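/- Let $S$ be a scheme or an algebraic space and let $f\colon X=\mathrm{Spec}_S(\mathcal A)\to S$ be an affine morphism, endowed with an action $\mu\colon \mathbb G_{a,S}\times_S X\to X$ of the additive group scheme over $S$. Let $D=\{D^{(i)}\}_{i\ge 0}$ be the associated locally finite iterative higher derivation (LFIHD) of $\mathcal A$, so that $\mu^*(a)=\sum_{i\ge0} D^{(i)}(a)\,t^i\in\mathcal A[t]$. For $n\ge 0$ put $\mathcal F_n=\bigcap_{i>n}\mathrm{Ker}\,D^{(i)}\subset\mathcal A$, let $\mathcal A_0=\mathcal F_0$ be the algebra of invariants and $X_0=\mathrm{Spec}_S(\mathcal A_0)$, and let $$\mathcal R(X,\mu)=\bigoplus_{n\ge0}\mathcal F_n\,\upsilon^n\subset\mathcal A[\upsilon]$$ be the Rees algebra, graded by the degree in $\upsilon$, where $\upsilon$ itself is the element $1\in\mathcal F_1$ placed in degree $1$. Let $\upsilon\mathcal R(D)=\{\upsilon^i\mathcal R(D)^{(i)}\}_{i\ge 0}$ be the homogeneous LFIHD of degree $0$ of $\mathcal R(X,\mu)$ whose $i$-th operator is, on the component of degree $n$, the composite of $D^{(i)}\colon\mathcal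 F_n\to\mathcal F_{n-i}$ with the inclusion $\mathcal F_{n-i}\subset\mathcal F_n$ (with $\mathcal F_m=0$ for $m<0$). Let $$j\colon X\cong\mathrm{Proj}_S(\mathcal A[\upsilon])\longrightarrow \mathrm{Proj}_S(\mathcal R(X,\mu))$$ be the $S$-morphism induced by the inclusion $\mathcal R(X,\mu)\subset\mathcal A[\upsilon]$. Then: 1. $j$ is an open immersion over $S$, and its image is the complement of the closed subset $V_+(\upsilon)$. 2. $\upsilon\mathcal R(D)$ determines an action of $\mathbb G_{a,S}$ on $\mathrm{Proj}_S(\mathcal R(X,\mu))$ over $S$, and $j$ is $\mathbb G_{a,S}$-equivariant for the action $\mu$ on $X$ (the one given by $D$) and this action. 3. In this way $\mathrm{Proj}_S(\mathcal R(X,\mu))$ is a relative equivariant completion of $X$ over $X_0$: the composite of $j$ with the canonical morphism $r\colon\mathrm{Proj}_S(\mathcal R(X,\mu))\to X_0$ is the canonical morphism $X\to X_0$; $r$ is $\mathbb G_{a,S}$-invariant; and, over every affine étale chart $V\to S$, the image of $j$ is dense, $r$ is separated, and $r$ is proper whenever the ring $\mathcal R(X,\mu)(V)$ is a finitely generated $\mathcal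 A_0(V)$-algebra. -/

import Mathlib

universe u

namespace GaRees

open Polynomial

/-! ### Locally finite iterative higher derivations -/

/-- A locally finite iterative higher derivation (LFIHD) of the `B`-algebra `A`. -/
structure LFIHD (B A : Type u) [CommRing B] [CommRing A] [Algebra B A] where
  D : ℕ → A →ₗ[B] A
  zero : D 0 = LinearMap.id
  leibniz : ∀ (i : ℕ) (a b : A),
    D i (a * b) = ∑ p ∈ Finset.HasAntidiagonal.antidiagonal i, D p.1 a * D p.2 b
  iter : ∀ (i j : ℕ) (a : A), D i (D j a) = (i + j).choose i • D (i + j) a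
  locFin : ∀ a : A, ∃ n : ℕ, ∀ i, n < i → D i a = 0

section Grading

/-- A convenient criterion for a family of submodules to be a grading, in terms of projections. -/
@[reducible]
noncomputable def gradedOfProj {B R : Type u} [CommRing B] [CommRing R] [Algebra B R]
    (𝒜 : ℕ → Submodule B R) [SetLike.GradedMonoid 𝒜] (π : ℕ → R →+ R)
    (hmem : ∀ n x, π n x ∈ 𝒜 n)
    (hsame : ∀ n, ∀ x ∈ 𝒜 n, π n x = x) (hne : ∀ n m, n ≠ m → ∀ x ∈ 𝒜 n, π m x = 0)
    (hsum : ∀ x, ∃ s : Finset ℕ, x = ∑ n ∈ s, π n x) : GradedAlgebra 𝒜 :=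
  letI h : DirectSum.IsInternal 𝒜 := by
    classical
    constructor
    · rw [injective_iff_map_eq_zero]
      intro x hx
      have key : ∀ (y : DirectSum ℕ fun n => 𝒜 n) (m : ℕ),
          π m (DirectSum.coeAddMonoidHom 𝒜 y) = (y m : R) := by
        intro y m
        induction y using DirectSum.induction_on with
        | zero => simp
        | of n z =>
          rw [DirectSum.coeAddMonoidHom_of]
          by_cases hnm : n = m
          · subst hnm
            rw [hsame _ _ z.2, DirectSum.of_eq_same]
          · rw [hne _ _ hnm _ z.2, DirectSum.of_eq_of_ne _ _ _ (Ne.symm hnm)]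
            simp
        | add y z hy hz => rw [map_add, map_add, hy, hz]; simp
      ext m
      rw [← key, hx, map_zero]; simp
    · intro x
      obtain ⟨s, hs⟩ := hsum x
      refine ⟨∑ n ∈ s, DirectSum.of (fun n => 𝒜 n) n ⟨π n x, hmem n x⟩, ?_⟩
      rw [map_sum]
      simp only [DirectSum.coeAddMonoidHom_of]
      exact hs.symm
  { (inferInstance : SetLike.GradedMonoid 𝒜), h.chooseDecomposition with }

end Grading

lemma coeff_sum_monomial {A A' : Type u} [CommRing A] [CommRing A'] (φ : A →+ A') (p : A[X])
    (n : ℕ) : (∑ i ∈ p.support, monomial i (φ (p.coeff i))).coeff n = φ (p.coeff n) := by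
  simp only [finsetSum_coeff, coeff_monomial, Finset.sum_ite_eq', mem_support_iff, ne_eq]
  by_cases h : p.coeff n = 0 <;> simp [h]

/-- Apply an additive map to all the coefficients of a polynomial. -/
noncomputable def coeffMap {A A' : Type u} [CommRing A] [CommRing A'] (φ : A →+ A') :
    A[X] →+ A'[X] where
  toFun p := ∑ i ∈ p.support, monomial i (φ (p.coeff i))
  map_zero' := by simp
  map_add' p q := by
    ext n
    rw [coeff_add, coeff_sum_monomial, coeff_sum_monomial, coeff_sum_monomial, coeff_add, map_add]

@[simp]
lemma coeff_coeffMap {A A' : Type u} [CommRing A] [CommRing A'] (φ : A →+ A') (p : A[X]) (n : ℕ) :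
    (coeffMap φ p).coeff n = φ (p.coeff n) := coeff_sum_monomial φ p n

section PolyGrading

variable {B R : Type u} [CommRing B] [CommRing R] [Algebra B R] (𝒜 : ℕ → Submodule B R)

/-- The grading of `R[t]` induced by a grading of `R`, the variable `t` having degree `0`. -/
def polyGrading (n : ℕ) : Submodule B R[X] where
  carrier := {p | ∀ i, p.coeff i ∈ 𝒜 n}
  add_mem' hp hq i := by rw [coeff_add]; exact add_mem (hp i) (hq i)
  zero_mem' i := by simp
  smul_mem' b p hp i := by rw [coeff_smul]; exact Submodule.smul_mem _ _ (hp i)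

variable [GradedAlgebra 𝒜]

instance : SetLike.GradedMonoid (polyGrading 𝒜) where
  one_mem i := by
    rw [coeff_one]
    split_ifs
    · exact SetLike.GradedOne.one_mem
    · exact zero_mem _
  mul_mem m n p q hp hq i := by
    rw [coeff_mul]
    exact sum_mem fun x _ => SetLike.GradedMul.mul_mem (hp _) (hq _)

noncomputable instance : GradedAlgebra (polyGrading 𝒜) :=
  gradedOfProj _ (fun n => coeffMap (GradedRing.proj 𝒜 n))
    (fun n p i => by
      rw [coeff_coeffMap, GradedRing.proj_apply]; exact SetLike.coe_mem _)
    (fun n p hp => by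
      ext i
      rw [coeff_coeffMap, GradedRing.proj_apply, DirectSum.decompose_of_mem_same _ (hp i)])
    (fun n m h p hp => by
      ext i
      rw [coeff_coeffMap, GradedRing.proj_apply, DirectSum.decompose_of_mem_ne _ (hp i) h,
        coeff_zero])
    (fun p => by
      classical
      refine ⟨p.support.biUnion fun i => (DirectSum.decompose 𝒜 (p.coeff i)).support, ?_⟩
      ext i
      simp only [finsetSum_coeff, coeff_coeffMap, GradedRing.proj_apply]
      by_cases hi : i ∈ p.support
      · conv_lhs => rw [← DirectSum.sum_support_decompose 𝒜 (p.coeff i)]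
        refine Finset.sum_subset (Finset.subset_biUnion_of_mem
          (fun i => (DirectSum.decompose 𝒜 (p.coeff i)).support) hi) ?_
        intro n _ hn
        simpa using hn
      · simp only [mem_support_iff, not_not] at hi
        simp [hi])

end PolyGrading

/-- The standard grading of `A[υ]`, with `A` in degree `0` and `υ` in degree `1`. -/
def stdGrading (B A : Type u) [CommRing B] [CommRing A] [Algebra B A] (n : ℕ) :
    Submodule B A[X] where
  carrier := {p | ∀ m, m ≠ n → p.coeff m = 0}
  add_mem' hp hq m h := by rw [coeff_add, hp m h, hq m h, add_zero]
  zero_mem' m _ := by simp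
  smul_mem' b p hp m h := by rw [coeff_smul, hp m h, smul_zero]

instance (B A : Type u) [CommRing B] [CommRing A] [Algebra B A] :
    SetLike.GradedMonoid (stdGrading B A) where
  one_mem m h := by rw [coeff_one, if_neg h]
  mul_mem m n p q hp hq k hk := by
    rw [coeff_mul]
    refine Finset.sum_eq_zero fun x hx => ?_
    rw [Finset.HasAntidiagonal.mem_antidiagonal] at hx
    by_cases h : x.1 = m
    · rw [hq x.2 (by omega), mul_zero]
    · rw [hp x.1 h, zero_mul]

noncomputable instance (B A : Type u) [CommRing B] [CommRing A] [Algebra B A] :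
    GradedAlgebra (stdGrading B A) :=
  gradedOfProj _ (fun n => (monomial n).toAddMonoidHom.comp (lcoeff A n).toAddMonoidHom)
    (fun n p m h => by simp [coeff_monomial, Ne.symm h])
    (fun n p hp => by
      ext m
      by_cases h : m = n
      · subst h; simp
      · simp [coeff_monomial, Ne.symm h, hp m h])
    (fun n m h p hp => by simp [hp m (Ne.symm h)])
    (fun p => ⟨p.support, by simpa using p.as_sum_support⟩)

namespace LFIHD

variable {B A : Type u} [CommRing B] [CommRing A] [Algebra B A] (E : LFIHD B A)

lemma D_zero_apply (a : A) : E.D 0 a = a := by rw [E.zero]; rfl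

lemma D_one (i : ℕ) (hi : 0 < i) : E.D i (1 : A) = 0 := by
  induction i using Nat.strong_induction_on with
  | _ i ih =>
    have h := E.leibniz i 1 1
    obtain ⟨k, rfl⟩ : ∃ k, i = k + 1 := ⟨i - 1, by omega⟩
    rw [mul_one, Finset.Nat.sum_antidiagonal_eq_sum_range_succ_mk, Finset.sum_range_succ,
      Finset.sum_range_succ'] at h
    simp only [Nat.sub_zero, E.D_zero_apply, one_mul, Nat.sub_self, mul_one] at h
    rw [Finset.sum_eq_zero, zero_add] at h
    · simpa using h
    · intro j hj
      rw [Finset.mem_range] at hj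
      rw [ih (j + 1) (by omega) (by omega), zero_mul]

/-- The co-action `exp(tE) : A → A[t]`, `a ↦ ∑ᵢ Eᵢ(a) tⁱ`. -/
noncomputable def expFun (a : A) : A[X] :=
  ∑ i ∈ Finset.range ((E.locFin a).choose + 1), monomial i (E.D i a)

lemma coeff_expFun (a : A) (n : ℕ) : (E.expFun a).coeff n = E.D n a := by
  simp only [expFun, finsetSum_coeff, coeff_monomial, Finset.sum_ite_eq', Finset.mem_range]
  split_ifs with h
  · rfl
  · exact ((E.locFin a).choose_spec n (by omega)).symm

/-- The co-action `exp(tE) : A → A[t]`, `a ↦ ∑ᵢ Eᵢ(a) tⁱ`, as a ring homomorphism. -/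
noncomputable def exp : A →+* A[X] where
  toFun := E.expFun
  map_one' := by
    ext n
    rw [coeff_expFun, coeff_one]
    split_ifs with h
    · rw [h, D_zero_apply]
    · rw [E.D_one n (by omega)]
  map_zero' := by ext n; simp [coeff_expFun]
  map_add' a b := by ext n; simp [coeff_expFun]
  map_mul' a b := by
    ext n
    rw [coeff_mul, coeff_expFun, E.leibniz]
    simp only [coeff_expFun]

@[simp]
lemma coeff_exp (a : A) (n : ℕ) : (E.exp a).coeff n = E.D n a := E.coeff_expFun a n

/-- The filtration `F n = ⋂_{i > n} Ker Dᵢ`. -/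
def F (n : ℕ) : Submodule B A := ⨅ i, ⨅ (_ : n < i), LinearMap.ker (E.D i)

lemma mem_F {n : ℕ} {a : A} : a ∈ E.F n ↔ ∀ i, n < i → E.D i a = 0 := by
  simp [F]

lemma one_mem_F : (1 : A) ∈ E.F 0 := E.mem_F.2 fun i hi => E.D_one i hi

lemma F_mono : Monotone E.F := fun _ _ h _ ha =>
  E.mem_F.2 fun i hi => E.mem_F.1 ha i (lt_of_le_of_lt h hi)

lemma mul_mem_F {m n : ℕ} {a b : A} (ha : a ∈ E.F m) (hb : b ∈ E.F n) :
    a * b ∈ E.F (m + n) := by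
  rw [mem_F] at *
  intro i hi
  rw [E.leibniz]
  refine Finset.sum_eq_zero fun p hp => ?_
  rw [Finset.HasAntidiagonal.mem_antidiagonal] at hp
  by_cases h : m < p.1
  · rw [ha _ h, zero_mul]
  · rw [hb p.2 (by omega), mul_zero]

lemma D_mem_F {n : ℕ} {a : A} (i : ℕ) (ha : a ∈ E.F (n + i)) : E.D i a ∈ E.F n := by
  rw [mem_F] at *
  intro j hj
  rw [E.iter, ha _ (by omega), smul_zero]

lemma D_mem_F' {n : ℕ} {a : A} (i : ℕ) (ha : a ∈ E.F n) : E.D i a ∈ E.F n :=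
  E.D_mem_F i (E.F_mono (Nat.le_add_right n i) ha)

/-- The subalgebra `A₀ = F 0` of invariants. -/
def inv : Subalgebra B A where
  carrier := E.F 0
  mul_mem' ha hb := by simpa using! E.mul_mem_F ha hb
  add_mem' ha hb := add_mem ha hb
  algebraMap_mem' b := by
    rw [Algebra.algebraMap_eq_smul_one]
    exact Submodule.smul_mem _ _ E.one_mem_F

/-- The Rees algebra `⨁ₙ Fₙ υⁿ`, as a subalgebra of `A[υ]`. -/
def rees : Subalgebra B A[X] where
  carrier := {p | ∀ n, p.coeff n ∈ E.F n}
  mul_mem' {p q} hp hq n := by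
    rw [coeff_mul]
    refine sum_mem fun x hx => ?_
    rw [Finset.HasAntidiagonal.mem_antidiagonal] at hx
    rw [← hx]
    exact E.mul_mem_F (hp _) (hq _)
  add_mem' hp hq n := by rw [coeff_add]; exact add_mem (hp n) (hq n)
  algebraMap_mem' b n := by
    rw [Polynomial.algebraMap_apply, coeff_C]
    split_ifs with h
    · rw [h]; exact E.inv.algebraMap_mem b
    · exact zero_mem _

/-- The homogeneous component `Fₙ υⁿ` of the Rees algebra. -/
noncomputable def reesGrading (n : ℕ) : Submodule B E.rees :=
  (stdGrading B A n).comap E.rees.val.toLinearMap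

lemma mem_reesGrading {n : ℕ} {p : E.rees} :
    p ∈ E.reesGrading n ↔ ∀ m, m ≠ n → (p : A[X]).coeff m = 0 := Iff.rfl

instance : SetLike.GradedMonoid E.reesGrading where
  one_mem := (SetLike.GradedOne.one_mem : (1 : A[X]) ∈ stdGrading B A 0)
  mul_mem m n p q hp hq :=
    (SetLike.GradedMul.mul_mem hp hq : (p * q : A[X]) ∈ stdGrading B A (m + n))

/-- The element `a υⁿ` of the Rees algebra, for `a ∈ F n`. -/
noncomputable def reesMonomial (n : ℕ) (a : A) (ha : a ∈ E.F n) : E.rees :=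
  ⟨monomial n a, fun m => by
    rw [coeff_monomial]
    split_ifs with h
    · rwa [← h]
    · exact zero_mem _⟩

lemma reesMonomial_mem (n : ℕ) (a : A) (ha : a ∈ E.F n) :
    E.reesMonomial n a ha ∈ E.reesGrading n := fun m h => by
  simp [reesMonomial, coeff_monomial, Ne.symm h]

noncomputable instance : GradedAlgebra E.reesGrading :=
  gradedOfProj _ (fun n =>
      { toFun := fun p => E.reesMonomial n ((p : A[X]).coeff n) (p.2 n)
        map_zero' := Subtype.ext (by simp [reesMonomial])
        map_add' := fun p q => Subtype.ext (by simp [reesMonomial]) })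
    (fun n p => E.reesMonomial_mem n _ (p.2 n))
    (fun n p hp => by
      ext m
      by_cases h : m = n
      · subst h; simp [reesMonomial]
      · rw [E.mem_reesGrading.1 hp m h]; simp [reesMonomial, coeff_monomial, Ne.symm h])
    (fun n m h p hp => Subtype.ext (by
      simp [reesMonomial, E.mem_reesGrading.1 hp m (Ne.symm h)]))
    (fun p => ⟨(p : A[X]).support, Subtype.ext (by
      simpa [reesMonomial] using (p : A[X]).as_sum_support)⟩)

/-- The element `υ`, i.e. `1 ∈ F 1` viewed in degree `1`. -/
noncomputable def υ : E.rees := E.reesMonomial 1 1 (E.F_mono zero_le_one E.one_mem_F)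

lemma coeff_divX_iterate (p : A[X]) (i n : ℕ) : (divX^[i] p).coeff n = p.coeff (n + i) := by
  induction i generalizing n with
  | zero => rfl
  | succ i ih => rw [Function.iterate_succ_apply', coeff_divX, ih]; congr 1; omega

/-- The operator `R(D)⁽ⁱ⁾` of the Rees algebra, homogeneous of degree `-i`: it is
`Dᵢ : Fₙ → F_{n-i}` on the component of degree `n`. -/
noncomputable def reesD (i : ℕ) : E.rees →ₗ[B] E.rees where
  toFun p := ⟨coeffMap (E.D i).toAddMonoidHom (divX^[i] (p : A[X])), fun n => by
    rw [coeff_coeffMap, coeff_divX_iterate]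
    exact E.D_mem_F i (p.2 (n + i))⟩
  map_add' p q := Subtype.ext <| by
    ext n
    simp [coeff_divX_iterate]
  map_smul' b p := Subtype.ext <| by
    ext n
    simp [coeff_divX_iterate]

lemma coeff_reesD (i n : ℕ) (p : E.rees) :
    (E.reesD i p : A[X]).coeff n = E.D i ((p : A[X]).coeff (n + i)) := by
  simp [reesD, coeff_divX_iterate]

/-- The operator `υⁱ R(D)⁽ⁱ⁾` of the Rees algebra, homogeneous of degree `0`. -/
noncomputable def υreesD (i : ℕ) : E.rees →ₗ[B] E.rees :=
  LinearMap.mulLeft B (E.υ ^ i) ∘ₗ E.reesD i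

lemma coe_υ : (E.υ : A[X]) = X := by
  simp [υ, reesMonomial, monomial_one_one_eq_X]

lemma coeff_υreesD (i n : ℕ) (p : E.rees) :
    (E.υreesD i p : A[X]).coeff n = E.D i ((p : A[X]).coeff n) := by
  simp only [υreesD, LinearMap.comp_apply, LinearMap.mulLeft_apply, MulMemClass.coe_mul,
    SubmonoidClass.coe_pow, coe_υ, coeff_X_pow_mul', coeff_reesD]
  split_ifs with h
  · rw [Nat.sub_add_cancel h]
  · exact (E.mem_F.1 (p.2 n) i (by omega)).symm

/-- The LFIHD `υR(D) = {υⁱ R(D)⁽ⁱ⁾}` of the Rees algebra. -/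
noncomputable def υR : LFIHD B E.rees where
  D := E.υreesD
  zero := by
    ext p n
    rw [coeff_υreesD, D_zero_apply]; rfl
  leibniz i p q := Subtype.ext <| by
    ext n
    rw [coeff_υreesD, MulMemClass.coe_mul, coeff_mul, map_sum, AddSubmonoidClass.coe_finsetSum,
      finsetSum_coeff]
    simp only [MulMemClass.coe_mul, coeff_mul, coeff_υreesD, E.leibniz]
    exact Finset.sum_comm
  iter i j p := Subtype.ext <| by
    ext n
    rw [coeff_υreesD, coeff_υreesD, E.iter, AddSubmonoidClass.coe_nsmul, coeff_smul,
      coeff_υreesD]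
  locFin p := ⟨(p : A[X]).natDegree, fun i hi => Subtype.ext <| by
    ext n
    rw [coeff_υreesD, ZeroMemClass.coe_zero, coeff_zero]
    by_cases h : n ≤ (p : A[X]).natDegree
    · exact E.mem_F.1 (p.2 n) i (by omega)
    · rw [coeff_eq_zero_of_natDegree_lt (by omega), map_zero]⟩

lemma υR_mem (i : ℕ) {n : ℕ} {p : E.rees} (hp : p ∈ E.reesGrading n) :
    E.υR.D i p ∈ E.reesGrading n := fun m h => by
  change (E.υreesD i p : A[X]).coeff m = 0
  rw [coeff_υreesD, E.mem_reesGrading.1 hp m h, map_zero]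

end LFIHD

end GaRees

namespace GaRees

open Polynomial AlgebraicGeometry CategoryTheory Limits

section ProjAction

variable {B R : Type u} [CommRing B] [CommRing R] [Algebra B R] (𝒜 : ℕ → Submodule B R)
  [GradedAlgebra 𝒜]

/-- The inclusion `R → R[t]`, as a homomorphism of graded rings. -/
noncomputable def constHom : GradedRingHom 𝒜 (polyGrading 𝒜) where
  toRingHom := C
  map_mem {n a} ha i := by
    rw [coeff_C]
    split_ifs
    · exact ha
    · exact zero_mem _

@[simp] lemma constHom_apply (a : R) : constHom 𝒜 a = C a := rfl

/-- The homomorphism `exp(tE) : R → R[t]` for an LFIHD `E` of degree `0`, as a homomorphism of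
graded rings. -/
noncomputable def expHom (E : LFIHD B R) (hE : ∀ (i n : ℕ) (a : R), a ∈ 𝒜 n → E.D i a ∈ 𝒜 n) :
    GradedRingHom 𝒜 (polyGrading 𝒜) where
  toRingHom := E.exp
  map_mem {n a} ha i := by
    rw [E.coeff_exp]
    exact hE i n a ha

open HomogeneousIdeal in
lemma irrelevant_le_of_homogeneous {R R' : Type u} [CommRing R] [CommRing R'] {σ σ' : Type u}
    [SetLike σ R] [AddSubgroupClass σ R] [SetLike σ' R'] [AddSubgroupClass σ' R']
    {𝒜 : ℕ → σ} {ℬ : ℕ → σ'} [GradedRing 𝒜] [GradedRing ℬ] (f : GradedRingHom 𝒜 ℬ)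
    (h : ∀ n, 0 < n → ∀ b ∈ ℬ n, b ∈ Ideal.span (f '' (𝒜 n : Set R))) :
    irrelevant ℬ ≤ (irrelevant 𝒜).map f := by
  rw [← toIdeal_le_toIdeal_iff, toIdeal_irrelevant_le]
  intro n hn b hb
  refine Ideal.span_le.2 ?_ (h n hn b hb)
  rintro _ ⟨a, ha, rfl⟩
  exact Ideal.mem_map_of_mem f (mem_irrelevant_of_mem 𝒜 hn ha)

lemma constHom_irrelevant :
    HomogeneousIdeal.irrelevant (polyGrading 𝒜) ≤
      (HomogeneousIdeal.irrelevant 𝒜).map (constHom 𝒜) := by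
  refine irrelevant_le_of_homogeneous _ fun n _ p hp => ?_
  rw [p.as_sum_support_C_mul_X_pow]
  exact sum_mem fun i _ => Ideal.mul_mem_right _ _ (Ideal.subset_span ⟨_, hp i, rfl⟩)

lemma LFIHD.sum_exp (E : LFIHD B R) (a : R) (N : ℕ) (hN : ∀ i, N < i → E.D i a = 0) :
    ∑ j ∈ Finset.range (N + 1), (-X) ^ j * E.exp (E.D j a) = C a := by
  ext k
  have h1 : ∀ j, ((-X : R[X]) ^ j * E.exp (E.D j a)).coeff k =
      if j ≤ k then (-1 : ℤ) ^ j • (k.choose j • E.D k a) else 0 := by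
    intro j
    rw [neg_pow, mul_assoc, ← C_1, ← C_neg, ← C_pow, coeff_C_mul, coeff_X_pow_mul']
    split_ifs with h
    · rw [E.coeff_exp, E.iter, Nat.sub_add_cancel h, Nat.choose_symm h, zsmul_eq_mul]
      push_cast
      rfl
    · rw [mul_zero]
  rw [finsetSum_coeff, Finset.sum_congr rfl fun j _ => h1 j, coeff_C]
  by_cases hk : N < k
  · rw [hN k hk, if_neg (by omega)]
    simp
  · rw [← Finset.sum_filter]
    have h2 : (Finset.range (N + 1)).filter (· ≤ k) = Finset.range (k + 1) := by
      ext j; simp; omega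
    rw [h2]
    have h3 : ∀ j ∈ Finset.range (k + 1), (-1 : ℤ) ^ j • (k.choose j • E.D k a) =
        ((-1 : ℤ) ^ j * (k.choose j : ℤ)) • E.D k a := by
      intro j _
      rw [mul_smul, natCast_zsmul]
    rw [Finset.sum_congr rfl h3, ← Finset.sum_smul, Int.alternating_sum_range_choose]
    split_ifs with h
    · rw [h, E.D_zero_apply, one_smul]
    · rw [zero_smul]

lemma expHom_irrelevant (E : LFIHD B R)
    (hE : ∀ (i n : ℕ) (a : R), a ∈ 𝒜 n → E.D i a ∈ 𝒜 n) :
    HomogeneousIdeal.irrelevant (polyGrading 𝒜) ≤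
      (HomogeneousIdeal.irrelevant 𝒜).map (expHom 𝒜 E hE) := by
  refine irrelevant_le_of_homogeneous _ fun n _ p hp => ?_
  rw [p.as_sum_support_C_mul_X_pow]
  refine sum_mem fun i _ => Ideal.mul_mem_right _ _ ?_
  obtain ⟨N, hN⟩ := E.locFin (p.coeff i)
  rw [← E.sum_exp _ N hN]
  exact sum_mem fun j _ => Ideal.mul_mem_left _ _
    (Ideal.subset_span ⟨E.D j (p.coeff i), hE j n _ (hp i), rfl⟩)

lemma X_mem_polyGrading : (X : R[X]) ∈ polyGrading 𝒜 0 := fun i => by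
  rw [coeff_X]
  split_ifs
  · exact SetLike.GradedOne.one_mem
  · exact zero_mem _

/-- The global function `t` on `Proj R[t]`. -/
noncomputable def tSection : Γ(Proj (polyGrading 𝒜), ⊤) :=
  (Proj.toSpecZero (polyGrading 𝒜)).appTop
    ((Scheme.ΓSpecIso (.of (polyGrading 𝒜 0))).inv ⟨X, X_mem_polyGrading 𝒜⟩)

/-- The canonical morphism `Proj R[t] ⟶ 𝔸¹ × Proj R`. -/
noncomputable def projPolyTo : Proj (polyGrading 𝒜) ⟶ 𝔸(PUnit.{u + 1}; Proj 𝒜) :=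
  AffineSpace.homOfVector (Proj.map (constHom 𝒜) (constHom_irrelevant 𝒜))
    (fun _ => tSection 𝒜)

/-- The canonical homomorphism `R_(f)[t] → R[t]_(f)`. -/
noncomputable def awayPoly (f : R) :
    MvPolynomial PUnit.{u + 1} (HomogeneousLocalization.Away 𝒜 f) →+*
      HomogeneousLocalization.Away (polyGrading 𝒜) (constHom 𝒜 f) :=
  MvPolynomial.eval₂Hom (HomogeneousLocalization.Away.map (constHom 𝒜) f)
    (fun _ => HomogeneousLocalization.fromZeroRingHom (polyGrading 𝒜) _
      ⟨X, X_mem_polyGrading 𝒜⟩)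

lemma awayPoly_C_val {n : ℕ} {f : R} (hf : f ∈ 𝒜 n) (k : ℕ) (a : R) (ha : a ∈ 𝒜 (k • n)) :
    (awayPoly 𝒜 f (MvPolynomial.C (HomogeneousLocalization.Away.mk 𝒜 hf k a ha))).val *
      algebraMap R[X] (Localization.Away (constHom 𝒜 f)) (constHom 𝒜 f) ^ k =
      algebraMap R[X] (Localization.Away (constHom 𝒜 f)) (C a) := by
  rw [awayPoly, MvPolynomial.eval₂Hom_C, HomogeneousLocalization.Away.map_mk,
    HomogeneousLocalization.Away.val_mk, Localization.mk_eq_mk']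
  exact (congrArg (_ * ·) (map_pow (algebraMap R[X] (Localization.Away (constHom 𝒜 f))) _ k).symm).trans
    (IsLocalization.mk'_spec _ _ _)

lemma awayPoly_X_val (f : R) (i : PUnit.{u + 1}) :
    (awayPoly 𝒜 f (MvPolynomial.X i)).val =
      algebraMap R[X] (Localization.Away (constHom 𝒜 f)) X := by
  rw [awayPoly, MvPolynomial.eval₂Hom_X']
  rfl

lemma awayPoly_injective {n : ℕ} (f : R) (hf : f ∈ 𝒜 n) : Function.Injective (awayPoly 𝒜 f) := by
  let g : R[X] →+* MvPolynomial PUnit.{u + 1} (Localization.Away f) :=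
    eval₂RingHom (MvPolynomial.C.comp (algebraMap R (Localization.Away f)))
        (MvPolynomial.X PUnit.unit)
  have hg : ∀ a : R, g (C a) = MvPolynomial.C (algebraMap R (Localization.Away f) a) :=
    fun a => by simp [g]
  have hu : IsUnit (g (constHom 𝒜 f)) := by
    rw [constHom_apply, hg]
    exact (IsLocalization.Away.algebraMap_isUnit f).map MvPolynomial.C
  let ℓ : Localization.Away (constHom 𝒜 f) →+*
      MvPolynomial PUnit.{u + 1} (Localization.Away f) :=
    IsLocalization.Away.lift (constHom 𝒜 f) hu
  have hℓ : ∀ p : R[X], ℓ (algebraMap _ _ p) = g p := fun p =>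
    IsLocalization.Away.lift_eq (constHom 𝒜 f) hu p
  have hval : Function.Injective (algebraMap (HomogeneousLocalization.Away 𝒜 f)
      (Localization.Away f)) := HomogeneousLocalization.val_injective _
  have key : (ℓ.comp (algebraMap (HomogeneousLocalization.Away (polyGrading 𝒜) (constHom 𝒜 f))
      (Localization.Away (constHom 𝒜 f)))).comp (awayPoly 𝒜 f) =
      MvPolynomial.map (algebraMap (HomogeneousLocalization.Away 𝒜 f)
        (Localization.Away f)) := by
    apply MvPolynomial.ringHom_ext
    · intro z
      obtain ⟨k, a, ha, rfl⟩ := z.mk_surjective _ hf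
      have h1 := congrArg ℓ (awayPoly_C_val 𝒜 hf k a ha)
      rw [map_mul, map_pow, hℓ, hℓ, hg] at h1
      apply (hu.pow k).mul_right_cancel
      refine h1.trans ?_
      rw [MvPolynomial.map_C, constHom_apply, hg, ← map_pow, ← map_mul,
        HomogeneousLocalization.algebraMap_apply, HomogeneousLocalization.Away.val_mk,
        Localization.mk_eq_mk', ← map_pow]
      exact congrArg _ (IsLocalization.mk'_spec _ _ _).symm
    · intro i
      have h1 := congrArg ℓ (awayPoly_X_val 𝒜 f i)
      refine h1.trans ?_
      rw [hℓ, MvPolynomial.map_X]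
      simp [g]
  have h2 : Function.Injective ((ℓ.comp (algebraMap (HomogeneousLocalization.Away (polyGrading 𝒜)
      (constHom 𝒜 f)) (Localization.Away (constHom 𝒜 f)))).comp (awayPoly 𝒜 f)) := by
    rw [key]
    exact MvPolynomial.map_injective _ hval
  rw [RingHom.coe_comp] at h2
  exact Function.Injective.of_comp h2

lemma awayPoly_surjective {n : ℕ} (f : R) (hf : f ∈ 𝒜 n) :
    Function.Surjective (awayPoly 𝒜 f) := by
  intro z
  obtain ⟨k, a, ha, rfl⟩ := z.mk_surjective _ ((constHom 𝒜).map_mem hf)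
  refine ⟨∑ i ∈ a.support, MvPolynomial.C (HomogeneousLocalization.Away.mk 𝒜 hf k (a.coeff i)
    (ha i)) * (MvPolynomial.X PUnit.unit) ^ i, ?_⟩
  apply HomogeneousLocalization.val_injective
  apply ((IsLocalization.Away.algebraMap_isUnit (S := Localization.Away (constHom 𝒜 f))
    (constHom 𝒜 f)).pow k).mul_right_cancel
  rw [HomogeneousLocalization.Away.val_mk, Localization.mk_eq_mk', ← map_pow]
  refine Eq.trans ?_ (IsLocalization.mk'_spec _ _ _).symm
  rw [map_sum, ← HomogeneousLocalization.algebraMap_apply, map_sum, Finset.sum_mul]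
  conv_rhs => rw [a.as_sum_support_C_mul_X_pow, map_sum]
  refine Finset.sum_congr rfl fun i _ => ?_
  rw [map_mul, map_mul, map_pow, map_pow, map_mul, map_pow, ← awayPoly_C_val 𝒜 hf k _ (ha i),
    HomogeneousLocalization.algebraMap_apply, HomogeneousLocalization.algebraMap_apply,
    awayPoly_X_val, map_pow]
  ring

end ProjAction

section ProjAction

variable {B R : Type u} [CommRing B] [CommRing R] [Algebra B R] (𝒜 : ℕ → Submodule B R)
  [GradedAlgebra 𝒜]

lemma projPolyTo_isPullback {n : ℕ} (hn : 0 < n) (f : R) (hf : f ∈ 𝒜 n) :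
    ∃ u : Spec (.of (HomogeneousLocalization.Away (polyGrading 𝒜) (constHom 𝒜 f))) ⟶
      𝔸(PUnit.{u + 1}; Spec (.of (HomogeneousLocalization.Away 𝒜 f))), IsIso u ∧
      IsPullback (Proj.awayι (polyGrading 𝒜) (constHom 𝒜 f) ((constHom 𝒜).map_mem hf) hn) u
        (projPolyTo 𝒜) (AffineSpace.map PUnit.{u + 1} (Proj.awayι 𝒜 f hf hn)) := by
  let φ : CommRingCat.of (MvPolynomial PUnit.{u + 1} (HomogeneousLocalization.Away 𝒜 f)) ⟶
      .of (HomogeneousLocalization.Away (polyGrading 𝒜) (constHom 𝒜 f)) :=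
    CommRingCat.ofHom (awayPoly 𝒜 f)
  have hφ : IsIso φ := by
    rw [ConcreteCategory.isIso_iff_bijective]
    exact ⟨awayPoly_injective 𝒜 f hf, awayPoly_surjective 𝒜 f hf⟩
  let u := Spec.map φ ≫ (AffineSpace.SpecIso PUnit.{u + 1}
    (.of (HomogeneousLocalization.Away 𝒜 f))).inv
  have hu : IsIso u := inferInstance
  have h1 : IsPullback (Proj.awayι (polyGrading 𝒜) (constHom 𝒜 f) ((constHom 𝒜).map_mem hf) hn)
      (Spec.map (CommRingCat.ofHom (HomogeneousLocalization.Away.map (constHom 𝒜) f)))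
      (Proj.map (constHom 𝒜) (constHom_irrelevant 𝒜)) (Proj.awayι 𝒜 f hf hn) := by
    refine (IsOpenImmersion.isPullback _ _ _ _
      (Proj.awayι_comp_map (constHom 𝒜) (constHom_irrelevant 𝒜) hn f hf) ?_).flip
    rw [Proj.opensRange_awayι, Proj.opensRange_awayι, Proj.map_preimage_basicOpen]
  have h2 := (AffineSpace.isPullback_map (n := PUnit.{u + 1}) (Proj.awayι 𝒜 f hf hn)).flip
  have e : u ≫ 𝔸(PUnit.{u + 1}; _) ↘ Spec (.of (HomogeneousLocalization.Away 𝒜 f)) =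
      Spec.map (CommRingCat.ofHom (HomogeneousLocalization.Away.map (constHom 𝒜) f)) := by
    simp only [u, Category.assoc]
    rw [AffineSpace.SpecIso_inv_over, ← Spec.map_comp, ← CommRingCat.ofHom_comp]
    congr 2
    exact MvPolynomial.eval₂Hom_comp_C _ _
  refine ⟨u, hu, IsPullback.of_bot (h₃₁ := Proj.awayι 𝒜 f hf hn)
    (v₂₁ := 𝔸(PUnit.{u + 1}; _) ↘ Spec (.of (HomogeneousLocalization.Away 𝒜 f)))
    (v₂₂ := 𝔸(PUnit.{u + 1}; Proj 𝒜) ↘ Proj 𝒜) ?_ ?_ h2.flip⟩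
  · rw [e, projPolyTo, AffineSpace.homOfVector_over]
    exact h1
  · apply AffineSpace.hom_ext
    · rw [Category.assoc, Category.assoc, AffineSpace.map_over, reassoc_of% e, projPolyTo,
        AffineSpace.homOfVector_over]
      exact h1.w
    · intro i
      simp only [Scheme.Hom.comp_appTop, CommRingCat.comp_apply, projPolyTo]
      rw [AffineSpace.homOfVector_appTop_coord, AffineSpace.map_appTop_coord]
      simp only [u, Scheme.Hom.comp_appTop, CommRingCat.comp_apply]
      rw [AffineSpace.SpecIso_inv_appTop_coord, tSection, ← CommRingCat.comp_apply,
        ← Scheme.Hom.comp_appTop, Proj.awayι_toSpecZero, ← CommRingCat.comp_apply,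
        ← CommRingCat.comp_apply, ← Scheme.ΓSpecIso_inv_naturality,
        ← Scheme.ΓSpecIso_inv_naturality, CommRingCat.comp_apply, CommRingCat.comp_apply]
      rw [show φ (MvPolynomial.X i) = CommRingCat.ofHom (HomogeneousLocalization.fromZeroRingHom
        (polyGrading 𝒜) (.powers (constHom 𝒜 f))) ⟨X, X_mem_polyGrading 𝒜⟩ from
        MvPolynomial.eval₂Hom_X' _ _ _]

instance : IsIso (projPolyTo 𝒜) := by
  let 𝒰 := (Proj.affineOpenCover 𝒜).openCover.pullback₁ (𝔸(PUnit.{u + 1}; Proj 𝒜) ↘ Proj 𝒜)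
  change MorphismProperty.isomorphisms Scheme (projPolyTo 𝒜)
  refine IsZariskiLocalAtTarget.of_openCover 𝒰 fun i => ?_
  obtain ⟨u, hu, h⟩ := projPolyTo_isPullback 𝒜 i.1.2 i.2.1 i.2.2
  have h3 : IsPullback (AffineSpace.map PUnit.{u + 1} (Proj.awayι 𝒜 i.2.1 i.2.2 i.1.2))
      (𝔸(PUnit.{u + 1}; Spec (.of (HomogeneousLocalization.Away 𝒜 i.2.1))) ↘
        Spec (.of (HomogeneousLocalization.Away 𝒜 i.2.1))) (𝔸(PUnit.{u + 1}; Proj 𝒜) ↘ Proj 𝒜)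
      ((Proj.affineOpenCover 𝒜).openCover.f i) := AffineSpace.isPullback_map (n := PUnit.{u + 1})
    (Proj.awayι 𝒜 i.2.1 i.2.2 i.1.2)
  let e : 𝔸(PUnit.{u + 1}; (Proj.affineOpenCover 𝒜).openCover.X i) ≅ 𝒰.X i := h3.isoPullback
  have he : e.hom ≫ 𝒰.f i = AffineSpace.map PUnit.{u + 1} (Proj.awayι 𝒜 i.2.1 i.2.2 i.1.2) :=
    h3.isoPullback_hom_fst
  have h4 : IsPullback (Proj.awayι (polyGrading 𝒜) (constHom 𝒜 i.2.1)
      ((constHom 𝒜).map_mem i.2.2) i.1.2) (u ≫ e.hom) (projPolyTo 𝒜) (𝒰.f i) :=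
    h.of_iso (Iso.refl _) (Iso.refl _) e (Iso.refl _) ((Category.comp_id _).trans (Category.id_comp _).symm)
      (Category.id_comp _).symm ((Category.comp_id _).trans (Category.id_comp _).symm)
      ((Category.comp_id _).trans he.symm)
  have h5 : h4.isoPullback.inv ≫ u ≫ e.hom = Scheme.Cover.pullbackHom 𝒰 (projPolyTo 𝒜) i :=
    h4.isoPullback_inv_snd
  rw [MorphismProperty.isomorphisms.iff, ← h5]
  have h6 : IsIso (u ≫ e.hom) := @IsIso.comp_isIso _ _ _ _ _ u e.hom hu e.isIso_hom
  exact @IsIso.comp_isIso _ _ _ _ _ h4.isoPullback.inv (u ≫ e.hom) h4.isoPullback.isIso_inv h6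

/-- The morphism `𝔸¹ × Proj R ⟶ Proj R` determined by an LFIHD of degree `0`: it is
the morphism `Proj R[t] ⟶ Proj R` induced by `exp(tE) : R → R[t]`. -/
noncomputable def projExp (E : LFIHD B R)
    (hE : ∀ (i n : ℕ) (a : R), a ∈ 𝒜 n → E.D i a ∈ 𝒜 n) :
    𝔸(PUnit.{u + 1}; Proj 𝒜) ⟶ Proj 𝒜 :=
  CategoryTheory.inv (projPolyTo 𝒜) ≫ Proj.map (expHom 𝒜 E hE) (expHom_irrelevant 𝒜 E hE)

end ProjAction

/-- The LFIHD determined by a co-action `c : A → A[t]` of the additive group: the operator `Dᵢ`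
is the coefficient of `tⁱ` in `c`. The compatibility with the group law is expressed through the
induced action `(r, ψ) ↦ (a ↦ ψ(c(a))(r))` of `r ∈ R` on ring homomorphisms `ψ : A → R`. -/
noncomputable def LFIHD.ofCoaction {B A : Type u} [CommRing B] [CommRing A] [Algebra B A] (c : A →+* A[X])
    (hB : ∀ b : B, c (algebraMap B A b) = C (algebraMap B A b))
    (hzero : ∀ a, eval₂ (RingHom.id A) 0 (c a) = a)
    (hadd : ∀ (R : Type u) [CommRing R] (ψ : A →+* R) (r s : R) (a : A),
      eval₂ ψ (r + s) (c a) = eval₂ ((eval₂RingHom ψ s).comp c) r (c a)) : LFIHD B A where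
  D i :=
    { toFun := fun a => (c a).coeff i
      map_add' := fun a b => by rw [map_add, coeff_add]
      map_smul' := fun b a => by
        rw [Algebra.smul_def, map_mul, hB, coeff_C_mul, RingHom.id_apply, Algebra.smul_def] }
  zero := by
    ext a
    have := hzero a
    rwa [eval₂_eq_sum_range, Finset.sum_range_succ', Finset.sum_eq_zero (fun i _ => by simp),
      zero_add, pow_zero, mul_one] at this
  leibniz i a b := by
    change (c (a * b)).coeff i = _
    rw [map_mul, coeff_mul]
    rfl
  iter i j a := by
    change (c ((c a).coeff j)).coeff i = (i + j).choose i • (c a).coeff (i + j)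
    have h := congrArg (fun p : A[X][X] => (p.coeff i).coeff j)
      (hadd A[X][X] (C.comp C) (C X) X a)
    simp only [eval₂_eq_sum_range, finsetSum_coeff] at h
    have h1 : ∀ n, (((C.comp C : A →+* A[X][X]) ((c a).coeff n) * (C X + X) ^ n).coeff i).coeff j =
        if n = i + j then (i + j).choose i • (c a).coeff (i + j) else 0 := by
      intro n
      rw [RingHom.comp_apply, coeff_C_mul, coeff_C_mul, add_comm, coeff_X_add_C_pow, ← nsmul_eq_mul', coeff_smul,
        mul_smul_comm, coeff_X_pow, mul_ite, mul_one, mul_zero, smul_ite, smul_zero]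
      rcases lt_or_ge n i with h3 | h3
      · rw [Nat.choose_eq_zero_of_lt h3, if_neg (show ¬ n = i + j by omega), zero_nsmul, ite_self]
      · split_ifs with h4 h5 h5
        · rw [h5]
        · omega
        · omega
        · rfl
    have h2 : ∀ n, ((((eval₂RingHom (C.comp C : A →+* A[X][X]) X).comp c) ((c a).coeff n) *
        (C X) ^ n).coeff i).coeff j =
        if n = j then (c ((c a).coeff j)).coeff i else 0 := by
      intro n
      have h3 : ∀ p : A[X], (eval₂RingHom (C.comp C : A →+* A[X][X]) X p) = p.map C := fun p => rfl
      rw [RingHom.comp_apply, h3, ← C_pow, coeff_mul_C, coeff_map, coeff_C_mul, coeff_X_pow,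
        mul_ite, mul_one, mul_zero]
      split_ifs with h4 h5 h5
      · rw [h4]
      · exact absurd h4.symm h5
      · exact absurd h5.symm h4
      · rfl
    rw [Finset.sum_congr rfl fun n _ => h1 n, Finset.sum_congr rfl fun n _ => h2 n,
      Finset.sum_ite_eq', Finset.sum_ite_eq'] at h
    have h5 : (i + j).choose i • (c a).coeff (i + j) = if i + j ∈ Finset.range ((c a).natDegree + 1)
        then (i + j).choose i • (c a).coeff (i + j) else 0 := by
      split_ifs with h6
      · rfl
      · rw [coeff_eq_zero_of_natDegree_lt (by simpa using h6), smul_zero]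
    have h7 : (c ((c a).coeff j)).coeff i = if j ∈ Finset.range ((c a).natDegree + 1)
        then (c ((c a).coeff j)).coeff i else 0 := by
      split_ifs with h6
      · rfl
      · rw [coeff_eq_zero_of_natDegree_lt (n := j) (by simpa using h6), map_zero, coeff_zero]
    rw [h5, h7, h]
  locFin a := ⟨(c a).natDegree, fun i hi => coeff_eq_zero_of_natDegree_lt hi⟩

/-- Presheaves on the category of schemes. -/
abbrev PSh := Scheme.{u}ᵒᵖ ⥤ Type (u + 1)

/-- The functor of points of a scheme. -/
abbrev yon : Scheme.{u} ⥤ PSh.{u} := uliftYoneda.{u + 1}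

/-- An algebraic space: a sheaf for the étale topology whose diagonal is representable by schemes
and that admits an étale surjection from a scheme. -/
structure IsAlgebraicSpace (S : PSh.{u}) : Prop where
  isSheaf : Presheaf.IsSheaf Scheme.etaleTopology S
  diag : yon.relativelyRepresentable (diag S)
  exists_cover : ∃ (U : Scheme.{u}) (p : yon.obj U ⟶ S),
    MorphismProperty.relative yon @Etale p ∧ MorphismProperty.relative yon @Surjective p

/-- `f : X ⟶ S` is an affine morphism, that is, `X = Spec_S A` for a quasi-coherent
`𝒪_S`-algebra `A`. -/
abbrev AffineOver {X S : PSh.{u}} (f : X ⟶ S) : Prop :=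
  MorphismProperty.relative yon @IsAffineHom f

/-- `smul` is an action of the additive group `𝔾ₐ` over `S` on `f : X ⟶ S`: on `T`-points,
the group `𝔾ₐ(T) = Γ(T, ⊤)` acts on the set `X(T) = Hom(T, X)` over `S(T)`, functorially in `T`. -/
structure IsGaAction {X S : PSh.{u}} (f : X ⟶ S)
    (smul : ∀ T : Scheme.{u}, Γ(T, ⊤) → (yon.obj T ⟶ X) → (yon.obj T ⟶ X)) : Prop where
  zero_smul : ∀ (T : Scheme.{u}) (x : yon.obj T ⟶ X), smul T 0 x = x
  add_smul : ∀ (T : Scheme.{u}) (a b : Γ(T, ⊤)) (x : yon.obj T ⟶ X),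
    smul T (a + b) x = smul T a (smul T b x)
  smul_comp : ∀ (T : Scheme.{u}) (a : Γ(T, ⊤)) (x : yon.obj T ⟶ X), smul T a x ≫ f = x ≫ f
  naturality : ∀ (T T' : Scheme.{u}) (g : T' ⟶ T) (a : Γ(T, ⊤)) (x : yon.obj T ⟶ X),
    yon.map g ≫ smul T a x = smul T' (g.appTop a) (yon.map g ≫ x)

/-- An affine étale chart `V = Spec B ⟶ S`. Quasi-coherent algebras on `S`, and the relative
spectra and homogeneous spectra of such algebras, are described through these charts. -/
structure Chart (S : PSh.{u}) where
  ring : CommRingCat.{u}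
  pt : yon.obj (Spec ring) ⟶ S
  etale : MorphismProperty.relative yon @Etale pt

namespace Chart

/-- A morphism `V' ⟶ V` of affine étale charts over `S`. -/
structure Hom {S : PSh.{u}} (V' V : Chart S) where
  φ : V.ring ⟶ V'.ring
  w : yon.map (Spec.map φ) ≫ V.pt = V'.pt

variable {S : PSh.{u}}

lemma Hom.etale {V' V : Chart S} (h : V'.Hom V) : Etale (Spec.map h.φ) := by
  have h1 : Etale (V.etale.rep.snd V'.pt) := V.etale.property_snd V'.pt
  have h2 : Etale (V.etale.rep.fst' V'.pt) :=
    V'.etale.property V.pt _ _ (V.etale.rep.isPullback' V'.pt).flip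
  let s : Spec V'.ring ⟶ V.etale.rep.pullback V'.pt := V.etale.rep.lift' (Spec.map h.φ) (𝟙 _)
    (by simp [h.w])
  have hs : s ≫ V.etale.rep.snd V'.pt = 𝟙 _ := V.etale.rep.lift'_snd _ _ _
  have hs' : s ≫ V.etale.rep.fst' V'.pt = Spec.map h.φ := V.etale.rep.lift'_fst _ _ _
  have h3 : Etale s := by
    have : Etale (s ≫ V.etale.rep.snd V'.pt) := by rw [hs]; infer_instance
    exact Etale.of_comp s (V.etale.rep.snd V'.pt)
  rw [← hs']
  infer_instance

lemma Hom.flat {V' V : Chart S} (h : V'.Hom V) : h.φ.hom.Flat := by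
  have := h.etale
  have : Flat (Spec.map h.φ) := inferInstance
  rwa [HasRingHomProperty.Spec_iff (P := @Flat)] at this

end Chart

section Coordinates

variable {X S : PSh.{u}} {f : X ⟶ S} (hf : AffineOver f)

/-- The affine scheme `X ×_S V`, for an affine chart `V`. -/
noncomputable def XV (V : Chart S) : Scheme.{u} := hf.rep.pullback V.pt

noncomputable def XV.fst (V : Chart S) : yon.obj (XV hf V) ⟶ X := hf.rep.fst V.pt

noncomputable def XV.snd (V : Chart S) : XV hf V ⟶ Spec V.ring := hf.rep.snd V.pt

lemma XV.isPullback (V : Chart S) :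
    IsPullback (XV.fst hf V) (yon.map (XV.snd hf V)) f V.pt := hf.rep.isPullback V.pt

instance (V : Chart S) : IsAffineHom (XV.snd hf V) := hf.property_snd V.pt

instance (V : Chart S) : IsAffine (XV hf V) := isAffine_of_isAffineHom (XV.snd hf V)

/-- The morphism to `X ×_S V` with given components. -/
noncomputable def XV.lift (V : Chart S) {T : Scheme.{u}} (x : yon.obj T ⟶ X) (v : T ⟶ Spec V.ring)
    (h : x ≫ f = yon.map v ≫ V.pt) : T ⟶ XV hf V := hf.rep.lift x v h

lemma XV.lift_fst (V : Chart S) {T : Scheme.{u}} (x : yon.obj T ⟶ X) (v : T ⟶ Spec V.ring)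
    (h : x ≫ f = yon.map v ≫ V.pt) : yon.map (XV.lift hf V x v h) ≫ XV.fst hf V = x :=
  hf.rep.lift_fst x v h

lemma XV.lift_snd (V : Chart S) {T : Scheme.{u}} (x : yon.obj T ⟶ X) (v : T ⟶ Spec V.ring)
    (h : x ≫ f = yon.map v ≫ V.pt) : XV.lift hf V x v h ≫ XV.snd hf V = v :=
  hf.rep.lift_snd x v h

lemma XV.lift_snd_assoc (V : Chart S) {T Z : Scheme.{u}} (x : yon.obj T ⟶ X)
    (v : T ⟶ Spec V.ring) (h : x ≫ f = yon.map v ≫ V.pt) (k : Spec V.ring ⟶ Z) :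
    XV.lift hf V x v h ≫ XV.snd hf V ≫ k = v ≫ k := by
  rw [← Category.assoc, XV.lift_snd]

lemma XV.hom_ext {V : Chart S} {T : Scheme.{u}} {a b : T ⟶ XV hf V}
    (h₁ : yon.map a ≫ XV.fst hf V = yon.map b ≫ XV.fst hf V)
    (h₂ : a ≫ XV.snd hf V = b ≫ XV.snd hf V) : a = b := hf.rep.hom_ext h₁ h₂

/-- The ring `A(V)` of sections of the algebra `A` over the chart `V`. -/
noncomputable abbrev coordRing (V : Chart S) : CommRingCat.{u} := Γ(XV hf V, ⊤)

/-- The structure morphism of the algebra `A(V)`. -/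
noncomputable def coordStr (V : Chart S) : V.ring ⟶ coordRing hf V :=
  (Scheme.ΓSpecIso V.ring).inv ≫ (XV.snd hf V).appTop

noncomputable instance (V : Chart S) : Algebra V.ring (coordRing hf V) :=
  (coordStr hf V).hom.toAlgebra

variable {smul : ∀ T : Scheme.{u}, Γ(T, ⊤) → (yon.obj T ⟶ X) → (yon.obj T ⟶ X)}
  (hμ : IsGaAction f smul)

/-- The action of `a ∈ 𝔾ₐ(T)` on `T`-points of `X ×_S V`. -/
noncomputable def chartAct (V : Chart S) {T : Scheme.{u}} (a : Γ(T, ⊤)) (g : T ⟶ XV hf V) :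
    T ⟶ XV hf V :=
  XV.lift hf V (smul T a (yon.map g ≫ XV.fst hf V)) (g ≫ XV.snd hf V) (by
    rw [hμ.smul_comp, Category.assoc, (XV.isPullback hf V).w, Functor.map_comp, Category.assoc])

lemma chartAct_zero (V : Chart S) {T : Scheme.{u}} (g : T ⟶ XV hf V) :
    chartAct hf hμ V 0 g = g := by
  refine XV.hom_ext hf ?_ ?_
  · rw [chartAct, XV.lift_fst, hμ.zero_smul]
  · rw [chartAct, XV.lift_snd]

lemma chartAct_add (V : Chart S) {T : Scheme.{u}} (a b : Γ(T, ⊤)) (g : T ⟶ XV hf V) :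
    chartAct hf hμ V (a + b) g = chartAct hf hμ V a (chartAct hf hμ V b g) := by
  refine XV.hom_ext hf ?_ ?_
  · rw [chartAct, chartAct, XV.lift_fst, XV.lift_fst, hμ.add_smul, chartAct, XV.lift_fst]
  · rw [chartAct, chartAct, XV.lift_snd, XV.lift_snd, chartAct, XV.lift_snd]

lemma comp_chartAct (V : Chart S) {T T' : Scheme.{u}} (h : T' ⟶ T) (a : Γ(T, ⊤))
    (g : T ⟶ XV hf V) :
    h ≫ chartAct hf hμ V a g = chartAct hf hμ V (h.appTop a) (h ≫ g) := by
  refine XV.hom_ext hf ?_ ?_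
  · rw [chartAct, chartAct, XV.lift_fst, Functor.map_comp, Category.assoc, XV.lift_fst,
      hμ.naturality, Functor.map_comp, Category.assoc]
  · rw [chartAct, chartAct, XV.lift_snd, Category.assoc, XV.lift_snd, Category.assoc]

/-- The co-action `μ^* : A(V) → A(V)[t]`. -/
noncomputable def coact (V : Chart S) : coordRing hf V →+* (coordRing hf V)[X] :=
  ((chartAct hf hμ V (T := Spec (.of (coordRing hf V)[X])) ((Scheme.ΓSpecIso _).inv Polynomial.X)
    (Spec.map (CommRingCat.ofHom C) ≫ (XV hf V).isoSpec.inv)).appTop ≫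
      (Scheme.ΓSpecIso (.of (coordRing hf V)[X])).hom).hom

lemma specMap_isoSpec_inv_appTop {Y : Scheme.{u}} [IsAffine Y] {R : CommRingCat.{u}}
    (ψ : Γ(Y, ⊤) ⟶ R) :
    (Spec.map ψ ≫ Y.isoSpec.inv).appTop = ψ ≫ (Scheme.ΓSpecIso R).inv := by
  rw [Scheme.Hom.comp_appTop, Scheme.ΓSpecIso_inv_naturality]
  congr 1
  rw [← cancel_epi (Scheme.ΓSpecIso Γ(Y, ⊤)).hom, Iso.hom_inv_id, ← Scheme.toSpecΓ_appTop,
    ← Scheme.Hom.comp_appTop, ← Scheme.isoSpec_hom, Iso.inv_hom_id, Scheme.Hom.id_appTop]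

lemma chartAct_appTop (V : Chart S) {T : Scheme.{u}} (a : Γ(T, ⊤)) (g : T ⟶ XV hf V)
    (s : coordRing hf V) :
    (chartAct hf hμ V a g).appTop s = eval₂ g.appTop.hom a (coact hf hμ V s) := by
  let φ : CommRingCat.of (coordRing hf V)[X] ⟶ Γ(T, ⊤) :=
    CommRingCat.ofHom (eval₂RingHom g.appTop.hom a)
  let h : T ⟶ Spec (.of (coordRing hf V)[X]) := T.toSpecΓ ≫ Spec.map φ
  have h1 : h.appTop = (Scheme.ΓSpecIso _).hom ≫ φ := by
    rw [Scheme.Hom.comp_appTop, Scheme.toSpecΓ_appTop]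
    exact Scheme.ΓSpecIso_naturality _
  have h2 : h ≫ Spec.map (CommRingCat.ofHom C) ≫ (XV hf V).isoSpec.inv = g := by
    apply ext_of_isAffine
    rw [Scheme.Hom.comp_appTop, h1]
    refine (congrArg (· ≫ _) (specMap_isoSpec_inv_appTop (Y := XV hf V) _)).trans ?_
    rw [Category.assoc, Iso.inv_hom_id_assoc]
    ext s
    exact eval₂_C _ _
  have h3 := comp_chartAct hf hμ V h ((Scheme.ΓSpecIso _).inv Polynomial.X)
    (Spec.map (CommRingCat.ofHom C) ≫ (XV hf V).isoSpec.inv)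
  have h4 : h.appTop ((Scheme.ΓSpecIso (.of (coordRing hf V)[X])).inv Polynomial.X) = a := by
    rw [h1]
    refine (congrArg φ (CommRingCat.inv_hom_apply _ _)).trans ?_
    exact eval₂_X _ _
  rw [h4, h2] at h3
  rw [← h3, Scheme.Hom.comp_appTop, h1]
  rfl

lemma coact_coordStr (V : Chart S) (b : V.ring) :
    coact hf hμ V (coordStr hf V b) = C (coordStr hf V b) := by
  have h : chartAct hf hμ V (T := Spec (.of (coordRing hf V)[X]))
      ((Scheme.ΓSpecIso _).inv Polynomial.X)
      (Spec.map (CommRingCat.ofHom C) ≫ (XV hf V).isoSpec.inv) ≫ XV.snd hf V =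
      (Spec.map (CommRingCat.ofHom C) ≫ (XV hf V).isoSpec.inv) ≫ XV.snd hf V :=
    XV.lift_snd hf V _ _ _
  have h2 := congrArg (fun g => (Scheme.ΓSpecIso (.of (coordRing hf V)[X])).hom
    (Scheme.Hom.appTop g ((Scheme.ΓSpecIso V.ring).inv b))) h
  simp only [Scheme.Hom.comp_appTop (g := XV.snd hf V), specMap_isoSpec_inv_appTop] at h2
  refine h2.trans ?_
  exact CommRingCat.inv_hom_apply _ _

/-- The locally finite iterative higher derivation of `A(V)` determined by the action. -/
noncomputable def chartD (V : Chart S) : LFIHD V.ring (coordRing hf V) :=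
  LFIHD.ofCoaction (coact hf hμ V) (coact_coordStr hf hμ V)
    (fun s => by
      have h := chartAct_appTop hf hμ V 0 (𝟙 _) s
      rw [chartAct_zero] at h
      exact (h.symm.trans (by simp)))
    (fun R _ ψ r s a => by
      have e : ∀ (T : Scheme.{u}) (R : CommRingCat.{u}) (g : T ⟶ XV hf V)
          (e : Γ(T, ⊤) ⟶ R) (r : Γ(T, ⊤)) (a : coordRing hf V),
          e (eval₂ g.appTop.hom r (coact hf hμ V a)) = 
            eval₂ (g.appTop ≫ e).hom (e r) (coact hf hμ V a) := fun T R g e r a => by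
        exact hom_eval₂ _ _ _ _
      let i := Scheme.ΓSpecIso (.of R)
      let g : Spec (.of R) ⟶ XV hf V := Spec.map (CommRingCat.ofHom ψ) ≫ (XV hf V).isoSpec.inv
      have hg : g.appTop ≫ i.hom = CommRingCat.ofHom ψ := by
        rw [specMap_isoSpec_inv_appTop, Category.assoc, Iso.inv_hom_id, Category.comp_id]
      have key : ∀ (r : R) (g : Spec (.of R) ⟶ XV hf V) (a : coordRing hf V),
          i.hom ((chartAct hf hμ V (i.inv r) g).appTop a) =
            eval₂ (g.appTop ≫ i.hom).hom r (coact hf hμ V a) := fun r g a => by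
        rw [chartAct_appTop, e, CommRingCat.hom_inv_apply]
      have h1 := key (r + s) g a
      rw [map_add, chartAct_add, key, hg] at h1
      refine h1.symm.trans ?_
      congr 1
      ext b
      refine (key s g b).trans ?_
      rw [hg]
      rfl)

end Coordinates

open scoped TensorProduct in
/-- The formation of the filtration `F` commutes with flat base change. -/
lemma LFIHD.mem_span_of_flat {B A B' A' : Type u} [CommRing B] [CommRing A] [CommRing B']
    [CommRing A'] [Algebra B A] [Algebra B' A'] [Algebra B B'] [Module.Flat B B']
    (E : LFIHD B A) (E' : LFIHD B' A') (ψ : A →+* A') (e : B' ⊗[B] A ≃+ A')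
    (he : ∀ b a, e (b ⊗ₜ[B] a) = b • ψ a) (hD : ∀ i a, ψ (E.D i a) = E'.D i (ψ a))
    (n : ℕ) (a' : A') (ha' : a' ∈ E'.F n) :
    a' ∈ Submodule.span B' (ψ '' (E.F n : Set A)) := by
  let θ : A →ₗ[B] (ℕ →₀ A) :=
    { toFun := fun a => Finsupp.onFinset (E.exp a).support (fun i => if n < i then E.D i a else 0)
        (fun i hi => by
          rw [mem_support_iff, E.coeff_exp]
          intro h0
          simp [h0] at hi)
      map_add' := fun a b => by
        ext i
        rw [Finsupp.add_apply, Finsupp.onFinset_apply, Finsupp.onFinset_apply,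
          Finsupp.onFinset_apply]
        split_ifs <;> simp
      map_smul' := fun b a => by
        ext i
        rw [RingHom.id_apply, Finsupp.smul_apply, Finsupp.onFinset_apply, Finsupp.onFinset_apply]
        split_ifs <;> simp }
  have hθ : ∀ a i, θ a i = if n < i then E.D i a else 0 := fun a i => rfl
  have hker : Function.Exact (E.F n).subtype θ := by
    intro a
    constructor
    · intro ha
      refine ⟨⟨a, E.mem_F.2 fun i hi => ?_⟩, rfl⟩
      have := hθ a i
      rw [ha, if_pos hi] at this
      exact this.symm
    · rintro ⟨a, rfl⟩
      ext i
      rw [hθ, Finsupp.zero_apply]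
      split_ifs with h
      · exact E.mem_F.1 a.2 i h
      · rfl
  obtain ⟨z, rfl⟩ := e.surjective a'
  have hcomm : ∀ (z : B' ⊗[B] A) (i : ℕ), e ((E.D i).lTensor B' z) = E'.D i (e z) := by
    intro z i
    induction z with
    | zero => simp
    | tmul b a => rw [LinearMap.lTensor_tmul, he, he, hD, map_smul]
    | add x y hx hy => rw [map_add, map_add, hx, hy, map_add, map_add]
  have hz : θ.lTensor B' z = 0 := by
    apply (TensorProduct.finsuppRight B B B' A ℕ).injective
    ext i
    rw [map_zero, Finsupp.zero_apply, TensorProduct.finsuppRight_apply,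
      ← LinearMap.comp_apply, ← LinearMap.lTensor_comp]
    have h1 : Finsupp.lapply i ∘ₗ θ = if n < i then E.D i else 0 := by
      ext a
      rw [LinearMap.comp_apply, Finsupp.lapply_apply, hθ]
      split_ifs <;> rfl
    rw [h1]
    split_ifs with h
    · apply e.injective
      rw [hcomm, map_zero]
      exact E'.mem_F.1 ha' i h
    · simp
  obtain ⟨w, rfl⟩ := (Module.Flat.lTensor_exact B' hker z).1 hz
  clear ha' hz
  induction w with
  | zero => simp
  | tmul b a =>
    rw [LinearMap.lTensor_tmul, he]
    exact Submodule.smul_mem _ _ (Submodule.subset_span ⟨a, a.2, rfl⟩)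
  | add x y hx hy =>
    rw [map_add, map_add]
    exact add_mem hx hy

/-- A morphism of LFIHDs, along which the filtration `F` commutes with extension of scalars. -/
structure LFIHD.Hom {B A B' A' : Type u} [CommRing B] [CommRing A] [CommRing B']
    [CommRing A'] [Algebra B A] [Algebra B' A'] (E : LFIHD B A) (E' : LFIHD B' A') where
  toHom : A →+* A'
  comm : ∀ (i : ℕ) (a : A), toHom (E.D i a) = E'.D i (toHom a)
  span : ∀ (n : ℕ), ∀ a' ∈ E'.F n, a' ∈ Submodule.span B' (toHom '' (E.F n : Set A))

section Maps

variable {B A B' A' : Type u} [CommRing B] [CommRing A] [CommRing B']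
    [CommRing A'] [Algebra B A] [Algebra B' A'] {E : LFIHD B A} {E' : LFIHD B' A'}

namespace LFIHD

lemma Hom.map_mem_F (ψ : E.Hom E') {n : ℕ} {a : A} (ha : a ∈ E.F n) : ψ.toHom a ∈ E'.F n :=
  E'.mem_F.2 fun i hi => by rw [← ψ.comm, E.mem_F.1 ha i hi, map_zero]

/-- The induced homomorphism of rings of invariants. -/
def Hom.inv (ψ : E.Hom E') : E.inv →+* E'.inv :=
  ψ.toHom.restrict E.inv E'.inv fun _ ha => ψ.map_mem_F ha

/-- The induced homomorphism of Rees algebras. -/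
noncomputable def Hom.rees (ψ : E.Hom E') : GradedRingHom E.reesGrading E'.reesGrading where
  toRingHom := (mapRingHom ψ.toHom).restrict E.rees E'.rees fun p hp n => by
    rw [coe_mapRingHom, coeff_map]
    exact ψ.map_mem_F (hp n)
  map_mem {n p} hp m hm := by
    change ((p : A[X]).map ψ.toHom).coeff m = 0
    rw [coeff_map, E.mem_reesGrading.1 hp m hm, map_zero]

lemma Hom.coe_rees (ψ : E.Hom E') (p : E.rees) :
    (ψ.rees p : A'[X]) = (p : A[X]).map ψ.toHom := rfl

lemma Hom.rees_irrelevant (ψ : E.Hom E') : HomogeneousIdeal.irrelevant E'.reesGrading ≤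
    (HomogeneousIdeal.irrelevant E.reesGrading).map ψ.rees := by
  refine irrelevant_le_of_homogeneous _ fun n _ p hp => ?_
  have h : ∀ a ∈ Submodule.span B' (ψ.toHom '' (E.F n : Set A)), ∃ ha : a ∈ E'.F n,
      E'.reesMonomial n a ha ∈ Ideal.span (ψ.rees '' (E.reesGrading n : Set E.rees)) := by
    intro a ha
    induction ha using Submodule.span_induction with
    | mem x hx =>
      obtain ⟨a, ha, rfl⟩ := hx
      refine ⟨ψ.map_mem_F ha, Ideal.subset_span ⟨E.reesMonomial n a ha,
        E.reesMonomial_mem n a ha, Subtype.ext ?_⟩⟩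
      exact map_monomial ψ.toHom
    | zero =>
      refine ⟨zero_mem _, ?_⟩
      convert zero_mem (Ideal.span (ψ.rees '' (E.reesGrading n : Set E.rees)))
      exact Subtype.ext (monomial_zero_right n)
    | add x y _ _ hx hy =>
      obtain ⟨hx, hx'⟩ := hx
      obtain ⟨hy, hy'⟩ := hy
      refine ⟨add_mem hx hy, ?_⟩
      convert add_mem hx' hy'
      exact Subtype.ext (map_add (monomial n) x y)
    | smul b x _ hx =>
      obtain ⟨hx, hx'⟩ := hx
      refine ⟨Submodule.smul_mem _ _ hx, ?_⟩
      convert Ideal.mul_mem_left _ (algebraMap B' E'.rees b) hx'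
      rw [← Algebra.smul_def]
      exact Subtype.ext (smul_monomial b n x).symm
  obtain ⟨hn, hn'⟩ := h _ (ψ.span n _ (p.2 n))
  convert hn'
  ext m
  change _ = (monomial n ((p : A'[X]).coeff n)).coeff m
  rw [coeff_monomial]
  split_ifs with h
  · rw [h]
  · exact hp m (Ne.symm h)

/-- The inclusion `η` of the Rees algebra in `A[υ]`. -/
noncomputable def η (E : LFIHD B A) : GradedRingHom E.reesGrading (stdGrading B A) where
  toRingHom := E.rees.val
  map_mem h := h

lemma eq_of_mem_stdGrading {n : ℕ} {p : A[X]} (hp : p ∈ stdGrading B A n) :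
    p = C (p.coeff n) * X ^ n := by
  ext m
  rw [coeff_C_mul, coeff_X_pow]
  split_ifs with h
  · rw [h, mul_one]
  · rw [mul_zero, hp m h]

lemma η_irrelevant (E : LFIHD B A) : HomogeneousIdeal.irrelevant (stdGrading B A) ≤
    (HomogeneousIdeal.irrelevant E.reesGrading).map E.η := by
  refine irrelevant_le_of_homogeneous _ fun n _ p hp => ?_
  rw [eq_of_mem_stdGrading hp]
  refine Ideal.mul_mem_left _ _ (Ideal.subset_span ⟨E.reesMonomial n 1
    (E.F_mono (Nat.zero_le n) E.one_mem_F), E.reesMonomial_mem n 1 _, ?_⟩)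
  exact (monomial_one_right_eq_X_pow n)

lemma X_pow_mem_stdGrading (B A : Type u) [CommRing B] [CommRing A] [Algebra B A] (n : ℕ) :
    (X ^ n : A[X]) ∈ stdGrading B A n := fun m h => by
  rw [coeff_X_pow, if_neg h]

/-- The homomorphism `A[υ]_(υ) → A`, `a υⁿ / υⁿ ↦ a`. -/
noncomputable def evOne (B A : Type u) [CommRing B] [CommRing A] [Algebra B A] :
    HomogeneousLocalization.Away (stdGrading B A) (X : A[X]) →+* A :=
  (IsLocalization.Away.lift (S := Localization.Away (X : A[X])) (g := evalRingHom 1) X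
    (by simp)).comp (algebraMap _ _)

lemma X_mem_stdGrading (B A : Type u) [CommRing B] [CommRing A] [Algebra B A] :
    (X : A[X]) ∈ stdGrading B A 1 := fun m h => by
  rw [coeff_X, if_neg (Ne.symm h)]

/-- The homomorphism `A[υ] → A'[υ]` of graded rings. -/
noncomputable def Hom.std (ψ : E.Hom E') : GradedRingHom (stdGrading B A) (stdGrading B' A') where
  toRingHom := mapRingHom ψ.toHom
  map_mem {n p} hp m hm := by
    change (p.map ψ.toHom).coeff m = 0
    rw [coeff_map, hp m hm, map_zero]

lemma Hom.std_irrelevant (ψ : E.Hom E') : HomogeneousIdeal.irrelevant (stdGrading B' A') ≤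
    (HomogeneousIdeal.irrelevant (stdGrading B A)).map ψ.std := by
  refine irrelevant_le_of_homogeneous _ fun n _ p hp => ?_
  rw [eq_of_mem_stdGrading hp]
  exact Ideal.mul_mem_left _ _ (Ideal.subset_span ⟨X ^ n, X_pow_mem_stdGrading B A n,
    by change (X ^ n : A[X]).map ψ.toHom = _; rw [Polynomial.map_pow, map_X]⟩)

/-- The morphism `j : Spec A ⟶ Proj R`: the composite of the isomorphism
`Spec A ≅ Proj A[υ]` with the morphism `Proj A[υ] ⟶ Proj R` induced by `η`. -/
noncomputable def openEmb (E : LFIHD B A) : Spec (.of A) ⟶ Proj E.reesGrading :=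
  Spec.map (CommRingCat.ofHom (evOne B A)) ≫
    Proj.awayι (stdGrading B A) X (X_mem_stdGrading B A) one_pos ≫ Proj.map E.η E.η_irrelevant

end LFIHD

end Maps

section ProjFunctoriality

variable {B R B' R' : Type u} [CommRing B] [CommRing R] [Algebra B R] [CommRing B'] [CommRing R']
  [Algebra B' R'] (𝒜 : ℕ → Submodule B R) [GradedAlgebra 𝒜]
  (ℬ : ℕ → Submodule B' R') [GradedAlgebra ℬ]

/-- The structure morphism `Proj R ⟶ Spec C` given by a ring homomorphism `C → R₀`. -/
noncomputable def projToSpec {C : Type u} [CommRing C] (ρ : C →+* 𝒜 0) : Proj 𝒜 ⟶ Spec (.of C) :=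
  Proj.toSpecZero 𝒜 ≫ Spec.map (CommRingCat.ofHom ρ)

variable {𝒜 ℬ}

lemma projMap_projToSpec (f : GradedRingHom 𝒜 ℬ)
    (hf : HomogeneousIdeal.irrelevant ℬ ≤ (HomogeneousIdeal.irrelevant 𝒜).map f)
    {C C' : Type u} [CommRing C] [CommRing C'] (ρ : C →+* 𝒜 0) (ρ' : C' →+* ℬ 0) (χ : C →+* C')
    (h : ∀ c, f (ρ c) = ρ' (χ c)) :
    Proj.map f hf ≫ projToSpec 𝒜 ρ = projToSpec ℬ ρ' ≫ Spec.map (CommRingCat.ofHom χ) := by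
  refine (Proj.mapAffineOpenCover f hf).openCover.hom_ext _ _ fun s' => ?_
  obtain ⟨s, rfl⟩ : ∃ s : Σ i : PNat, 𝒜 i, s = s' := ⟨s', rfl⟩
  change Proj.awayι ℬ (f s.2) (f.map_mem s.2.2) s.1.pos ≫ _ = Proj.awayι ℬ (f s.2) (f.map_mem s.2.2) s.1.pos ≫ _
  rw [projToSpec, projToSpec, Proj.awayι_comp_map_assoc f hf s.1.pos _ s.2.2, Category.assoc, Proj.awayι_toSpecZero_assoc,
    Proj.awayι_toSpecZero_assoc, ← Spec.map_comp, ← Spec.map_comp, ← Spec.map_comp, ← Spec.map_comp]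
  congr 1
  ext c
  have h1 : HomogeneousLocalization.val (HomogeneousLocalization.Away.map f (s.2 : R)
      (HomogeneousLocalization.fromZeroRingHom 𝒜 (.powers (s.2 : R)) (ρ c))) =
      HomogeneousLocalization.val (HomogeneousLocalization.fromZeroRingHom ℬ
        (.powers (f (s.2 : R))) (ρ' (χ c))) := by
    change Localization.mk (f (ρ c : R)) ⟨f (1 : R), _⟩ = Localization.mk (ρ' (χ c) : R') ⟨1, _⟩
    congr 1
    · exact h c
    · exact Subtype.ext (map_one f)
  exact h1

/-- The degree `0` part of a homomorphism of graded rings. -/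
def zeroHom (f : GradedRingHom 𝒜 ℬ) : 𝒜 0 →+* ℬ 0 where
  toFun a := ⟨f a, f.map_mem a.2⟩
  map_one' := Subtype.ext (map_one f)
  map_mul' _ _ := Subtype.ext (map_mul f _ _)
  map_zero' := Subtype.ext (map_zero f)
  map_add' _ _ := Subtype.ext (map_add f _ _)

/-- The homomorphism `R[t] → R'[t]` of graded rings. -/
noncomputable def polyHom (f : GradedRingHom 𝒜 ℬ) :
    GradedRingHom (polyGrading 𝒜) (polyGrading ℬ) where
  toRingHom := mapRingHom f.toRingHom
  map_mem {n p} hp i := by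
    change (p.map f.toRingHom).coeff i ∈ _
    rw [coeff_map]
    exact f.map_mem (hp i)

lemma polyHom_irrelevant (f : GradedRingHom 𝒜 ℬ)
    (hf : HomogeneousIdeal.irrelevant ℬ ≤ (HomogeneousIdeal.irrelevant 𝒜).map f) :
    HomogeneousIdeal.irrelevant (polyGrading ℬ) ≤
      (HomogeneousIdeal.irrelevant (polyGrading 𝒜)).map (polyHom f) := by
  refine (HomogeneousIdeal.toIdeal_irrelevant_le _).2 fun n hn (p : R'[X]) (hp : p ∈ polyGrading ℬ n) => ?_
  change p ∈ Ideal.map _ _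
  rw [p.as_sum_support_C_mul_X_pow]
  refine sum_mem fun i _ => Ideal.mul_mem_right _ _ ?_
  have h1 : p.coeff i ∈ Ideal.map f.toRingHom (HomogeneousIdeal.irrelevant 𝒜).toIdeal :=
    hf (HomogeneousIdeal.mem_irrelevant_of_mem ℬ hn (hp i))
  have h2 := Ideal.mem_map_of_mem C h1
  rw [Ideal.map_map] at h2
  have h3 : (C : R' →+* R'[X]).comp f.toRingHom = (mapRingHom f.toRingHom).comp C := by
    ext a; simp
  rw [h3, ← Ideal.map_map] at h2
  refine Ideal.map_mono ?_ h2
  rw [Ideal.map_le_iff_le_comap]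
  refine (HomogeneousIdeal.toIdeal_irrelevant_le _).2 fun n hn a ha => ?_
  exact HomogeneousIdeal.mem_irrelevant_of_mem (polyGrading 𝒜) hn ((constHom 𝒜).map_mem ha)

lemma projMap_congr {f g : GradedRingHom 𝒜 ℬ} (h : ∀ a, f a = g a)
    (hf : HomogeneousIdeal.irrelevant ℬ ≤ (HomogeneousIdeal.irrelevant 𝒜).map f)
    (hg : HomogeneousIdeal.irrelevant ℬ ≤ (HomogeneousIdeal.irrelevant 𝒜).map g) :
    Proj.map f hf = Proj.map g hg := by
  obtain rfl : f = g := DFunLike.ext _ _ h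
  rfl

lemma tSection_eq : tSection 𝒜 = (projToSpec (polyGrading 𝒜) (RingHom.id _)).appTop
    ((Scheme.ΓSpecIso (.of (polyGrading 𝒜 0))).inv ⟨X, X_mem_polyGrading 𝒜⟩) := by
  rw [projToSpec, CommRingCat.ofHom_id, Spec.map_id, Category.comp_id]
  rfl

lemma projPolyTo_naturality (f : GradedRingHom 𝒜 ℬ)
    (hf : HomogeneousIdeal.irrelevant ℬ ≤ (HomogeneousIdeal.irrelevant 𝒜).map f) :
    projPolyTo ℬ ≫ AffineSpace.map PUnit.{u + 1} (Proj.map f hf) =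
      Proj.map (polyHom f) (polyHom_irrelevant f hf) ≫ projPolyTo 𝒜 := by
  apply AffineSpace.hom_ext
  · rw [Category.assoc, AffineSpace.map_over, projPolyTo, Category.assoc, projPolyTo,
      AffineSpace.homOfVector_over, AffineSpace.homOfVector_over_assoc,
      ← Proj.map_comp, ← Proj.map_comp]
    exact projMap_congr (fun a => (Polynomial.map_C _).symm) _ _
  · intro i
    rw [Scheme.Hom.comp_appTop, CommRingCat.comp_apply, AffineSpace.map_appTop_coord,
      Scheme.Hom.comp_appTop, CommRingCat.comp_apply, projPolyTo, projPolyTo,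
      AffineSpace.homOfVector_appTop_coord, AffineSpace.homOfVector_appTop_coord]
    have h := projMap_projToSpec (polyHom f) (polyHom_irrelevant f hf) (RingHom.id _)
      (RingHom.id _) (zeroHom (polyHom f)) (fun _ => rfl)
    have h2 := congrArg (fun g => Scheme.Hom.appTop g
      ((Scheme.ΓSpecIso (.of (polyGrading 𝒜 0))).inv ⟨X, X_mem_polyGrading 𝒜⟩)) h
    simp only [Scheme.Hom.comp_appTop] at h2
    rw [tSection_eq, tSection_eq]
    refine Eq.trans ?_ h2.symm
    refine congrArg (projToSpec (polyGrading ℬ) (RingHom.id _)).appTop ?_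
    refine Eq.trans (congrArg (Scheme.ΓSpecIso (.of (polyGrading ℬ 0))).inv ?_)
      (ConcreteCategory.congr_hom (Scheme.ΓSpecIso_inv_naturality
        (CommRingCat.ofHom (zeroHom (polyHom f)))) ⟨X, X_mem_polyGrading 𝒜⟩)
    exact Subtype.ext (Polynomial.map_X _).symm

lemma projExp_naturality (f : GradedRingHom 𝒜 ℬ)
    (hf : HomogeneousIdeal.irrelevant ℬ ≤ (HomogeneousIdeal.irrelevant 𝒜).map f)
    (E : LFIHD B R) (hE : ∀ (i n : ℕ) (a : R), a ∈ 𝒜 n → E.D i a ∈ 𝒜 n)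
    (E' : LFIHD B' R') (hE' : ∀ (i n : ℕ) (a : R'), a ∈ ℬ n → E'.D i a ∈ ℬ n)
    (h : ∀ i a, f (E.D i a) = E'.D i (f a)) :
    AffineSpace.map PUnit.{u + 1} (Proj.map f hf) ≫ projExp 𝒜 E hE =
      projExp ℬ E' hE' ≫ Proj.map f hf := by
  rw [projExp, projExp, ← cancel_epi (projPolyTo ℬ), reassoc_of% projPolyTo_naturality f hf,
    IsIso.hom_inv_id_assoc, Category.assoc, IsIso.hom_inv_id_assoc, ← Proj.map_comp, ← Proj.map_comp]
  refine projMap_congr (fun a => ?_) _ _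
  change (E.exp a).map f.toRingHom = E'.exp (f a)
  ext i
  rw [coeff_map, E.coeff_exp, E'.coeff_exp]
  exact h i a

lemma projExp_projToSpec (E : LFIHD B R) (hE : ∀ (i n : ℕ) (a : R), a ∈ 𝒜 n → E.D i a ∈ 𝒜 n)
    {C : Type u} [CommRing C] (ρ : C →+* 𝒜 0) (h : ∀ i c, 0 < i → E.D i (ρ c) = 0) :
    projExp 𝒜 E hE ≫ projToSpec 𝒜 ρ = (𝔸(PUnit.{u + 1}; Proj 𝒜) ↘ Proj 𝒜) ≫ projToSpec 𝒜 ρ := by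
  rw [← cancel_epi (projPolyTo 𝒜), projExp, Category.assoc, IsIso.hom_inv_id_assoc,
    projPolyTo, AffineSpace.homOfVector_over_assoc]
  let ρ' : C →+* polyGrading 𝒜 0 := (zeroHom (constHom 𝒜)).comp ρ
  rw [projMap_projToSpec (expHom 𝒜 E hE) _ ρ ρ' (RingHom.id C) ?_,
    projMap_projToSpec (constHom 𝒜) _ ρ ρ' (RingHom.id C) ?_]
  · intro c
    rfl
  · intro c
    change E.exp (ρ c) = Polynomial.C (ρ c : R)
    ext i
    rw [E.coeff_exp, coeff_C]
    split_ifs with hi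
    · rw [hi, E.D_zero_apply]
    · exact h i c (by omega)

/-- The action of `a ∈ 𝔾ₐ(W) = Γ(W, ⊤)` on a `W`-point of `Proj R`. -/
noncomputable def projAct (E : LFIHD B R) (hE : ∀ (i n : ℕ) (a : R), a ∈ 𝒜 n → E.D i a ∈ 𝒜 n)
    {W : Scheme.{u}} (a : Γ(W, ⊤)) (p : W ⟶ Proj 𝒜) : W ⟶ Proj 𝒜 :=
  AffineSpace.homOfVector p (fun _ => a) ≫ projExp 𝒜 E hE

lemma comp_projAct (E : LFIHD B R) (hE : ∀ (i n : ℕ) (a : R), a ∈ 𝒜 n → E.D i a ∈ 𝒜 n)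
    {W W' : Scheme.{u}} (g : W' ⟶ W) (a : Γ(W, ⊤)) (p : W ⟶ Proj 𝒜) :
    g ≫ projAct E hE a p = projAct E hE (g.appTop a) (g ≫ p) := by
  rw [projAct, projAct, ← Category.assoc, AffineSpace.comp_homOfVector]
  rfl

lemma projAct_projToSpec (E : LFIHD B R) (hE : ∀ (i n : ℕ) (a : R), a ∈ 𝒜 n → E.D i a ∈ 𝒜 n)
    {C : Type u} [CommRing C] (ρ : C →+* 𝒜 0) (h : ∀ i c, 0 < i → E.D i (ρ c) = 0)
    {W : Scheme.{u}} (a : Γ(W, ⊤)) (p : W ⟶ Proj 𝒜) :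
    projAct E hE a p ≫ projToSpec 𝒜 ρ = p ≫ projToSpec 𝒜 ρ := by
  rw [projAct, Category.assoc, projExp_projToSpec E hE ρ h, AffineSpace.homOfVector_over_assoc]

lemma projAct_naturality (f : GradedRingHom 𝒜 ℬ)
    (hf : HomogeneousIdeal.irrelevant ℬ ≤ (HomogeneousIdeal.irrelevant 𝒜).map f)
    (E : LFIHD B R) (hE : ∀ (i n : ℕ) (a : R), a ∈ 𝒜 n → E.D i a ∈ 𝒜 n)
    (E' : LFIHD B' R') (hE' : ∀ (i n : ℕ) (a : R'), a ∈ ℬ n → E'.D i a ∈ ℬ n)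
    (h : ∀ i a, f (E.D i a) = E'.D i (f a)) {W : Scheme.{u}} (a : Γ(W, ⊤)) (p : W ⟶ Proj ℬ) :
    projAct E hE a (p ≫ Proj.map f hf) = projAct E' hE' a p ≫ Proj.map f hf := by
  rw [projAct, projAct, Category.assoc, ← projExp_naturality f hf E hE E' hE' h, ← Category.assoc]
  congr 1
  apply AffineSpace.hom_ext
  · rw [Category.assoc, AffineSpace.map_over, AffineSpace.homOfVector_over,
      AffineSpace.homOfVector_over_assoc]
  · intro i
    rw [Scheme.Hom.comp_appTop, CommRingCat.comp_apply, AffineSpace.map_appTop_coord,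
      AffineSpace.homOfVector_appTop_coord, AffineSpace.homOfVector_appTop_coord]

end ProjFunctoriality

namespace LFIHD

variable {B A B' A' : Type u} [CommRing B] [CommRing A] [CommRing B']
    [CommRing A'] [Algebra B A] [Algebra B' A'] {E : LFIHD B A} {E' : LFIHD B' A'}

/-- The identification of `A₀` with the degree `0` part of the Rees algebra. -/
noncomputable def invToRees (E : LFIHD B A) : E.inv →+* E.reesGrading 0 where
  toFun a := ⟨E.reesMonomial 0 a a.2, E.reesMonomial_mem 0 _ _⟩
  map_one' := Subtype.ext (Subtype.ext rfl)
  map_mul' _ _ := Subtype.ext (Subtype.ext (map_mul (C : A →+* A[X]) _ _))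
  map_zero' := Subtype.ext (Subtype.ext (map_zero (C : A →+* A[X])))
  map_add' _ _ := Subtype.ext (Subtype.ext (map_add (C : A →+* A[X]) _ _))

/-- The inclusion of `A₀` in the Rees algebra, as its component of degree `0`. -/
noncomputable def invIncl (E : LFIHD B A) : E.inv →+* E.rees where
  toFun a := E.reesMonomial 0 a a.2
  map_one' := Subtype.ext rfl
  map_mul' _ _ := Subtype.ext (map_mul (C : A →+* A[X]) _ _)
  map_zero' := Subtype.ext (map_zero (C : A →+* A[X]))
  map_add' _ _ := Subtype.ext (map_add (C : A →+* A[X]) _ _)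

/-- The canonical morphism `Proj R ⟶ Spec A₀`. -/
noncomputable def reesToInv (E : LFIHD B A) : Proj E.reesGrading ⟶ Spec (.of E.inv) :=
  projToSpec E.reesGrading E.invToRees

/-- The morphism `Proj R' ⟶ Proj R` induced by a morphism of LFIHDs. -/
noncomputable def Hom.proj (ψ : E.Hom E') : Proj E'.reesGrading ⟶ Proj E.reesGrading :=
  Proj.map ψ.rees ψ.rees_irrelevant

lemma Hom.proj_reesToInv (ψ : E.Hom E') :
    ψ.proj ≫ E.reesToInv = E'.reesToInv ≫ Spec.map (CommRingCat.ofHom ψ.inv) := by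
  refine projMap_projToSpec _ _ _ _ _ fun c => Subtype.ext ?_
  exact map_monomial ψ.toHom

/-- The action of `a ∈ 𝔾ₐ(W) = Γ(W, ⊤)` on the `W`-points of `Proj R`, given by the homogeneous
LFIHD `υR(D)` of degree `0`. -/
noncomputable def reesAct (E : LFIHD B A) {W : Scheme.{u}} (a : Γ(W, ⊤))
    (p : W ⟶ Proj E.reesGrading) : W ⟶ Proj E.reesGrading :=
  projAct E.υR (fun i _ _ h => E.υR_mem i h) a p

lemma comp_reesAct {W W' : Scheme.{u}} (g : W' ⟶ W) (a : Γ(W, ⊤)) (p : W ⟶ Proj E.reesGrading) :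
    g ≫ E.reesAct a p = E.reesAct (g.appTop a) (g ≫ p) := comp_projAct _ _ g a p

lemma reesAct_reesToInv {W : Scheme.{u}} (a : Γ(W, ⊤)) (p : W ⟶ Proj E.reesGrading) :
    E.reesAct a p ≫ E.reesToInv = p ≫ E.reesToInv := by
  refine projAct_projToSpec _ _ _ (fun i c hi => Subtype.ext ?_) a p
  ext n
  change (E.υreesD i (E.reesMonomial 0 c c.2) : A[X]).coeff n = 0
  rw [coeff_υreesD]
  change E.D i ((monomial 0 (c : A)).coeff n) = 0
  rw [coeff_monomial]
  split_ifs
  · exact E.mem_F.1 c.2 i hi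
  · rw [map_zero]

lemma Hom.reesAct_proj (ψ : E.Hom E') {W : Scheme.{u}} (a : Γ(W, ⊤))
    (p : W ⟶ Proj E'.reesGrading) :
    E.reesAct a (p ≫ ψ.proj) = E'.reesAct a p ≫ ψ.proj := by
  refine projAct_naturality _ _ _ _ _ _ (fun i x => Subtype.ext ?_) a p
  ext n
  change ((E.υreesD i x : A[X]).map ψ.toHom).coeff n = (E'.υreesD i (ψ.rees x) : A'[X]).coeff n
  rw [coeff_map, coeff_υreesD, coeff_υreesD, ψ.comm, Hom.coe_rees, coeff_map]

lemma evOne_eq (z : HomogeneousLocalization.Away (stdGrading B A) (X : A[X])) (n : ℕ) (p : A[X])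
    (h : z.val * algebraMap A[X] _ X ^ n = algebraMap A[X] (Localization.Away (X : A[X])) p) :
    evOne B A z = eval 1 p := by
  have hu : IsUnit (evalRingHom (1 : A) X) := by simp
  have h1 := congrArg (IsLocalization.Away.lift (S := Localization.Away (X : A[X])) X hu) h
  rw [map_mul, map_pow, IsLocalization.Away.lift_eq, IsLocalization.Away.lift_eq,
    coe_evalRingHom, eval_X, one_pow, mul_one] at h1
  exact h1

lemma evOne_mk (n : ℕ) (p : A[X]) (hp : p ∈ stdGrading B A (n • 1)) :
    evOne B A (HomogeneousLocalization.Away.mk (stdGrading B A) (X_mem_stdGrading B A) n p hp) =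
      eval 1 p := by
  apply evOne_eq _ n
  rw [HomogeneousLocalization.Away.val_mk, Localization.mk_eq_mk']
  exact (congrArg (_ * ·) (map_pow (algebraMap A[X] (Localization.Away (X : A[X]))) _ n).symm).trans
    (IsLocalization.mk'_spec _ _ _)

lemma openEmb_reesToInv : E.openEmb ≫ E.reesToInv =
    Spec.map (CommRingCat.ofHom E.inv.val.toRingHom) := by
  rw [openEmb, reesToInv, Category.assoc, Category.assoc,
    projMap_projToSpec E.η _ E.invToRees ((zeroHom E.η).comp E.invToRees) (RingHom.id _)
    (fun _ => rfl), CommRingCat.ofHom_id, Spec.map_id, Category.comp_id, projToSpec,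
    Proj.awayι_toSpecZero_assoc, ← Spec.map_comp, ← Spec.map_comp]
  congr 1
  ext c
  refine (evOne_eq _ 0 (C (c : A)) ?_).trans eval_C
  rw [pow_zero, mul_one]
  exact Localization.mk_one_eq_algebraMap _

lemma Hom.std_aux (ψ : E.Hom E') (s : A'[X]) (hs : s = ψ.std X) (hs1 : s ∈ stdGrading B' A' 1)
    (ev : HomogeneousLocalization.Away (stdGrading B' A') s →+* A')
    (hev : ∀ n p hp, ev (HomogeneousLocalization.Away.mk _ hs1 n p hp) = eval 1 p) :
    Spec.map (CommRingCat.ofHom ev) ≫ Proj.awayι _ s hs1 one_pos ≫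
      Proj.map ψ.std ψ.std_irrelevant = Spec.map (CommRingCat.ofHom ψ.toHom) ≫
        Spec.map (CommRingCat.ofHom (evOne B A)) ≫
          Proj.awayι (stdGrading B A) X (X_mem_stdGrading B A) one_pos := by
  subst hs
  rw [Proj.awayι_comp_map ψ.std ψ.std_irrelevant one_pos X (X_mem_stdGrading B A),
    ← Category.assoc, ← Category.assoc, ← Spec.map_comp, ← Spec.map_comp]
  congr 2
  ext z
  obtain ⟨n, p, hp, rfl⟩ := z.mk_surjective _ (X_mem_stdGrading B A)
  change ev (HomogeneousLocalization.Away.map ψ.std X _) = ψ.toHom (evOne B A _)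
  rw [HomogeneousLocalization.Away.map_mk, hev, evOne_mk]
  change eval 1 (p.map ψ.toHom) = _
  rw [Polynomial.eval_map, ← map_one ψ.toHom, eval₂_at_apply]

lemma Hom.openEmb_proj (ψ : E.Hom E') :
    E'.openEmb ≫ ψ.proj = Spec.map (CommRingCat.ofHom ψ.toHom) ≫ E.openEmb := by
  have h1 : Proj.map E'.η E'.η_irrelevant ≫ ψ.proj =
      Proj.map ψ.std ψ.std_irrelevant ≫ Proj.map E.η E.η_irrelevant := by
    rw [Hom.proj, ← Proj.map_comp, ← Proj.map_comp]
    exact projMap_congr (fun a => rfl) _ _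
  rw [openEmb, openEmb, Category.assoc, Category.assoc, h1]
  have h2 := ψ.std_aux X (Polynomial.map_X _).symm (X_mem_stdGrading B' A') (evOne B' A')
    (fun n p hp => evOne_mk n p hp)
  rw [reassoc_of% h2]

end LFIHD

section BaseChange

variable {X S : PSh.{u}} {f : X ⟶ S} (hf : AffineOver f) {V' V : Chart S} (h : V'.Hom V)

/-- The morphism `X ×_S V' ⟶ X ×_S V`. -/
noncomputable def XV.map : XV hf V' ⟶ XV hf V :=
  XV.lift hf V (XV.fst hf V') (XV.snd hf V' ≫ Spec.map h.φ) (by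
    rw [(XV.isPullback hf V').w, Functor.map_comp, Category.assoc, h.w])

lemma XV.map_fst : yon.map (XV.map hf h) ≫ XV.fst hf V = XV.fst hf V' := XV.lift_fst hf V _ _ _

lemma XV.map_snd : XV.map hf h ≫ XV.snd hf V = XV.snd hf V' ≫ Spec.map h.φ :=
  XV.lift_snd hf V _ _ _

lemma XV.isPullback_map :
    IsPullback (XV.map hf h) (XV.snd hf V') (XV.snd hf V) (Spec.map h.φ) := by
  apply IsPullback.of_map yon (XV.map_snd hf h)
  refine IsPullback.of_right ?_ ?_ (XV.isPullback hf V)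
  · rw [XV.map_fst, h.w]
    exact XV.isPullback hf V'
  · rw [← Functor.map_comp, ← Functor.map_comp, XV.map_snd]

/-- The homomorphism `A(V) → A(V')`. -/
noncomputable def coordMap : coordRing hf V ⟶ coordRing hf V' := (XV.map hf h).appTop

lemma coord_isPushout :
    IsPushout (coordStr hf V) h.φ (coordMap hf h) (coordStr hf V') := by
  refine (isPushout_appTop_of_isPullback (XV.isPullback_map hf h)).of_iso
    (Scheme.ΓSpecIso _) (Iso.refl _) (Scheme.ΓSpecIso _) (Iso.refl _) ?_ ?_ ?_ ?_
  · simp [coordStr]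
  · simp
  · simp [coordMap]
  · simp [coordStr]

variable {smul : ∀ T : Scheme.{u}, Γ(T, ⊤) → (yon.obj T ⟶ X) → (yon.obj T ⟶ X)}
  (hμ : IsGaAction f smul)

lemma chartAct_map {T : Scheme.{u}} (a : Γ(T, ⊤)) (g : T ⟶ XV hf V') :
    chartAct hf hμ V' a g ≫ XV.map hf h = chartAct hf hμ V a (g ≫ XV.map hf h) := by
  refine XV.hom_ext hf ?_ ?_
  · rw [chartAct, chartAct, XV.lift_fst, Functor.map_comp, Category.assoc, XV.map_fst, XV.lift_fst,
      Functor.map_comp, Category.assoc, XV.map_fst]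
  · rw [chartAct, chartAct, XV.lift_snd, Category.assoc, XV.map_snd, XV.lift_snd_assoc,
      Category.assoc, Category.assoc, XV.map_snd]

lemma coact_coordMap (a : coordRing hf V) :
    coact hf hμ V' (coordMap hf h a) = (coact hf hμ V a).map (coordMap hf h).hom := by
  let i := Scheme.ΓSpecIso (.of (coordRing hf V')[X])
  have h1 := chartAct_map hf h hμ (T := Spec (.of (coordRing hf V')[X])) (i.inv Polynomial.X)
    (Spec.map (CommRingCat.ofHom C) ≫ (XV hf V').isoSpec.inv)
  have h2 := congrArg (fun g => i.hom (Scheme.Hom.appTop g a)) h1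
  simp only [chartAct_appTop, Scheme.Hom.comp_appTop (g := XV.map hf h),
    specMap_isoSpec_inv_appTop] at h2
  refine h2.trans ((hom_eval₂ _ _ i.hom.hom _).trans ?_)
  refine (congrArg (fun r => eval₂ _ r (coact hf hμ V a)) (CommRingCat.hom_inv_apply i _)).trans ?_
  rw [Polynomial.map]
  congr 1
  refine RingHom.ext fun b => ?_
  exact CommRingCat.hom_inv_apply i (C (coordMap hf h b))

open scoped TensorProduct in
lemma coord_tensor : letI := h.φ.hom.toAlgebra
    ∃ e : V'.ring ⊗[V.ring] coordRing hf V ≃+ coordRing hf V',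
      ∀ b a, e (b ⊗ₜ a) = b • coordMap hf h a := by
  let _ := h.φ.hom.toAlgebra
  let H := CommRingCat.isPushout_tensorProduct V.ring V'.ring (coordRing hf V)
  have H' : IsPushout (CommRingCat.ofHom (algebraMap V.ring V'.ring))
    (CommRingCat.ofHom (algebraMap V.ring (coordRing hf V))) (coordStr hf V') (coordMap hf h) :=
    (coord_isPushout hf h).flip
  let e := (H.isoIsPushout _ _ H').commRingCatIsoToRingEquiv
  refine ⟨e.toAddEquiv, fun b a => ?_⟩
  have h1 : e (b ⊗ₜ 1) = coordStr hf V' b :=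
    ConcreteCategory.congr_hom (H.inl_isoIsPushout_hom _ _ H') b
  have h2 : e (1 ⊗ₜ a) = coordMap hf h a :=
    ConcreteCategory.congr_hom (H.inr_isoIsPushout_hom _ _ H') a
  change e (b ⊗ₜ a) = _
  rw [Algebra.smul_def, ← h2, show (algebraMap V'.ring (coordRing hf V') b) = e (b ⊗ₜ 1) from
    h1.symm, ← map_mul, Algebra.TensorProduct.tmul_mul_tmul, one_mul, mul_one]

lemma chart_comm (i : ℕ) (a : coordRing hf V) :
    coordMap hf h ((chartD hf hμ V).D i a) = (chartD hf hμ V').D i (coordMap hf h a) := by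
  change (coordMap hf h) ((coact hf hμ V a).coeff i) =
    (coact hf hμ V' (coordMap hf h a)).coeff i
  rw [coact_coordMap, coeff_map]

/-- The morphism of LFIHDs `A(V) → A(V')`. -/
noncomputable def chartHom : (chartD hf hμ V).Hom (chartD hf hμ V') where
  toHom := (coordMap hf h).hom
  comm := chart_comm hf h hμ
  span := by
    let _ := h.φ.hom.toAlgebra
    have : Module.Flat V.ring V'.ring := h.flat
    obtain ⟨e, he⟩ := coord_tensor hf h
    exact LFIHD.mem_span_of_flat _ _ _ e he (chart_comm hf h hμ)

end BaseChange

end GaRees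

namespace GaRees

open Polynomial AlgebraicGeometry CategoryTheory Limits Opposite

/-- A compatible family of schemes over the affine étale charts of `S`. -/
structure ChartFamily (S : PSh.{u}) where
  obj : Chart S → Scheme.{u}
  toBase : ∀ V, obj V ⟶ Spec V.ring
  map : ∀ {V' V : Chart S}, V'.Hom V → (obj V' ⟶ obj V)
  w : ∀ {V' V : Chart S} (c : V'.Hom V), map c ≫ toBase V = toBase V' ≫ Spec.map c.φ

namespace ChartFamily

variable {S : PSh.{u}} (G G' : ChartFamily S)

/-- A `T`-point of the functor over `S` glued from the family `G`: a `T`-point of `S`, together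
with a compatible family of liftings to `G V` of its local factorisations through the
charts `V` of `S`. -/
structure Point (T : Scheme.{u}) where
  base : yon.obj T ⟶ S
  map : ∀ (V : Chart S) (W : Scheme.{u}) (g : W ⟶ T) (w : W ⟶ Spec V.ring),
    yon.map g ≫ base = yon.map w ≫ V.pt → (W ⟶ G.obj V)
  map_toBase : ∀ (V : Chart S) (W : Scheme.{u}) (g : W ⟶ T) (w : W ⟶ Spec V.ring)
    (h : yon.map g ≫ base = yon.map w ≫ V.pt), map V W g w h ≫ G.toBase V = w
  map_comp : ∀ (V : Chart S) (W W' : Scheme.{u}) (k : W' ⟶ W) (g : W ⟶ T)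
    (w : W ⟶ Spec V.ring) (h : yon.map g ≫ base = yon.map w ≫ V.pt)
    (h' : yon.map (k ≫ g) ≫ base = yon.map (k ≫ w) ≫ V.pt),
    map V W' (k ≫ g) (k ≫ w) h' = k ≫ map V W g w h
  map_chart : ∀ (V V' : Chart S) (c : V'.Hom V) (W : Scheme.{u}) (g : W ⟶ T)
    (w : W ⟶ Spec V'.ring) (h' : yon.map g ≫ base = yon.map w ≫ V'.pt)
    (h : yon.map g ≫ base = yon.map (w ≫ Spec.map c.φ) ≫ V.pt),
    map V W g (w ≫ Spec.map c.φ) h = map V' W g w h' ≫ G.map c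

variable {G G'}

lemma Point.ext {T : Scheme.{u}} {z z' : G.Point T} (hb : z.base = z'.base)
    (hm : ∀ V W g w h h', z.map V W g w h = z'.map V W g w h') : z = z' := by
  obtain ⟨b, m, _, _, _⟩ := z
  obtain ⟨b', m', _, _, _⟩ := z'
  obtain rfl : b = b' := hb
  obtain rfl : m = m' := by
    funext V W g w h
    exact hm V W g w h h
  rfl

lemma Point.map_congr {T : Scheme.{u}} (z : G.Point T) {V : Chart S} {W : Scheme.{u}}
    {g g' : W ⟶ T} (hg : g = g') {w : W ⟶ Spec V.ring} (h h') :
    z.map V W g w h = z.map V W g' w h' := by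
  subst hg
  rfl

/-- The restriction of a point along `k : T' ⟶ T`. -/
def Point.res {T T' : Scheme.{u}} (k : T' ⟶ T) (z : G.Point T) : G.Point T' where
  base := yon.map k ≫ z.base
  map V W g w h := z.map V W (g ≫ k) w (by rw [← h, Functor.map_comp, Category.assoc])
  map_toBase V W g w h := z.map_toBase _ _ _ _ _
  map_comp V W W' l g w h h' := by
    rw [← z.map_comp]
    · exact z.map_congr (Category.assoc _ _ _) _ _
    · rw [← Category.assoc, Functor.map_comp, Category.assoc, h']
  map_chart V V' c W g w h' h := z.map_chart _ _ _ _ _ _ _ _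

variable (G) in
/-- The functor over `S` glued from the family `G`. -/
def glue : PSh.{u} where
  obj T := G.Point T.unop
  map k := ↾ fun z => z.res k.unop
  map_id T := by
    ext z
    refine Point.ext ?_ fun V W g w h h' => ?_
    · exact (congrArg (· ≫ z.base) (yon.map_id _)).trans (Category.id_comp _)
    · exact z.map_congr (Category.comp_id _) _ _
  map_comp k l := by
    ext z
    refine Point.ext ?_ fun V W g w h h' => ?_
    · exact (congrArg (· ≫ z.base) (yon.map_comp _ _)).trans (Category.assoc _ _ _)
    · exact z.map_congr (Category.assoc _ _ _).symm _ _

/-- The identification of morphisms `T ⟶ G.glue` with points. -/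
def pointEquiv {T : Scheme.{u}} : (yon.obj T ⟶ G.glue) ≃ G.Point T := uliftYonedaEquiv.{u + 1}

lemma pointEquiv_comp {T T' : Scheme.{u}} (k : T' ⟶ T) (z : yon.obj T ⟶ G.glue) :
    pointEquiv (yon.map k ≫ z) = (pointEquiv z).res k :=
  (uliftYonedaEquiv_naturality (F := G.glue) z k.op).symm

variable (G) in
/-- The structure morphism of the glued functor. -/
def glueToBase : G.glue ⟶ S where
  app T := ↾ fun z => uliftYonedaEquiv z.base
  naturality T T' k := by
    ext z
    exact (uliftYonedaEquiv_naturality _ _).symm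

/-- The morphism to the glued functor given by a functorial construction of points. -/
def lift {X : PSh.{u}} (Φ : ∀ T : Scheme.{u}, (yon.obj T ⟶ X) → G.Point T)
    (hΦ : ∀ (T T' : Scheme.{u}) (k : T' ⟶ T) (x : yon.obj T ⟶ X),
      (Φ T x).res k = Φ T' (yon.map k ≫ x)) : X ⟶ G.glue where
  app T := ↾ fun x => Φ T.unop (uliftYonedaEquiv.symm x)
  naturality T T' k := by
    ext x
    refine (congrArg (Φ T'.unop) (uliftYonedaEquiv_symm_map k x)).trans ?_
    exact (hΦ _ _ k.unop _).symm

variable (G G') in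
/-- A morphism of families. -/
structure Hom where
  app : ∀ V, G.obj V ⟶ G'.obj V
  toBase : ∀ V, app V ≫ G'.toBase V = G.toBase V
  comm : ∀ {V' V : Chart S} (c : V'.Hom V), G.map c ≫ app V = app V' ≫ G'.map c

/-- The image of a point under a morphism of families. -/
def Hom.point (θ : G.Hom G') {T : Scheme.{u}} (z : G.Point T) : G'.Point T where
  base := z.base
  map V W g w h := z.map V W g w h ≫ θ.app V
  map_toBase V W g w h := by rw [Category.assoc, θ.toBase, z.map_toBase]
  map_comp V W W' k g w h h' := by rw [z.map_comp V W W' k g w h h', Category.assoc]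
  map_chart V V' c W g w h' h := by
    rw [z.map_chart V V' c W g w h' h, Category.assoc, Category.assoc, θ.comm]

/-- The morphism of glued functors induced by a morphism of families. -/
def Hom.glue (θ : G.Hom G') : G.glue ⟶ G'.glue where
  app T := ↾ fun z => θ.point z

end ChartFamily

section Rees

variable {X S : PSh.{u}} {f : X ⟶ S} (hf : AffineOver f)
  {smul : ∀ T : Scheme.{u}, Γ(T, ⊤) → (yon.obj T ⟶ X) → (yon.obj T ⟶ X)}
  (hμ : IsGaAction f smul)

/-- The structure morphism `Spec A₀(V) ⟶ V`. -/
noncomputable def invStr (V : Chart S) : Spec (.of (chartD hf hμ V).inv) ⟶ Spec V.ring :=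
  Spec.map (CommRingCat.ofHom (algebraMap V.ring (chartD hf hμ V).inv))

lemma inv_invStr {V' V : Chart S} (h : V'.Hom V) :
    Spec.map (CommRingCat.ofHom (chartHom hf h hμ).inv) ≫ invStr hf hμ V =
      invStr hf hμ V' ≫ Spec.map h.φ := by
  rw [invStr, invStr, ← Spec.map_comp, ← Spec.map_comp]
  congr 1
  refine CommRingCat.hom_ext (RingHom.ext fun b => Subtype.ext ?_)
  exact (ConcreteCategory.congr_hom (coord_isPushout hf h).w b)

/-- The family of the schemes `Spec A₀(V)`. -/
noncomputable def invFamily : ChartFamily S where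
  obj V := Spec (.of (chartD hf hμ V).inv)
  toBase V := invStr hf hμ V
  map h := Spec.map (CommRingCat.ofHom (chartHom hf h hμ).inv)
  w h := inv_invStr hf hμ h

/-- The family of the schemes `Proj R(V)`. -/
noncomputable def reesFamily : ChartFamily S where
  obj V := Proj (chartD hf hμ V).reesGrading
  toBase V := (chartD hf hμ V).reesToInv ≫ invStr hf hμ V
  map h := (chartHom hf h hμ).proj
  w {V' V} h := by
    rw [Category.assoc, ← inv_invStr hf hμ h, ← Category.assoc, ← Category.assoc,
      (chartHom hf h hμ).proj_reesToInv]

/-- The relative spectrum `X₀ = Spec_S A₀`. -/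
noncomputable def specInv : PSh.{u} := (invFamily hf hμ).glue

/-- The relative homogeneous spectrum `Proj_S R(X, μ)` of the Rees algebra, obtained by gluing the
schemes `Proj R(V)` along the étale charts `V` of `S`. -/
noncomputable def projRees : PSh.{u} := (reesFamily hf hμ).glue

/-- The structure morphism `Proj_S R(X, μ) ⟶ S`. -/
noncomputable def projReesToBase : projRees hf hμ ⟶ S := (reesFamily hf hμ).glueToBase

/-- The canonical morphism `Proj_S R(X, μ) ⟶ X₀`. -/
noncomputable def projReesToInv : projRees hf hμ ⟶ specInv hf hμ :=
  ChartFamily.Hom.glue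
    { app := fun V => (chartD hf hμ V).reesToInv
      toBase := fun _ => rfl
      comm := fun c => (chartHom hf c hμ).proj_reesToInv }

/-- The morphism from `X` to a glued functor that is given by compatible morphisms
`X ×_S V ⟶ G V`. -/
noncomputable def toGlue (G : ChartFamily S) (j : ∀ V, XV hf V ⟶ G.obj V)
    (hj : ∀ V, j V ≫ G.toBase V = XV.snd hf V)
    (hc : ∀ {V' V : Chart S} (c : V'.Hom V), j V' ≫ G.map c = XV.map hf c ≫ j V) : X ⟶ G.glue :=
  ChartFamily.lift (fun T x =>
    { base := x ≫ f
      map := fun V W g w h => XV.lift hf V (yon.map g ≫ x) w (by rw [← h, Category.assoc]) ≫ j V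
      map_toBase := fun V W g w h => by rw [Category.assoc, hj, XV.lift_snd]
      map_comp := fun V W W' k g w h h' => by
        refine Eq.trans (congrArg (· ≫ j V) ?_) (Category.assoc _ _ _)
        refine XV.hom_ext hf ?_ ?_
        · rw [XV.lift_fst, Functor.map_comp, Functor.map_comp, Category.assoc, Category.assoc,
            XV.lift_fst]
        · rw [XV.lift_snd, Category.assoc, XV.lift_snd]
      map_chart := fun V V' c W g w h' h => by
        refine Eq.trans (congrArg (· ≫ j V) ?_) ((Category.assoc _ _ _).trans
          ((congrArg (_ ≫ ·) (hc c)).trans (Category.assoc _ _ _).symm)).symm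
        refine XV.hom_ext hf ?_ ?_
        · rw [XV.lift_fst, Functor.map_comp, Category.assoc, XV.map_fst, XV.lift_fst]
        · rw [XV.lift_snd, Category.assoc, XV.map_snd, XV.lift_snd_assoc] })
    (fun T T' k x => ChartFamily.Point.ext (Category.assoc _ _ _).symm
      (fun V W g w h h' => by
        change XV.lift hf V _ w _ ≫ j V = XV.lift hf V _ w _ ≫ j V
        congr 2))

/-- The open embedding `X ×_S V ≅ Spec A(V) ⟶ Proj R(V)`. -/
noncomputable def chartEmb (V : Chart S) : XV hf V ⟶ Proj (chartD hf hμ V).reesGrading :=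
  (XV hf V).isoSpec.hom ≫ (chartD hf hμ V).openEmb

/-- The morphism `X ×_S V ≅ Spec A(V) ⟶ Spec A₀(V)`. -/
noncomputable def chartQuot (V : Chart S) : XV hf V ⟶ Spec (.of (chartD hf hμ V).inv) :=
  (XV hf V).isoSpec.hom ≫ Spec.map (CommRingCat.ofHom (chartD hf hμ V).inv.val.toRingHom)

lemma chartEmb_reesToInv (V : Chart S) :
    chartEmb hf hμ V ≫ (chartD hf hμ V).reesToInv = chartQuot hf hμ V := by
  rw [chartEmb, Category.assoc, LFIHD.openEmb_reesToInv, chartQuot]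

lemma chartQuot_invStr (V : Chart S) :
    chartQuot hf hμ V ≫ invStr hf hμ V = XV.snd hf V := by
  have h : Spec.map (CommRingCat.ofHom (chartD hf hμ V).inv.val.toRingHom) ≫ invStr hf hμ V =
      Spec.map (XV.snd hf V).appTop ≫ (Spec V.ring).isoSpec.inv := by
    rw [invStr, Scheme.isoSpec_Spec_inv, ← Spec.map_comp, ← Spec.map_comp]
    rfl
  rw [chartQuot, Category.assoc, h, ← Category.assoc, Scheme.isoSpec_hom_naturality,
    Category.assoc, Iso.hom_inv_id, Category.comp_id]

lemma isoSpec_coordMap {V' V : Chart S} (c : V'.Hom V) :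
    (XV hf V').isoSpec.hom ≫ Spec.map (CommRingCat.ofHom (chartHom hf c hμ).toHom) =
      XV.map hf c ≫ (XV hf V).isoSpec.hom :=
  Scheme.isoSpec_hom_naturality (XV.map hf c)

lemma chartEmb_naturality {V' V : Chart S} (c : V'.Hom V) :
    chartEmb hf hμ V' ≫ (chartHom hf c hμ).proj = XV.map hf c ≫ chartEmb hf hμ V := by
  rw [chartEmb, chartEmb, Category.assoc, LFIHD.Hom.openEmb_proj, ← Category.assoc,
    ← Category.assoc]
  exact congrArg (· ≫ _) (isoSpec_coordMap hf hμ c)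

/-- The canonical morphism `X ⟶ X₀`. -/
noncomputable def toSpecInv : X ⟶ specInv hf hμ :=
  toGlue hf (invFamily hf hμ) (chartQuot hf hμ) (chartQuot_invStr hf hμ) (fun {V' V} c => by
    have h := (chartHom hf c hμ).proj_reesToInv
    have h1 := congrArg (chartEmb hf hμ V' ≫ ·) h
    simp only [← Category.assoc] at h1
    rw [chartEmb_naturality, chartEmb_reesToInv, Category.assoc, chartEmb_reesToInv] at h1
    exact h1.symm)

/-- The canonical morphism `j : X ⟶ Proj_S R(X, μ)`. -/
noncomputable def toProjRees : X ⟶ projRees hf hμ :=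
  toGlue hf (reesFamily hf hμ) (chartEmb hf hμ)
    (fun V => by
      refine (Category.assoc _ _ _).symm.trans ?_
      exact (congrArg (· ≫ invStr hf hμ V) (chartEmb_reesToInv hf hμ V)).trans
        (chartQuot_invStr hf hμ V))
    (fun c => chartEmb_naturality hf hμ c)

/-- The action of `a ∈ 𝔾ₐ(T) = Γ(T, ⊤)` on the `T`-points of `Proj_S R(X, μ)` determined by the
homogeneous LFIHD `υR(D)` of degree `0`. -/
noncomputable def projReesSMul (T : Scheme.{u}) (a : Γ(T, ⊤)) (z : yon.obj T ⟶ projRees hf hμ) :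
    yon.obj T ⟶ projRees hf hμ :=
  (ChartFamily.pointEquiv (G := reesFamily hf hμ)).symm
    { base := (ChartFamily.pointEquiv z).base
      map := fun V W g w h =>
        (chartD hf hμ V).reesAct (g.appTop a) ((ChartFamily.pointEquiv z).map V W g w h)
      map_toBase := fun V W g w h => by
        refine Eq.trans ?_ ((ChartFamily.pointEquiv z).map_toBase V W g w h)
        refine (Category.assoc _ _ _).symm.trans ((congrArg (· ≫ invStr hf hμ V)
          (LFIHD.reesAct_reesToInv _ _)).trans (Category.assoc _ _ _))
      map_comp := fun V W W' k g w h h' => by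
        rw [(ChartFamily.pointEquiv z).map_comp V W W' k g w h h']
        exact (LFIHD.comp_reesAct k (g.appTop a) _).symm
      map_chart := fun V V' c W g w h' h => by
        rw [(ChartFamily.pointEquiv z).map_chart V V' c W g w h' h]
        exact (chartHom hf c hμ).reesAct_proj _ _ }

/-- The `T`-point `z` of `Proj_S R(X, μ)` lies in the complement of `V₊(υ)`: over each chart `V`,
its components `W ⟶ Proj R(V)` have image disjoint from the closed subset `V₊(υ)` of `Proj R(V)`,
the zero locus of the homogeneous element `υ` of degree `1`. -/
def AvoidsVPlus {T : Scheme.{u}} (z : yon.obj T ⟶ projRees hf hμ) : Prop :=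
  ∀ (V : Chart S) (W : Scheme.{u}) (g : W ⟶ T) (w : W ⟶ Spec V.ring)
    (h : yon.map g ≫ (ChartFamily.pointEquiv z).base = yon.map w ≫ V.pt) (p : W),
    ((ChartFamily.pointEquiv z).map V W g w h p : Proj (chartD hf hμ V).reesGrading) ∉
      ProjectiveSpectrum.zeroLocus (chartD hf hμ V).reesGrading {(chartD hf hμ V).υ}

end Rees

end GaRees

open AlgebraicGeometry CategoryTheory GaRees

/-! Over an affine étale chart V ⟶ S the morphism X ⟶ S becomes Spec A ⟶ V, and the target of j
becomes Proj R, with R the Rees algebra of (A, D).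

Open immersion and density. Setting υ = 1 defines R → A, and the induced map R_(υ) → A, a υⁿ / υⁿ ↦
a, is an isomorphism: it is visibly injective, and it is surjective because local finiteness puts
every a in some Fₙ (`awayLift_reesEval_bijective`). Hence j identifies Spec A with D₊(υ), the
complement of V₊(υ). As υ is a nonzerodivisor of R ⊂ A[υ], this open subset is dense
(`basicOpen_υ_dense`). Since R₀ = A₀, the morphism Proj R ⟶ Spec A₀ is separated, and it is proper
when R is of finite type over A₀.

Action. As υR(D) has degree 0, its exponential R → R[t] is graded for t of degree 0, and Proj R[t] =
𝔸¹ × Proj R. A pair (a, p) of a function and a W-point of Proj R is thus a W-point of Proj R[t], and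
Proj of the exponential moves it. The axioms of an action become identities between graded
homomorphisms (`polyPoint_projMap`): the value of exp at t = 0 is the identity, and iterating exp
amounts to adding the parameters, which is the rule Dᵢ Dⱼ = (i + j choose i) Dᵢ₊ⱼ
(`LFIHD.eval₂_exp_exp`). Equivariance of j holds because υ is invariant and υ = 1 intertwines υR(D)
with D (`projAct_specToProj`).

Globalisation. A point of a glued functor is a point of S with compatible components over the
charts. If all the components land in D₊(υ), they lift uniquely to X over each chart; the lifts
agree on refinements of charts and glue by étale descent along the representable morphism X ⟶ S
(`FactorsThrough.exists_lift`). As changes of chart send υ to υ, the condition on components does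
not depend on the chart and cuts out an open subset of the test scheme T, which represents the
pullback of j (`toGlue_relative_isOpenImmersion`). The remaining assertions are verified component
by component. -/

namespace GaRees

open Polynomial AlgebraicGeometry CategoryTheory Limits

/-! ### Elements of degree 0 as global functions on Proj -/

section DegreeZero

variable {B R B' R' : Type u} [CommRing B] [CommRing R] [Algebra B R] [CommRing B'] [CommRing R']
  [Algebra B' R'] (𝒜 : ℕ → Submodule B R) [GradedAlgebra 𝒜]
  {ℬ : ℕ → Submodule B' R'} [GradedAlgebra ℬ]

/-- The global functions on `Proj R` given by the elements of degree `0`. -/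
noncomputable def zeroSection : CommRingCat.of (𝒜 0) ⟶ Γ(Proj 𝒜, ⊤) :=
  (Scheme.ΓSpecIso (.of (𝒜 0))).inv ≫ (Proj.toSpecZero 𝒜).appTop

lemma tSection_eq_zeroSection :
    tSection 𝒜 = zeroSection (polyGrading 𝒜) ⟨X, X_mem_polyGrading 𝒜⟩ := rfl

variable {𝒜}

lemma projMap_toSpecZero (f : GradedRingHom 𝒜 ℬ)
    (hf : HomogeneousIdeal.irrelevant ℬ ≤ (HomogeneousIdeal.irrelevant 𝒜).map f) :
    Proj.map f hf ≫ Proj.toSpecZero 𝒜 =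
      Proj.toSpecZero ℬ ≫ Spec.map (CommRingCat.ofHom (zeroHom f)) := by
  have h := projMap_projToSpec f hf (RingHom.id _) (RingHom.id _) (zeroHom f) (fun _ => rfl)
  simpa only [projToSpec, CommRingCat.ofHom_id, Spec.map_id, Category.comp_id] using h

lemma zeroSection_projMap (f : GradedRingHom 𝒜 ℬ)
    (hf : HomogeneousIdeal.irrelevant ℬ ≤ (HomogeneousIdeal.irrelevant 𝒜).map f) :
    zeroSection 𝒜 ≫ (Proj.map f hf).appTop =
      CommRingCat.ofHom (zeroHom f) ≫ zeroSection ℬ := by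
  rw [zeroSection, zeroSection, Category.assoc, ← Scheme.Hom.comp_appTop, projMap_toSpecZero,
    Scheme.Hom.comp_appTop, Scheme.ΓSpecIso_inv_naturality_assoc]

lemma projMap_zeroSection (f : GradedRingHom 𝒜 ℬ)
    (hf : HomogeneousIdeal.irrelevant ℬ ≤ (HomogeneousIdeal.irrelevant 𝒜).map f) (c : 𝒜 0) :
    (Proj.map f hf).appTop (zeroSection 𝒜 c) = zeroSection ℬ (zeroHom f c) := by
  have h := ConcreteCategory.congr_hom (zeroSection_projMap f hf) c
  rwa [CommRingCat.comp_apply, CommRingCat.comp_apply] at h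

end DegreeZero

/-! ### Affine points of Proj given by homomorphisms that invert a homogeneous element -/

section SpecToProj

variable {B R B' R' C C' : Type u} [CommRing B] [CommRing R] [Algebra B R] [CommRing B']
  [CommRing R'] [Algebra B' R'] [CommRing C] [CommRing C'] {𝒜 : ℕ → Submodule B R}
  [GradedAlgebra 𝒜] {ℬ : ℕ → Submodule B' R'} [GradedAlgebra ℬ]

variable (𝒜) in
/-- The homomorphism `R_(f) → C` induced by a homomorphism `R → C` that inverts `f`. -/
noncomputable def awayLift {f : R} (φ : R →+* C) (hφ : IsUnit (φ f)) :
    HomogeneousLocalization.Away 𝒜 f →+* C :=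
  (IsLocalization.Away.lift (S := Localization.Away f) f hφ).comp (algebraMap _ _)

lemma awayLift_mk {n : ℕ} {f : R} (hf : f ∈ 𝒜 n) (φ : R →+* C) (hφ : IsUnit (φ f)) (k : ℕ) (a : R)
    (ha : a ∈ 𝒜 (k • n)) :
    awayLift 𝒜 φ hφ (HomogeneousLocalization.Away.mk 𝒜 hf k a ha) * φ f ^ k = φ a := by
  have h : (HomogeneousLocalization.Away.mk 𝒜 hf k a ha).val *
      algebraMap R (Localization.Away f) f ^ k = algebraMap R _ a := by
    rw [HomogeneousLocalization.Away.val_mk, Localization.mk_eq_mk', ← map_pow]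
    exact IsLocalization.mk'_spec _ _ _
  have h1 := congrArg (IsLocalization.Away.lift (S := Localization.Away f) f hφ) h
  rwa [map_mul, map_pow, IsLocalization.Away.lift_eq, IsLocalization.Away.lift_eq] at h1

/-- Every element of R_(f) is a fraction a / f^k and φ(f) is a unit, so this relation pins the
homomorphism down. It serves to identify composites with `awayLift`. -/
lemma awayLift_unique {n : ℕ} {f : R} (hf : f ∈ 𝒜 n) (φ : R →+* C) (hφ : IsUnit (φ f))
    (ψ : HomogeneousLocalization.Away 𝒜 f →+* C)
    (h : ∀ k a ha, ψ (HomogeneousLocalization.Away.mk 𝒜 hf k a ha) * φ f ^ k = φ a) :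
    ψ = awayLift 𝒜 φ hφ := by
  refine RingHom.ext fun z => ?_
  obtain ⟨k, a, ha, rfl⟩ := z.mk_surjective _ hf
  apply (hφ.pow k).mul_right_cancel
  rw [h, awayLift_mk]

/-- The morphism `Spec C ⟶ Proj R` given by a homomorphism `R → C` that inverts a homogeneous
element of positive degree. -/
noncomputable def specToProj {n : ℕ} {f : R} (hf : f ∈ 𝒜 n) (hn : 0 < n) (φ : R →+* C)
    (hφ : IsUnit (φ f)) : Spec (.of C) ⟶ Proj 𝒜 :=
  Spec.map (CommRingCat.ofHom (awayLift 𝒜 φ hφ)) ≫ Proj.awayι 𝒜 f hf hn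

lemma specToProj_congr {n : ℕ} {f : R} (hf : f ∈ 𝒜 n) (hn : 0 < n) {φ ψ : R →+* C}
    (h : φ = ψ) (hφ : IsUnit (φ f)) (hψ : IsUnit (ψ f)) :
    specToProj hf hn φ hφ = specToProj hf hn ψ hψ := by
  subst h
  rfl

lemma specMap_specToProj {n : ℕ} {f : R} (hf : f ∈ 𝒜 n) (hn : 0 < n) (φ : R →+* C)
    (hφ : IsUnit (φ f)) (χ : C →+* C') :
    Spec.map (CommRingCat.ofHom χ) ≫ specToProj hf hn φ hφ =
      specToProj hf hn (χ.comp φ) (hφ.map χ) := by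
  rw [specToProj, ← Category.assoc, ← Spec.map_comp, ← CommRingCat.ofHom_comp, specToProj]
  congr 3
  refine awayLift_unique hf _ _ _ fun k a ha => ?_
  rw [RingHom.comp_apply, RingHom.comp_apply, ← map_pow, ← map_mul, awayLift_mk]
  rfl

/-- Proj g carries D₊(g f) to D₊(f), on coordinate rings by a / f^k ↦ g(a) / g(f)^k. The target
element is a separate f' because in the applications g f is only provably equal to the element
inverted: exp(tE) f = f for an invariant f, and υ ↦ X under the inclusion in A[υ]. -/
lemma specToProj_projMap (g : GradedRingHom 𝒜 ℬ)
    (hg : HomogeneousIdeal.irrelevant ℬ ≤ (HomogeneousIdeal.irrelevant 𝒜).map g)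
    {n : ℕ} {f : R} (hf : f ∈ 𝒜 n) (hn : 0 < n) {f' : R'} (e : g f = f') (hf' : f' ∈ ℬ n)
    (φ : R' →+* C) (hφ : IsUnit (φ f')) :
    specToProj hf' hn φ hφ ≫ Proj.map g hg =
      specToProj hf hn (φ.comp g.toRingHom) (show IsUnit (φ (g f)) from e ▸ hφ) := by
  subst e
  rw [specToProj, Category.assoc, Proj.awayι_comp_map g hg hn f hf, ← Category.assoc,
    ← Spec.map_comp, ← CommRingCat.ofHom_comp, specToProj]
  congr 3
  refine awayLift_unique hf _ _ _ fun k a ha => ?_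
  rw [RingHom.comp_apply, HomogeneousLocalization.Away.map_mk]
  exact awayLift_mk hf' φ hφ k (g a) (g.map_mem ha)

lemma specToProj_toSpecZero {n : ℕ} {f : R} (hf : f ∈ 𝒜 n) (hn : 0 < n) (φ : R →+* C)
    (hφ : IsUnit (φ f)) : specToProj hf hn φ hφ ≫ Proj.toSpecZero 𝒜 =
      Spec.map (CommRingCat.ofHom (φ.comp (algebraMap (𝒜 0) R))) := by
  rw [specToProj, Category.assoc, Proj.awayι_toSpecZero, ← Spec.map_comp,
    ← CommRingCat.ofHom_comp]
  congr 2
  refine RingHom.ext fun c => ?_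
  have h1 := IsLocalization.Away.lift_eq (S := Localization.Away f) f hφ (c : R)
  refine Eq.trans ?_ h1
  exact congrArg (IsLocalization.Away.lift (S := Localization.Away f) f hφ)
    (Localization.mk_one_eq_algebraMap (M := Submonoid.powers f) (c : R))

lemma zeroSection_specToProj {n : ℕ} {f : R} (hf : f ∈ 𝒜 n) (hn : 0 < n) (φ : R →+* C)
    (hφ : IsUnit (φ f)) : zeroSection 𝒜 ≫ (specToProj hf hn φ hφ).appTop =
      CommRingCat.ofHom (φ.comp (algebraMap (𝒜 0) R)) ≫ (Scheme.ΓSpecIso (.of C)).inv := by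
  rw [zeroSection, Category.assoc, ← Scheme.Hom.comp_appTop, specToProj_toSpecZero,
    Scheme.ΓSpecIso_inv_naturality]

lemma specToProj_zeroSection {n : ℕ} {f : R} (hf : f ∈ 𝒜 n) (hn : 0 < n) (φ : R →+* C)
    (hφ : IsUnit (φ f)) (c : 𝒜 0) :
    (specToProj hf hn φ hφ).appTop (zeroSection 𝒜 c) = (Scheme.ΓSpecIso (.of C)).inv (φ c) := by
  have h := ConcreteCategory.congr_hom (zeroSection_specToProj hf hn φ hφ) c
  rwa [CommRingCat.comp_apply, CommRingCat.comp_apply] at h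

end SpecToProj

/-! ### Points of Proj R[t] as pairs of a point of Proj R and a function -/

section PolyPoint

variable {B R B' R' : Type u} [CommRing B] [CommRing R] [Algebra B R] [CommRing B'] [CommRing R']
  [Algebra B' R'] {𝒜 : ℕ → Submodule B R} [GradedAlgebra 𝒜]
  {ℬ : ℕ → Submodule B' R'} [GradedAlgebra ℬ] {W : Scheme.{u}}

/-- The `W`-point of `Proj R[t]` given by a `W`-point of `Proj R` and a value of `t`. -/
noncomputable def polyPoint (a : Γ(W, ⊤)) (p : W ⟶ Proj 𝒜) : W ⟶ Proj (polyGrading 𝒜) :=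
  AffineSpace.homOfVector p (fun _ => a) ≫ CategoryTheory.inv (projPolyTo 𝒜)

/-- Uniqueness in the universal property of 𝔸¹ × Proj R, carried over to Proj R[t] by the
isomorphism `projPolyTo`. -/
lemma polyPoint_unique (a : Γ(W, ⊤)) (p : W ⟶ Proj 𝒜) (r : W ⟶ Proj (polyGrading 𝒜))
    (h₁ : r ≫ Proj.map (constHom 𝒜) (constHom_irrelevant 𝒜) = p)
    (h₂ : r.appTop (tSection 𝒜) = a) : polyPoint a p = r := by
  rw [polyPoint, IsIso.comp_inv_eq]
  apply AffineSpace.hom_ext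
  · rw [AffineSpace.homOfVector_over, Category.assoc, projPolyTo, AffineSpace.homOfVector_over, h₁]
  · intro i
    rw [AffineSpace.homOfVector_appTop_coord, Scheme.Hom.comp_appTop, CommRingCat.comp_apply,
      projPolyTo, AffineSpace.homOfVector_appTop_coord, h₂]

lemma polyPoint_const (a : Γ(W, ⊤)) (p : W ⟶ Proj 𝒜) :
    polyPoint a p ≫ Proj.map (constHom 𝒜) (constHom_irrelevant 𝒜) = p := by
  have h : projPolyTo 𝒜 ≫ (𝔸(PUnit.{u + 1}; Proj 𝒜) ↘ Proj 𝒜) =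
      Proj.map (constHom 𝒜) (constHom_irrelevant 𝒜) := AffineSpace.homOfVector_over _ _
  rw [← h, polyPoint, Category.assoc, IsIso.inv_hom_id_assoc, AffineSpace.homOfVector_over]

lemma polyPoint_tSection (a : Γ(W, ⊤)) (p : W ⟶ Proj 𝒜) :
    (polyPoint a p).appTop (tSection 𝒜) = a := by
  have h : (projPolyTo 𝒜).appTop (AffineSpace.coord _ PUnit.unit) = tSection 𝒜 :=
    AffineSpace.homOfVector_appTop_coord _ _ _
  rw [← h, ← CommRingCat.comp_apply, ← Scheme.Hom.comp_appTop, polyPoint, Category.assoc,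
    IsIso.inv_hom_id, Category.comp_id, AffineSpace.homOfVector_appTop_coord]

/-- This form trades affine space for Proj R[t], where everything is a Proj of a graded
homomorphism. -/
lemma projAct_eq_polyPoint (E : LFIHD B R)
    (hE : ∀ (i n : ℕ) (a : R), a ∈ 𝒜 n → E.D i a ∈ 𝒜 n) (a : Γ(W, ⊤)) (p : W ⟶ Proj 𝒜) :
    projAct E hE a p =
      polyPoint a p ≫ Proj.map (expHom 𝒜 E hE) (expHom_irrelevant 𝒜 E hE) := by
  rw [projAct, polyPoint, projExp, Category.assoc]

end PolyPoint

end GaRees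

namespace GaRees

open Polynomial AlgebraicGeometry CategoryTheory Limits

/-! ### The action on Proj R defined by an LFIHD of degree 0 -/

section ProjAct

variable {B R B' R' : Type u} [CommRing B] [CommRing R] [Algebra B R] [CommRing B'] [CommRing R']
  [Algebra B' R'] {𝒜 : ℕ → Submodule B R} [GradedAlgebra 𝒜]
  {ℬ : ℕ → Submodule B' R'} [GradedAlgebra ℬ] {W : Scheme.{u}}

/-- The homomorphism `R[t] → R'` of graded rings that extends `g : R → R'` and maps `t` to an
element `c` of degree `0`. -/
noncomputable def polyEval (g : GradedRingHom 𝒜 ℬ) (c : ℬ 0) :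
    GradedRingHom (polyGrading 𝒜) ℬ where
  toRingHom := eval₂RingHom g.toRingHom c
  map_mem {n p} hp := by
    change eval₂ g.toRingHom (c : R') p ∈ ℬ n
    rw [eval₂_eq_sum_range]
    refine sum_mem fun i _ => ?_
    have h : (c : R') ^ i ∈ ℬ 0 := by simpa using SetLike.pow_mem_graded i c.2
    simpa using SetLike.mul_mem_graded (g.map_mem (hp i)) h

/-- The homomorphism g is the restriction of `polyEval g c` to constants, so the image of the larger
irrelevant ideal contains that of the smaller. -/
lemma polyEval_irrelevant (g : GradedRingHom 𝒜 ℬ)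
    (hg : HomogeneousIdeal.irrelevant ℬ ≤ (HomogeneousIdeal.irrelevant 𝒜).map g) (c : ℬ 0) :
    HomogeneousIdeal.irrelevant ℬ ≤
      (HomogeneousIdeal.irrelevant (polyGrading 𝒜)).map (polyEval g c) := by
  refine hg.trans ?_
  change Ideal.map g.toRingHom _ ≤ Ideal.map (polyEval g c).toRingHom _
  have h : g.toRingHom = (polyEval g c).toRingHom.comp C :=
    RingHom.ext fun a => (eval₂_C _ _).symm
  rw [h, ← Ideal.map_map]
  refine Ideal.map_mono ?_
  rw [Ideal.map_le_iff_le_comap]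
  refine (HomogeneousIdeal.toIdeal_irrelevant_le _).2 fun n hn a ha => ?_
  exact HomogeneousIdeal.mem_irrelevant_of_mem (polyGrading 𝒜) hn ((constHom 𝒜).map_mem ha)

/-- Both sides have the same point of Proj R and the same value of t. When the point and the
parameter both come from one Proj, this replaces `polyPoint` by a graded homomorphism, so that the
axioms of an action reduce to algebra. -/
lemma polyPoint_projMap (r : W ⟶ Proj ℬ) (g : GradedRingHom 𝒜 ℬ)
    (hg : HomogeneousIdeal.irrelevant ℬ ≤ (HomogeneousIdeal.irrelevant 𝒜).map g) (c : ℬ 0) :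
    polyPoint (r.appTop (zeroSection ℬ c)) (r ≫ Proj.map g hg) =
      r ≫ Proj.map (polyEval g c) (polyEval_irrelevant g hg c) := by
  apply polyPoint_unique
  · rw [Category.assoc, ← Proj.map_comp]
    exact congrArg (r ≫ ·) (projMap_congr (fun a => eval₂_C _ _) _ _)
  · rw [Scheme.Hom.comp_appTop, CommRingCat.comp_apply, tSection_eq_zeroSection,
      projMap_zeroSection]
    congr 2
    exact Subtype.ext (eval₂_X _ _)

variable (E : LFIHD B R) (hE : ∀ (i n : ℕ) (a : R), a ∈ 𝒜 n → E.D i a ∈ 𝒜 n)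

/-- Acting by 0 is Proj of the exponential evaluated at t = 0, which is D₀ = id. -/
lemma projAct_zero (p : W ⟶ Proj 𝒜) : projAct E hE 0 p = p := by
  have h := polyPoint_projMap p (.id 𝒜) (by simp) 0
  rw [map_zero, map_zero, Proj.map_id, Category.comp_id] at h
  rw [projAct_eq_polyPoint, h, Category.assoc, ← Proj.map_comp]
  conv_rhs => rw [← Category.comp_id p, ← Proj.map_id]
  refine congrArg (p ≫ ·) (projMap_congr (fun a => ?_) _ _)
  change eval₂ (RingHom.id R) 0 (E.exp a) = a
  rw [eval₂_at_zero, E.coeff_exp, E.D_zero_apply]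
  rfl

/-- The additive group law in terms of exp: with outer variable s and inner variable t, the
coefficient of sⁱ tʲ is Dⱼ Dᵢ x on the left and (i + j choose i) Dᵢ₊ⱼ x on the right, and these
agree by the iteration rule. -/
lemma LFIHD.eval₂_exp_exp (x : R) :
    eval₂ (C.comp E.exp) (X : R[X][X]) (E.exp x) = eval₂ (C.comp C) (X + C X) (E.exp x) := by
  ext i j
  simp only [eval₂_eq_sum_range, finsetSum_coeff]
  have h1 : ∀ n, (((C.comp C : R →+* R[X][X]) ((E.exp x).coeff n) * (X + C X) ^ n).coeff i).coeff j
      = if n = i + j then (i + j).choose i • (E.exp x).coeff (i + j) else 0 := by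
    intro n
    rw [RingHom.comp_apply, coeff_C_mul, coeff_C_mul, coeff_X_add_C_pow, ← nsmul_eq_mul',
      coeff_smul, mul_smul_comm, coeff_X_pow, mul_ite, mul_one, mul_zero, smul_ite, smul_zero]
    rcases lt_or_ge n i with h3 | h3
    · rw [Nat.choose_eq_zero_of_lt h3, if_neg (show ¬ n = i + j by omega), zero_nsmul, ite_self]
    · split_ifs with h4 h5 h5
      · rw [h5]
      · omega
      · omega
      · rfl
  have h2 : ∀ n, (((C.comp E.exp : R →+* R[X][X]) ((E.exp x).coeff n) * X ^ n).coeff i).coeff j =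
      if n = i then (i + j).choose i • (E.exp x).coeff (i + j) else 0 := by
    intro n
    rw [RingHom.comp_apply, coeff_C_mul, coeff_X_pow, mul_ite, mul_one, mul_zero]
    split_ifs with h4 h5 h5
    · rw [E.coeff_exp, E.coeff_exp, E.coeff_exp, ← h4, E.iter, add_comm j i, h4, 
        ← Nat.choose_symm_add]
    · exact absurd h4.symm h5
    · exact absurd h5.symm h4
    · rfl
  rw [Finset.sum_congr rfl fun n _ => h1 n, Finset.sum_congr rfl fun n _ => h2 n,
    Finset.sum_ite_eq', Finset.sum_ite_eq']
  -- The two sums stop at the degree of exp x. Beyond it the coefficient Dᵢ₊ⱼ x vanishes, so it does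
  -- not matter that one sum selects the index i + j and the other the index i.
  by_cases h : i + j ≤ (E.exp x).natDegree
  · rw [if_pos (by simp; omega), if_pos (by simp; omega)]
  · rw [coeff_eq_zero_of_natDegree_lt (by omega), smul_zero, ite_self, ite_self]

/-- The triple (a, b, p) is a single point r of Proj R[t][s], with s ↦ a and t ↦ b. Both sides are r
followed by Proj of a graded homomorphism R → R[t][s], and these homomorphisms coincide by
`LFIHD.eval₂_exp_exp`. -/
lemma projAct_add (a b : Γ(W, ⊤)) (p : W ⟶ Proj 𝒜) :
    projAct E hE (a + b) p = projAct E hE a (projAct E hE b p) := by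
  let ℬ := polyGrading 𝒜
  let t : ℬ 0 := ⟨X, X_mem_polyGrading 𝒜⟩
  -- The outer variable s carries the parameter a, which acts second; s' is the inner variable t,
  -- regarded in R[t][s], and carries b, which acts first.
  let s : polyGrading ℬ 0 := ⟨X, X_mem_polyGrading ℬ⟩
  let s' : polyGrading ℬ 0 := zeroHom (constHom ℬ) t
  let q := polyPoint b p
  let r := polyPoint a q
  have hq : r ≫ Proj.map (constHom ℬ) (constHom_irrelevant ℬ) = q := polyPoint_const a q
  have ha : r.appTop (zeroSection _ s) = a := polyPoint_tSection a q
  have hb : r.appTop (zeroSection _ s') = b := by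
    have h := projMap_zeroSection (constHom ℬ) (constHom_irrelevant ℬ) t
    rw [← h, ← CommRingCat.comp_apply, ← Scheme.Hom.comp_appTop, hq]
    exact polyPoint_tSection b p
  -- The lift of (a, b · p) corresponds to exp on coefficients and t ↦ s; the lift of (a + b, p),
  -- computed next, corresponds to constants on coefficients and t ↦ s + s'.
  have h1 := polyPoint_projMap r ((constHom ℬ).comp (expHom 𝒜 E hE))
    (HomogeneousIdeal.irrelevant_le_map_comp (expHom_irrelevant 𝒜 E hE)
      (constHom_irrelevant ℬ)) s
  have h2 := polyPoint_projMap r ((constHom ℬ).comp (constHom 𝒜))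
    (HomogeneousIdeal.irrelevant_le_map_comp (constHom_irrelevant 𝒜) (constHom_irrelevant ℬ))
    (s + s')
  rw [Proj.map_comp _ _ (expHom_irrelevant 𝒜 E hE) (constHom_irrelevant ℬ), ← Category.assoc,
    hq, ha, ← projAct_eq_polyPoint] at h1
  rw [Proj.map_comp _ _ (constHom_irrelevant 𝒜) (constHom_irrelevant ℬ), ← Category.assoc,
    hq, polyPoint_const, map_add, map_add, ha, hb] at h2
  rw [projAct_eq_polyPoint E hE a, h1, projAct_eq_polyPoint, h2, Category.assoc, Category.assoc,
    ← Proj.map_comp, ← Proj.map_comp]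
  exact congrArg (r ≫ ·) (projMap_congr (fun x => (E.eval₂_exp_exp x).symm) _ _)

/-- The action on a point of `Proj R` that comes from a homomorphism `R → A` that is compatible
with the LFIHDs and inverts an invariant homogeneous element. -/
lemma projAct_specToProj {B₁ A : Type u} [CommRing B₁] [CommRing A] [Algebra B₁ A]
    (E' : LFIHD B₁ A) {n : ℕ} {f : R} (hf : f ∈ 𝒜 n) (hn : 0 < n) (hfE : E.exp f = C f)
    (φ : R →+* A) (hφ : IsUnit (φ f)) (hE' : ∀ i x, φ (E.D i x) = E'.D i (φ x))
    (y : W ⟶ Spec (.of A[X])) :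
    projAct E hE (y.appTop ((Scheme.ΓSpecIso (.of A[X])).inv X))
      (y ≫ Spec.map (CommRingCat.ofHom C) ≫ specToProj hf hn φ hφ) =
      y ≫ Spec.map (CommRingCat.ofHom E'.exp) ≫ specToProj hf hn φ hφ := by
  have hC : C f ∈ polyGrading 𝒜 n := (constHom 𝒜).map_mem hf
  have hψ : IsUnit (mapRingHom φ (C f)) := by
    rw [coe_mapRingHom, map_C]
    exact hφ.map C
  -- The pair lifts to the point of Proj R[t] given by φ[t] : R[t] → A[t], which inverts the
  -- constant f.
  have h1 : polyPoint (y.appTop ((Scheme.ΓSpecIso (.of A[X])).inv X))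
      (y ≫ Spec.map (CommRingCat.ofHom C) ≫ specToProj hf hn φ hφ) =
      y ≫ specToProj hC hn (mapRingHom φ) hψ := by
    apply polyPoint_unique
    · rw [Category.assoc, specToProj_projMap (constHom 𝒜) _ hf hn (constHom_apply 𝒜 f), specMap_specToProj]
      refine congrArg (y ≫ ·) (specToProj_congr hf hn (RingHom.ext fun x => ?_) _ _)
      exact map_C φ
    · rw [Scheme.Hom.comp_appTop, CommRingCat.comp_apply, tSection_eq_zeroSection,
        specToProj_zeroSection]
      congr 2
      exact map_X φ
  -- Invariance of f is what lets Proj(exp) send the chart D₊(C f) to D₊(f). It remains to compare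
  -- φ[t] ∘ exp with exp ∘ φ coefficient by coefficient.
  rw [projAct_eq_polyPoint, h1, Category.assoc,
    specToProj_projMap (expHom 𝒜 E hE) _ hf hn hfE, specMap_specToProj]
  refine congrArg (y ≫ ·) (specToProj_congr hf hn (RingHom.ext fun x => ?_) _ _)
  change (E.exp x).map φ = E'.exp (φ x)
  ext i
  rw [coeff_map, E.coeff_exp, E'.coeff_exp, hE']

end ProjAct

end GaRees

namespace GaRees

open Polynomial AlgebraicGeometry CategoryTheory Limits

/-! ### Separatedness and properness over the degree 0 part -/

section ProjToSpec

variable {B R C : Type u} [CommRing B] [CommRing R] [Algebra B R] [CommRing C]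
  {𝒜 : ℕ → Submodule B R} [GradedAlgebra 𝒜]

lemma isIso_specMap_of_bijective (ρ : C →+* 𝒜 0) (hρ : Function.Bijective ρ) :
    IsIso (Spec.map (CommRingCat.ofHom ρ)) := by
  have : IsIso (CommRingCat.ofHom ρ) := by
    rw [ConcreteCategory.isIso_iff_bijective]
    exact hρ
  infer_instance

lemma isSeparated_projToSpec (ρ : C →+* 𝒜 0) (hρ : Function.Bijective ρ) :
    IsSeparated (projToSpec 𝒜 ρ) := by
  have := isIso_specMap_of_bijective ρ hρ
  rw [projToSpec]
  infer_instance

/-- Finite type over C implies finite type over R₀, and Proj R is then proper over Spec R₀, with no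
condition on the degrees of the generators; ρ only contributes an isomorphism. -/
lemma isProper_projToSpec (ρ : C →+* 𝒜 0) (hρ : Function.Bijective ρ)
    (h : ((algebraMap (𝒜 0) R).comp ρ).FiniteType) :
    IsProper (projToSpec 𝒜 ρ) := by
  have := isIso_specMap_of_bijective ρ hρ
  have : Algebra.FiniteType (𝒜 0) R := 
    RingHom.finiteType_algebraMap.1 (RingHom.FiniteType.of_comp_finiteType h)
  rw [projToSpec]
  infer_instance

end ProjToSpec

/-! ### The Rees algebra: the chart D₊(υ), equivariance, density -/

namespace LFIHD

variable {B A : Type u} [CommRing B] [CommRing A] [Algebra B A] (E : LFIHD B A)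

/-- The homomorphism from the Rees algebra to `A` that maps `υ` to `1`. -/
noncomputable def reesEval : E.rees →+* A := (evalRingHom 1).comp E.rees.val.toRingHom

lemma υ_mem : E.υ ∈ E.reesGrading 1 := E.reesMonomial_mem _ _ _

lemma reesEval_apply (p : E.rees) : E.reesEval p = eval 1 (p : A[X]) := rfl

lemma reesEval_υ : E.reesEval E.υ = 1 := by
  rw [reesEval_apply, coe_υ, eval_X]

lemma isUnit_reesEval_υ : IsUnit (E.reesEval E.υ) := by
  rw [reesEval_υ]
  exact isUnit_one

lemma reesEval_of_mem {n : ℕ} {p : E.rees} (hp : p ∈ E.reesGrading n) :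
    E.reesEval p = (p : A[X]).coeff n := by
  have h : (p : A[X]) = C ((p : A[X]).coeff n) * X ^ n := eq_of_mem_stdGrading (B := B) hp
  rw [reesEval_apply, h]
  simp

/-- The detour through Proj A[υ] disappears, because evaluating A[υ] at υ = 1 restricts to
`reesEval` on the Rees algebra and the inclusion sends υ to the variable. -/
lemma openEmb_eq_specToProj :
    E.openEmb = specToProj E.υ_mem one_pos E.reesEval E.isUnit_reesEval_υ := by
  have h : IsUnit (evalRingHom (1 : A) X) := by simp
  have h1 := specToProj_projMap E.η E.η_irrelevant E.υ_mem one_pos (f' := X) E.coe_υ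
    (X_mem_stdGrading B A) (evalRingHom 1) h
  rw [openEmb, ← Category.assoc]
  exact h1

/-- In A[υ] the element υ is the variable, hence a nonzerodivisor. -/
lemma υ_mul_injective : Function.Injective (E.υ * ·) := by
  intro p q h
  have h1 : (X : A[X]) * (p : A[X]) = X * (q : A[X]) := by
    rw [← E.coe_υ]
    exact congrArg Subtype.val h
  refine Subtype.ext (Polynomial.ext fun n => ?_)
  rw [← coeff_X_mul, h1, coeff_X_mul]

lemma exists_mem_F (a : A) : ∃ n, a ∈ E.F n := by
  obtain ⟨n, hn⟩ := E.locFin a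
  exact ⟨n, E.mem_F.2 hn⟩

/-- An element of R_(υ) is a υᵏ / υᵏ with a in Fₖ, and its image is a: this gives injectivity.
Surjectivity says that the Fₙ exhaust A, which is local finiteness. -/
lemma awayLift_reesEval_bijective :
    Function.Bijective (awayLift E.reesGrading E.reesEval E.isUnit_reesEval_υ) := by
  constructor
  · rw [injective_iff_map_eq_zero]
    intro z hz
    obtain ⟨k, p, hp, rfl⟩ := z.mk_surjective _ E.υ_mem
    have h := awayLift_mk E.υ_mem E.reesEval E.isUnit_reesEval_υ k p hp
    rw [hz, zero_mul, E.reesEval_of_mem hp] at h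
    have hp0 : p = 0 := by
      refine Subtype.ext ((eq_of_mem_stdGrading (B := B) hp).trans ?_)
      change C ((p : A[X]).coeff (k • 1)) * X ^ (k • 1) = 0
      rw [← h, C_0, zero_mul]
    subst hp0
    apply HomogeneousLocalization.val_injective
    rw [HomogeneousLocalization.Away.val_mk, Localization.mk_zero, HomogeneousLocalization.val_zero]
  · intro a
    obtain ⟨n, hn⟩ := E.exists_mem_F a
    have hp : E.reesMonomial n a hn ∈ E.reesGrading (n • 1) := by
      simpa using E.reesMonomial_mem n a hn
    refine ⟨HomogeneousLocalization.Away.mk _ E.υ_mem n _ hp, ?_⟩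
    have h := awayLift_mk E.υ_mem E.reesEval E.isUnit_reesEval_υ n _ hp
    rw [E.reesEval_υ, one_pow, mul_one] at h
    refine h.trans ?_
    rw [reesEval_apply]
    exact (eval_monomial).trans (by simp)

instance : IsIso (Spec.map (CommRingCat.ofHom
    (awayLift E.reesGrading E.reesEval E.isUnit_reesEval_υ))) := by
  have : IsIso (CommRingCat.ofHom
      (awayLift E.reesGrading E.reesEval E.isUnit_reesEval_υ)) := by
    rw [ConcreteCategory.isIso_iff_bijective]
    exact E.awayLift_reesEval_bijective
  infer_instance

instance : IsOpenImmersion E.openEmb := by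
  rw [openEmb_eq_specToProj, specToProj]
  infer_instance

lemma opensRange_openEmb : E.openEmb.opensRange = Proj.basicOpen E.reesGrading E.υ := by
  have h : E.openEmb = Spec.map (CommRingCat.ofHom
      (awayLift E.reesGrading E.reesEval E.isUnit_reesEval_υ)) ≫
      Proj.awayι E.reesGrading E.υ E.υ_mem one_pos := E.openEmb_eq_specToProj
  rw [← Proj.opensRange_awayι E.reesGrading E.υ E.υ_mem one_pos]
  simp only [h]
  exact Scheme.Hom.opensRange_comp_of_isIso _ _

/-- The coefficient of υ is 1, which is killed by all Dᵢ with i > 0. -/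
lemma υR_exp_υ : E.υR.exp E.υ = C E.υ := by
  ext i : 1
  rw [coeff_exp, coeff_C]
  split_ifs with hi
  · rw [hi, D_zero_apply]
  · refine Subtype.ext (Polynomial.ext fun n => ?_)
    change (E.υreesD i E.υ : A[X]).coeff n = 0
    rw [coeff_υreesD, coe_υ, coeff_X]
    split_ifs
    · exact E.D_one i (by omega)
    · exact map_zero _

/-- The operators of υR(D) act coefficientwise by Dᵢ, and evaluation at 1 is the sum of the
coefficients, so additivity of Dᵢ suffices. -/
lemma reesEval_υR (i : ℕ) (p : E.rees) : E.reesEval (E.υR.D i p) = E.D i (E.reesEval p) := by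
  have h : ∀ (N : ℕ) (q : A[X]), q.natDegree < N → eval 1 q = ∑ n ∈ Finset.range N, q.coeff n :=
    fun N q hq => by
      rw [eval_eq_sum_range' hq]
      simp
  change eval 1 (E.υreesD i p : A[X]) = E.D i (eval 1 (p : A[X]))
  -- A common bound for both degrees lets the two sums run over the same range.
  let N := max (E.υreesD i p : A[X]).natDegree (p : A[X]).natDegree + 1
  rw [h N _ (by omega), h N _ (by omega), map_sum]
  exact Finset.sum_congr rfl fun n _ => E.coeff_υreesD i n p

/-- Equivariance for points (t, x) that come from the universal pair over Spec A[t]: the projection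
`C` gives the point x and `E.exp` gives the moved point. -/
lemma reesAct_openEmb {W : Scheme.{u}} (y : W ⟶ Spec (.of A[X])) :
    E.reesAct (y.appTop ((Scheme.ΓSpecIso (.of A[X])).inv X))
      (y ≫ Spec.map (CommRingCat.ofHom C) ≫ E.openEmb) =
      y ≫ Spec.map (CommRingCat.ofHom E.exp) ≫ E.openEmb := by
  rw [openEmb_eq_specToProj]
  exact projAct_specToProj E.υR _ E E.υ_mem one_pos E.υR_exp_υ E.reesEval E.isUnit_reesEval_υ
    E.reesEval_υR y

/-- If D₊(g) misses D₊(υ), then gυ is nilpotent, and so is g because υ is a nonzerodivisor; hence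
D₊(g) is empty. -/
lemma basicOpen_υ_dense (U : (Proj E.reesGrading).Opens)
    (hU : U ⊓ Proj.basicOpen E.reesGrading E.υ = ⊥) : U = ⊥ := by
  rw [eq_bot_iff]
  intro x hx
  exfalso
  obtain ⟨_, ⟨_, ⟨f, rfl⟩, rfl⟩, hxf, hf⟩ :=
    (Proj.isBasis_basicOpen E.reesGrading).exists_subset_of_mem_open hx U.isOpen
  -- Basic open sets are indexed by arbitrary elements; one homogeneous component g of f does not
  -- vanish at x.
  obtain ⟨i, hxi⟩ : ∃ i, x ∈ Proj.basicOpen E.reesGrading (GradedRing.proj E.reesGrading i f) := by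
    have h : x ∈ Proj.basicOpen E.reesGrading f := hxf
    rw [Proj.basicOpen_eq_iSup_proj] at h
    exact TopologicalSpace.Opens.mem_iSup.1 h
  let g : E.rees := GradedRing.proj E.reesGrading i f
  have hg : g ∈ E.reesGrading i := by
    change GradedRing.proj E.reesGrading i f ∈ _
    rw [GradedRing.proj_apply]
    exact SetLike.coe_mem _
  -- The component g may have degree 0, but gυ has degree i + 1 > 0, so D₊(gυ) is the spectrum of
  -- the degree 0 part of the localization.
  have hgυ : g * E.υ ∈ E.reesGrading (i + 1) := SetLike.mul_mem_graded hg E.υ_mem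
  have hgU : Proj.basicOpen E.reesGrading g ≤ U := by
    refine le_trans ?_ (show Proj.basicOpen E.reesGrading f ≤ U from hf)
    rw [Proj.basicOpen_eq_iSup_proj E.reesGrading f]
    exact le_iSup (fun i => Proj.basicOpen E.reesGrading (GradedRing.proj E.reesGrading i f)) i
  have hempty : (Proj.awayι E.reesGrading (g * E.υ) hgυ (Nat.succ_pos i)).opensRange = ⊥ := by
    rw [Proj.opensRange_awayι, Proj.basicOpen_mul, eq_bot_iff, ← hU]
    exact inf_le_inf_right _ hgU
  have hsub : Subsingleton (HomogeneousLocalization.Away E.reesGrading (g * E.υ)) := by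
    rw [← PrimeSpectrum.isEmpty_iff_subsingleton]
    refine ⟨fun z => ?_⟩
    have h : Proj.awayι E.reesGrading (g * E.υ) hgυ (Nat.succ_pos i) z ∈
      (Proj.awayι E.reesGrading (g * E.υ) hgυ (Nat.succ_pos i)).opensRange := ⟨z, rfl⟩
    rw [hempty] at h
    exact h
  -- The degree 0 part contains 1, so its vanishing makes the whole localization zero, and gυ is
  -- nilpotent.
  have h10 : (1 : Localization.Away (g * E.υ)) = 0 := by
    have h := congrArg HomogeneousLocalization.val (Subsingleton.elim
      (1 : HomogeneousLocalization.Away E.reesGrading (g * E.υ)) 0)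
    rwa [HomogeneousLocalization.val_one, HomogeneousLocalization.val_zero] at h
  obtain ⟨n, hn⟩ : (0 : E.rees) ∈ Submonoid.powers (g * E.υ) := by
    exact (IsLocalization.subsingleton_iff (R := E.rees) (S := Localization.Away (g * E.υ))).1
      (subsingleton_of_zero_eq_one h10.symm)
  have hgn : g ^ n = 0 := by
    have hinj : Function.Injective (E.υ ^ n * ·) := by
      rw [← mul_left_iterate]
      exact E.υ_mul_injective.iterate n
    apply hinj
    change (g * E.υ) ^ n = 0 at hn
    change E.υ ^ n * g ^ n = E.υ ^ n * 0
    rw [mul_zero, ← mul_pow, mul_comm, hn]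
  apply hxi
  refine x.isPrime.mem_of_pow_mem n ?_
  change g ^ n ∈ _
  rw [hgn]
  exact zero_mem _

instance : IsDominant E.openEmb := by
  constructor
  refine dense_iff_inter_open.2 fun U hU hne => ?_
  by_contra h
  have h1 : (⟨U, hU⟩ : (Proj E.reesGrading).Opens) = ⊥ := by
    apply E.basicOpen_υ_dense
    rw [← opensRange_openEmb, eq_bot_iff]
    exact fun x hx => (h ⟨x, hx.1, hx.2⟩).elim
  obtain ⟨x, hx⟩ := hne
  have h2 : x ∈ (⟨U, hU⟩ : (Proj E.reesGrading).Opens) := hx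
  rw [h1] at h2
  exact h2

/-- In degree 0 the Rees algebra consists of the constants in F₀, that is, the invariants. -/
lemma invToRees_bijective : Function.Bijective E.invToRees := by
  constructor
  · intro a b h
    have h1 : monomial 0 (a : A) = monomial 0 (b : A) :=
      congrArg (fun p : E.reesGrading 0 => ((p : E.rees) : A[X])) h
    exact Subtype.ext (monomial_injective 0 h1)
  · intro p
    refine ⟨⟨(p : E.rees).1.coeff 0, (p : E.rees).2 0⟩, Subtype.ext (Subtype.ext ?_)⟩
    refine Eq.trans ?_ (eq_of_mem_stdGrading (B := B) p.2).symm
    change monomial 0 ((p : E.rees).1.coeff 0) = C ((p : E.rees).1.coeff 0) * X ^ 0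
    rw [pow_zero, mul_one]
    rfl

instance : IsSeparated E.reesToInv := isSeparated_projToSpec _ E.invToRees_bijective

lemma isProper_reesToInv (h : E.invIncl.FiniteType) : IsProper E.reesToInv :=
  isProper_projToSpec E.invToRees E.invToRees_bijective h

end LFIHD

end GaRees

/-! ### The étale topology on schemes and pullbacks of presheaves -/

namespace GaRees

open Polynomial AlgebraicGeometry CategoryTheory Limits Opposite

/-- Étale morphisms are flat and locally of finite presentation, so the étale topology is coarser
than the subcanonical fppf topology. -/
instance : Scheme.etaleTopology.{u}.Subcanonical :=
  .of_le (K := Scheme.fppfTopology) (Precoverage.toGrothendieck_mono (Scheme.precoverage_mono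
    fun _ _ _ _ => ⟨inferInstance, inferInstance⟩))

lemma mem_etaleTopology_of_forall_exists {T : Scheme.{u}} (R : Sieve T)
    (h : ∀ t : T, ∃ (W : Scheme.{u}) (g : W ⟶ T), Etale g ∧ R g ∧ t ∈ Set.range g) :
    R ∈ Scheme.etaleTopology T := by
  choose W g hg hR ht using h
  refine Scheme.mem_grothendieckTopology_iff.2 ⟨Scheme.Cover.mkOfCovers T W g (fun t => ⟨t, ht t⟩) hg, ?_⟩
  rintro _ _ ⟨t⟩
  exact hR t

/-- Pullbacks of presheaves are computed on sections, and by Yoneda the sections over T are the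
morphisms from T. -/
lemma isPullback_of_forall_existsUnique {P X Y Z : PSh.{u}} {p : P ⟶ X} {q : P ⟶ Y} {f : X ⟶ Z}
    {g : Y ⟶ Z} (w : p ≫ f = q ≫ g)
    (h : ∀ (T : Scheme.{u}) (x : yon.obj T ⟶ X) (y : yon.obj T ⟶ Y), x ≫ f = y ≫ g →
      ∃! z : yon.obj T ⟶ P, z ≫ p = x ∧ z ≫ q = y) : IsPullback p q f g := by
  refine IsPullback.of_forall_isPullback_app fun T => ?_
  have h1 : ∀ x : P.obj T, uliftYonedaEquiv.{u + 1}.symm x ≫ p =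
      uliftYonedaEquiv.{u + 1}.symm (p.app T x) := fun x => uliftYonedaEquiv_symm_comp x p
  have h2 : ∀ x : P.obj T, uliftYonedaEquiv.{u + 1}.symm x ≫ q =
      uliftYonedaEquiv.{u + 1}.symm (q.app T x) := fun x => uliftYonedaEquiv_symm_comp x q
  refine (Types.isPullback_iff _ _ _ _).2 ⟨?_, ?_, ?_⟩
  · exact congrArg (fun k => NatTrans.app k T) w
  · rintro x y ⟨hp, hq⟩
    have hw : uliftYonedaEquiv.{u + 1}.symm (p.app T x) ≫ f =
        uliftYonedaEquiv.{u + 1}.symm (q.app T x) ≫ g := by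
      rw [← h1, ← h2, Category.assoc, Category.assoc, w]
    apply uliftYonedaEquiv.{u + 1}.symm.injective
    refine (h T.unop _ _ hw).unique ⟨h1 x, h2 x⟩ ⟨?_, ?_⟩
    · exact (h1 y).trans (congrArg _ hp.symm)
    · exact (h2 y).trans (congrArg _ hq.symm)
  · intro x y hxy
    obtain ⟨z, ⟨hz1, hz2⟩, -⟩ := h T.unop (uliftYonedaEquiv.{u + 1}.symm x)
      (uliftYonedaEquiv.{u + 1}.symm y) (by
        refine (uliftYonedaEquiv_symm_comp x f).trans ((congrArg _ hxy).trans ?_)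
        exact (uliftYonedaEquiv_symm_comp y g).symm)
    obtain ⟨z, rfl⟩ := uliftYonedaEquiv.{u + 1}.symm.surjective z
    exact ⟨z, uliftYonedaEquiv.{u + 1}.symm.injective ((h1 z).symm.trans hz1),
      uliftYonedaEquiv.{u + 1}.symm.injective ((h2 z).symm.trans hz2)⟩

/-! ### Étale descent for points of X over S -/

section Relative

variable {X S : PSh.{u}} {f : X ⟶ S} {T : Scheme.{u}}

/-- Two T-points of X over the same T-point of S are two sections of the scheme X ×_S T over T;
schemes are étale sheaves, so sections that agree on a cover are equal. -/
lemma AffineOver.hom_ext (hf : AffineOver f) {R : Sieve T} (hR : R ∈ Scheme.etaleTopology T)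
    {x x' : yon.obj T ⟶ X} (hb : x ≫ f = x' ≫ f)
    (h : ∀ (W : Scheme.{u}) (g : W ⟶ T), R g → yon.map g ≫ x = yon.map g ≫ x') : x = x' := by
  let s := hf.rep.lift (g := x ≫ f) x (𝟙 T) (by simp)
  let s' := hf.rep.lift (g := x ≫ f) x' (𝟙 T) (by simp [hb])
  have hs : s = s' := by
    have hY : Presieve.IsSheaf Scheme.etaleTopology (yoneda.obj (hf.rep.pullback (x ≫ f))) :=
      GrothendieckTopology.Subcanonical.isSheaf_of_isRepresentable _
    refine (hY R hR).isSeparatedFor.ext fun W g hg => ?_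
    refine hf.rep.hom_ext ?_ ?_
    · change yon.map (g ≫ s) ≫ _ = yon.map (g ≫ s') ≫ _
      rw [Functor.map_comp, Functor.map_comp, Category.assoc, Category.assoc]
      simp only [s, s', hf.rep.lift_fst]
      exact h W g hg
    · change (g ≫ s) ≫ _ = (g ≫ s') ≫ _
      simp [s, s']
  have h1 : yon.map s ≫ hf.rep.fst (x ≫ f) = x := hf.rep.lift_fst _ _ _
  rw [← h1, hs]
  exact hf.rep.lift_fst _ _ _

/-- The local points are local sections of the scheme X ×_S T, and these glue in the sheaf it
represents. -/
lemma AffineOver.exists_glue (hf : AffineOver f) {R : Sieve T} (hR : R ∈ Scheme.etaleTopology T)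
    (b : yon.obj T ⟶ S) (ξ : ∀ (W : Scheme.{u}) (g : W ⟶ T), R g → (yon.obj W ⟶ X))
    (hb : ∀ W g hg, ξ W g hg ≫ f = yon.map g ≫ b)
    (hξ : ∀ (W W' : Scheme.{u}) (k : W' ⟶ W) (g : W ⟶ T) (hg : R g) (hg' : R (k ≫ g)),
      yon.map k ≫ ξ W g hg = ξ W' (k ≫ g) hg') :
    ∃ x : yon.obj T ⟶ X, x ≫ f = b ∧ ∀ W g hg, yon.map g ≫ x = ξ W g hg := by
  have hY : Presieve.IsSheaf Scheme.etaleTopology (yoneda.obj (hf.rep.pullback b)) :=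
    GrothendieckTopology.Subcanonical.isSheaf_of_isRepresentable _
  have hT : Presieve.IsSheaf Scheme.etaleTopology (yoneda.obj T) :=
    GrothendieckTopology.Subcanonical.isSheaf_of_isRepresentable _
  let σ : Presieve.FamilyOfElements (yoneda.obj (hf.rep.pullback b)) R.arrows :=
    fun W g hg => hf.rep.lift (ξ W g hg) g (hb W g hg)
  have hσ : σ.Compatible := by
    rw [Presieve.compatible_iff_sieveCompatible]
    intro W W' g k hg
    refine hf.rep.hom_ext ?_ ?_
    · change yon.map (σ _ _) ≫ _ = yon.map (k ≫ σ _ _) ≫ _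
      rw [Functor.map_comp, Category.assoc]
      simp only [σ, hf.rep.lift_fst]
      exact (hξ _ _ _ _ _ _).symm
    · change σ _ _ ≫ _ = (k ≫ σ _ _) ≫ _
      simp [σ]
  obtain ⟨s, hs, -⟩ := hY R hR σ hσ
  have hs' : ∀ (W : Scheme.{u}) (g : W ⟶ T) (hg : R g), g ≫ s = σ g hg := fun W g hg => hs g hg
  -- The glued morphism T ⟶ X ×_S T is again a section: this too is checked on the cover, now in the
  -- sheaf represented by T.
  have hsnd : s ≫ hf.rep.snd b = 𝟙 T := by
    refine (hT R hR).isSeparatedFor.ext fun W g hg => ?_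
    change g ≫ s ≫ hf.rep.snd b = g ≫ 𝟙 T
    rw [← Category.assoc, hs' W g hg, Category.comp_id]
    exact hf.rep.lift_snd _ _ _
  refine ⟨yon.map s ≫ hf.rep.fst b, ?_, fun W g hg => ?_⟩
  · rw [Category.assoc, hf.rep.w, ← Functor.map_comp_assoc, hsnd]
    exact (congrArg (· ≫ b) (yon.map_id T)).trans (Category.id_comp b)
  · rw [← Functor.map_comp_assoc, hs' W g hg]
    exact hf.rep.lift_fst _ _ _

end Relative

/-! ### Existence and refinement of charts -/

section Charts

variable {S : PSh.{u}} {T : Scheme.{u}}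

lemma relative_etale_comp {X Y Z : PSh.{u}} {p : X ⟶ Y} {q : Y ⟶ Z}
    (hp : MorphismProperty.relative yon @Etale p) (hq : MorphismProperty.relative yon @Etale q) :
    MorphismProperty.relative yon @Etale (p ≫ q) := by
  let _ : MorphismProperty.IsStableUnderComposition (@Etale.{u}) :=
    (inferInstance : MorphismProperty.IsMultiplicative (@Etale.{u})).toIsStableUnderComposition
  exact (MorphismProperty.relative_isStableUnderComposition (F := yon) (@Etale.{u})).comp_mem _ _ hp hq

lemma relative_etale_map {T T' : Scheme.{u}} (g : T ⟶ T') [Etale g] :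
    MorphismProperty.relative yon @Etale (yon.map g) :=
  MorphismProperty.relative_map ‹_›

/-- An étale atlas of S pulls back to an étale surjection onto T. An affine open of the atlas around
the image of a preimage of t is the chart V. -/
lemma IsAlgebraicSpace.exists_chart (hS : IsAlgebraicSpace S) (b : yon.obj T ⟶ S) (t : T) :
    ∃ (V : Chart S) (W : Scheme.{u}) (g : W ⟶ T) (w : W ⟶ Spec V.ring), Etale g ∧
      yon.map g ≫ b = yon.map w ≫ V.pt ∧ t ∈ Set.range g := by
  obtain ⟨U, p, hp, hp'⟩ := hS.exists_cover
  have h1 : Etale (hp.rep.snd b) := hp.property_snd b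
  have h2 : Surjective (hp.rep.snd b) := hp'.property _ _ _ (hp.rep.isPullback b)
  obtain ⟨t', rfl⟩ := (hp.rep.snd b).surjective t
  obtain ⟨R, i, hi, ⟨r, hr⟩, -⟩ := Scheme.exists_affine_mem_range_and_range_subset
    (x := hp.rep.fst' b t') (U := ⊤) trivial
  let V : Chart S :=
    { ring := R
      pt := yon.map i ≫ p
      etale := relative_etale_comp (relative_etale_map i) hp }
  refine ⟨V, pullback (hp.rep.fst' b) i, pullback.fst _ _ ≫ hp.rep.snd b, pullback.snd _ _,
    inferInstance, ?_, ?_⟩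
  · have h3 : yon.map (hp.rep.fst' b) ≫ p = yon.map (hp.rep.snd b) ≫ b :=
      (hp.rep.isPullback' b).w
    change _ = _ ≫ yon.map i ≫ p
    rw [Functor.map_comp, Category.assoc, ← h3, ← Functor.map_comp_assoc, pullback.condition,
      Functor.map_comp_assoc]
  · obtain ⟨q, hq, -⟩ := Scheme.Pullback.exists_preimage_pullback t' r hr.symm
    exact ⟨q, by rw [Scheme.Hom.comp_apply, hq]⟩

/-- The pair (w, w') is a morphism from W to the scheme V ×_S V'. An affine open of this scheme
around the image of p is étale over V', hence a chart that refines both, and W₀ is its preimage in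
W. -/
lemma Chart.exists_refinement {W : Scheme.{u}} {V V' : Chart S} (w : W ⟶ Spec V.ring)
    (w' : W ⟶ Spec V'.ring) (h : yon.map w ≫ V.pt = yon.map w' ≫ V'.pt) (p : W) :
    ∃ (V'' : Chart S) (c : V''.Hom V) (c' : V''.Hom V') (W₀ : Scheme.{u}) (k : W₀ ⟶ W)
      (w'' : W₀ ⟶ Spec V''.ring), Etale k ∧ k ≫ w = w'' ≫ Spec.map c.φ ∧
      k ≫ w' = w'' ≫ Spec.map c'.φ ∧ p ∈ Set.range k := by
  let m := V.etale.rep.lift' w w' h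
  have h1 : Etale (V.etale.rep.snd V'.pt) := V.etale.property_snd V'.pt
  obtain ⟨R, i, hi, ⟨r, hr⟩, -⟩ := Scheme.exists_affine_mem_range_and_range_subset
    (x := m p) (U := ⊤) trivial
  let V'' : Chart S :=
    { ring := R
      pt := yon.map (i ≫ V.etale.rep.snd V'.pt) ≫ V'.pt
      etale := relative_etale_comp (relative_etale_map _) V'.etale }
  refine ⟨V'', ⟨Spec.preimage (i ≫ V.etale.rep.fst' V'.pt), ?_⟩,
    ⟨Spec.preimage (i ≫ V.etale.rep.snd V'.pt), ?_⟩, pullback m i, pullback.fst _ _,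
    pullback.snd _ _, inferInstance, ?_, ?_, ?_⟩
  · rw [Spec.map_preimage, Functor.map_comp, Category.assoc, (V.etale.rep.isPullback' V'.pt).w,
      ← Functor.map_comp_assoc]
  · rw [Spec.map_preimage]
  · rw [Spec.map_preimage, ← pullback.condition_assoc, V.etale.rep.lift'_fst]
  · rw [Spec.map_preimage, ← pullback.condition_assoc, V.etale.rep.lift'_snd]
  · obtain ⟨q, hq, -⟩ := Scheme.Pullback.exists_preimage_pullback p r hr.symm
    exact ⟨q, hq⟩

/-- The sieve of the morphisms to `T` along which `b` factors through a chart. -/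
def chartSieve (b : yon.obj T ⟶ S) : Sieve T where
  arrows W g := ∃ (V : Chart S) (w : W ⟶ Spec V.ring), yon.map g ≫ b = yon.map w ≫ V.pt
  downward_closed := by
    rintro W W' g ⟨V, w, h⟩ k
    exact ⟨V, k ≫ w, by rw [Functor.map_comp, Category.assoc, h, Functor.map_comp_assoc]⟩

lemma IsAlgebraicSpace.chartSieve_mem (hS : IsAlgebraicSpace S) (b : yon.obj T ⟶ S) :
    chartSieve b ∈ Scheme.etaleTopology T := by
  refine mem_etaleTopology_of_forall_exists _ fun t => ?_
  obtain ⟨V, W, g, w, hg, h, ht⟩ := hS.exists_chart b t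
  exact ⟨W, g, hg, ⟨V, w, h⟩, ht⟩

end Charts

end GaRees

namespace GaRees

open Polynomial AlgebraicGeometry CategoryTheory Limits Opposite

/-! ### Components of the points of a glued functor -/

namespace ChartFamily

variable {S X : PSh.{u}} {G : ChartFamily S} {T : Scheme.{u}}

lemma pointEquiv_comp_lift (Φ : ∀ T : Scheme.{u}, (yon.obj T ⟶ X) → G.Point T)
    (hΦ : ∀ (T T' : Scheme.{u}) (k : T' ⟶ T) (x : yon.obj T ⟶ X),
      (Φ T x).res k = Φ T' (yon.map k ≫ x)) (x : yon.obj T ⟶ X) :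
    pointEquiv (x ≫ lift Φ hΦ) = Φ T x :=
  congrArg (Φ T) (uliftYonedaEquiv.{u + 1}.symm_apply_apply x)

lemma comp_glueToBase (z : yon.obj T ⟶ G.glue) :
    z ≫ G.glueToBase = (pointEquiv z).base :=
  uliftYonedaEquiv.{u + 1}.injective rfl

lemma pointEquiv_comp_base {T' : Scheme.{u}} (k : T' ⟶ T) (z : yon.obj T ⟶ G.glue) :
    (pointEquiv (yon.map k ≫ z)).base = yon.map k ≫ (pointEquiv z).base := by
  rw [pointEquiv_comp]
  rfl

lemma Point.map_eq {z z' : G.Point T} (e : z = z') {V : Chart S} {W : Scheme.{u}}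
    {g : W ⟶ T} {w : W ⟶ Spec V.ring} (h h') : z.map V W g w h = z'.map V W g w h' := by
  subst e
  rfl

lemma pointEquiv_comp_map {T' : Scheme.{u}} (k : T' ⟶ T) (z : yon.obj T ⟶ G.glue) {V : Chart S}
    {W : Scheme.{u}} (g : W ⟶ T') (w : W ⟶ Spec V.ring) (h h') :
    (pointEquiv (yon.map k ≫ z)).map V W g w h = (pointEquiv z).map V W (g ≫ k) w h' :=
  Point.map_eq (pointEquiv_comp k z) h (by rw [← pointEquiv_comp, h])

end ChartFamily

open ChartFamily

/-! ### Lifting points of a glued functor to X -/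

section ToGlue

variable {X S : PSh.{u}} {f : X ⟶ S} (hf : AffineOver f) (G : ChartFamily S)
  (j : ∀ V, XV hf V ⟶ G.obj V) (hj : ∀ V, j V ≫ G.toBase V = XV.snd hf V)
  (hc : ∀ {V' V : Chart S} (c : V'.Hom V), j V' ≫ G.map c = XV.map hf c ≫ j V)
  {T : Scheme.{u}}

lemma pointEquiv_comp_toGlue_base (x : yon.obj T ⟶ X) :
    (pointEquiv (x ≫ toGlue hf G j hj hc)).base = x ≫ f := by
  rw [toGlue, pointEquiv_comp_lift]

lemma pointEquiv_comp_toGlue_map (x : yon.obj T ⟶ X) (V : Chart S) (W : Scheme.{u}) (g : W ⟶ T)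
    (w : W ⟶ Spec V.ring) (h) (h' : (yon.map g ≫ x) ≫ f = yon.map w ≫ V.pt) :
    (pointEquiv (x ≫ toGlue hf G j hj hc)).map V W g w h =
      XV.lift hf V (yon.map g ≫ x) w h' ≫ j V :=
  Point.map_eq (pointEquiv_comp_lift _ _ x) _ (by rw [← h', Category.assoc])

lemma toGlue_glueToBase : toGlue hf G j hj hc ≫ G.glueToBase = f :=
  hom_ext_uliftYoneda.{u + 1} fun T x => by
    rw [← Category.assoc]
    exact (comp_glueToBase _).trans (pointEquiv_comp_toGlue_base hf G j hj hc x)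

/-- The components of the point `z` of `G.glue` factor set-theoretically through `j`. -/
def FactorsThrough (z : yon.obj T ⟶ G.glue) : Prop :=
  ∀ (V : Chart S) (W : Scheme.{u}) (g : W ⟶ T) (w : W ⟶ Spec V.ring)
    (h : yon.map g ≫ (pointEquiv z).base = yon.map w ≫ V.pt) (p : W),
    (pointEquiv z).map V W g w h p ∈ Set.range (j V)

lemma factorsThrough_comp_toGlue (x : yon.obj T ⟶ X) :
    FactorsThrough hf G j (x ≫ toGlue hf G j hj hc) := by
  intro V W g w h p
  have h' : (yon.map g ≫ x) ≫ f = yon.map w ≫ V.pt := by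
    rw [← h, pointEquiv_comp_toGlue_base, Category.assoc]
  rw [pointEquiv_comp_toGlue_map hf G j hj hc x V W g w h h', Scheme.Hom.comp_apply]
  exact ⟨_, rfl⟩

/-- Equal images in the glued functor have equal components over every chart; there j V is a
monomorphism, so the points of X agree on the cover by charts and descent applies. -/
lemma comp_toGlue_injective (hS : IsAlgebraicSpace S) [∀ V, Mono (j V)] {x x' : yon.obj T ⟶ X}
    (h : x ≫ toGlue hf G j hj hc = x' ≫ toGlue hf G j hj hc) : x = x' := by
  have hb : x ≫ f = x' ≫ f := by
    rw [← pointEquiv_comp_toGlue_base hf G j hj hc, h, pointEquiv_comp_toGlue_base]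
  refine hf.hom_ext (hS.chartSieve_mem (x ≫ f)) hb fun W g ⟨V, w, hw⟩ => ?_
  have h1 : (yon.map g ≫ x) ≫ f = yon.map w ≫ V.pt := by rw [← hw, Category.assoc]
  have h2 : (yon.map g ≫ x') ≫ f = yon.map w ≫ V.pt := by rw [← hw, hb, Category.assoc]
  have h3 : XV.lift hf V _ w h1 = XV.lift hf V _ w h2 := by
    rw [← cancel_mono (j V),
      ← pointEquiv_comp_toGlue_map hf G j hj hc x V W g w (by rw [pointEquiv_comp_toGlue_base, hw]),
      ← pointEquiv_comp_toGlue_map hf G j hj hc x' V W g w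
        (by rw [pointEquiv_comp_toGlue_base, ← hb, hw])]
    exact Point.map_eq (congrArg pointEquiv h) _ _
  rw [← XV.lift_fst hf V _ w h1, h3, XV.lift_fst]

variable {G j}

/-- The component of the lift to `X` of a point of `G.glue`. -/
noncomputable def FactorsThrough.comp [∀ V, IsOpenImmersion (j V)] {z : yon.obj T ⟶ G.glue}
    (hz : FactorsThrough hf G j z) (V : Chart S) (W : Scheme.{u}) (g : W ⟶ T)
    (w : W ⟶ Spec V.ring) (h : yon.map g ≫ (pointEquiv z).base = yon.map w ≫ V.pt) :
    W ⟶ XV hf V :=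
  IsOpenImmersion.lift (j V) ((pointEquiv z).map V W g w h)
    (by rintro _ ⟨p, rfl⟩; exact hz V W g w h p)

variable {hf} [∀ V, IsOpenImmersion (j V)] {z : yon.obj T ⟶ G.glue}

lemma FactorsThrough.comp_fac (hz : FactorsThrough hf G j z) (V : Chart S) (W : Scheme.{u})
    (g : W ⟶ T) (w : W ⟶ Spec V.ring) (h) :
    hz.comp hf V W g w h ≫ j V = (pointEquiv z).map V W g w h :=
  IsOpenImmersion.lift_fac _ _ _

lemma FactorsThrough.comp_snd
    (hj : ∀ V, j V ≫ G.toBase V = XV.snd hf V)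
    (hz : FactorsThrough hf G j z) (V : Chart S) (W : Scheme.{u})
    (g : W ⟶ T) (w : W ⟶ Spec V.ring) (h) : hz.comp hf V W g w h ≫ XV.snd hf V = w := by
  rw [← hj, ← Category.assoc, hz.comp_fac, Point.map_toBase]

lemma FactorsThrough.comp_fst_comp
    (hj : ∀ V, j V ≫ G.toBase V = XV.snd hf V)
    (hz : FactorsThrough hf G j z) (V : Chart S) (W : Scheme.{u})
    (g : W ⟶ T) (w : W ⟶ Spec V.ring) (h) :
    (yon.map (hz.comp hf V W g w h) ≫ XV.fst hf V) ≫ f = yon.map g ≫ (pointEquiv z).base := by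
  rw [Category.assoc, (XV.isPullback hf V).w, ← Functor.map_comp_assoc, hz.comp_snd hj, h]

lemma FactorsThrough.comp_comp (hz : FactorsThrough hf G j z) (V : Chart S) (W W' : Scheme.{u})
    (k : W' ⟶ W) (g : W ⟶ T) (w : W ⟶ Spec V.ring) (h h') :
    hz.comp hf V W' (k ≫ g) (k ≫ w) h' = k ≫ hz.comp hf V W g w h := by
  rw [← cancel_mono (j V), Category.assoc, hz.comp_fac, hz.comp_fac,
    (pointEquiv z).map_comp V W W' k g w h h']

lemma FactorsThrough.comp_chart
    (hc : ∀ {V' V : Chart S} (c : V'.Hom V), j V' ≫ G.map c = XV.map hf c ≫ j V)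
    (hz : FactorsThrough hf G j z) (V V' : Chart S) (c : V'.Hom V)
    (W : Scheme.{u}) (g : W ⟶ T) (w : W ⟶ Spec V'.ring) (h' h) :
    hz.comp hf V W g (w ≫ Spec.map c.φ) h = hz.comp hf V' W g w h' ≫ XV.map hf c := by
  rw [← cancel_mono (j V), Category.assoc, ← hc, hz.comp_fac,
    (pointEquiv z).map_chart V V' c W g w h' h, ← hz.comp_fac, Category.assoc]

lemma FactorsThrough.comp_congr (hz : FactorsThrough hf G j z) (V : Chart S) {W : Scheme.{u}}
    {g g' : W ⟶ T} (hg : g = g') {w w' : W ⟶ Spec V.ring} (hw : w = w') (h h') :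
    hz.comp hf V W g w h = hz.comp hf V W g' w' h' := by
  subst hg hw
  rfl

/-- The local lift to X does not depend on the chart: on a common refinement V'' both lifts are the
one computed with V'', and agreement on an étale cover is enough. -/
lemma FactorsThrough.comp_fst_eq
    (hj : ∀ V, j V ≫ G.toBase V = XV.snd hf V)
    (hc : ∀ {V' V : Chart S} (c : V'.Hom V), j V' ≫ G.map c = XV.map hf c ≫ j V)
    (hz : FactorsThrough hf G j z) (V V' : Chart S) (W : Scheme.{u})
    (g : W ⟶ T) (w : W ⟶ Spec V.ring) (w' : W ⟶ Spec V'.ring) (h h') :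
    yon.map (hz.comp hf V W g w h) ≫ XV.fst hf V =
      yon.map (hz.comp hf V' W g w' h') ≫ XV.fst hf V' := by
  -- The sieve of all morphisms along which the two lifts agree; it is covering because it contains
  -- the refinements.
  let R : Sieve W :=
    { arrows := fun W₀ k => yon.map k ≫ yon.map (hz.comp hf V W g w h) ≫ XV.fst hf V =
        yon.map k ≫ yon.map (hz.comp hf V' W g w' h') ≫ XV.fst hf V'
      downward_closed := fun {_ _ k} hk l => by
        rw [Functor.map_comp, Category.assoc, hk, Category.assoc] }
  have hR : R ∈ Scheme.etaleTopology W := by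
    refine mem_etaleTopology_of_forall_exists _ fun p => ?_
    obtain ⟨V'', c, c', W₀, k, w'', hk, e, e', hp⟩ :=
      Chart.exists_refinement w w' (h.symm.trans h') p
    refine ⟨W₀, k, hk, ?_, hp⟩
    have h0 : yon.map (k ≫ g) ≫ (pointEquiv z).base = yon.map w'' ≫ V''.pt := by
      rw [Functor.map_comp, Category.assoc, h, ← Functor.map_comp_assoc, e, ← c.w,
        Functor.map_comp_assoc]
    have h1 : yon.map (k ≫ g) ≫ (pointEquiv z).base = yon.map (k ≫ w) ≫ V.pt := by
      rw [Functor.map_comp, Category.assoc, h, Functor.map_comp_assoc]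
    have h1' : yon.map (k ≫ g) ≫ (pointEquiv z).base = yon.map (k ≫ w') ≫ V'.pt := by
      rw [Functor.map_comp, Category.assoc, h', Functor.map_comp_assoc]
    change yon.map k ≫ yon.map _ ≫ _ = yon.map k ≫ yon.map _ ≫ _
    rw [← Functor.map_comp_assoc, ← Functor.map_comp_assoc, ← hz.comp_comp V W W₀ k g w h h1,
      ← hz.comp_comp V' W W₀ k g w' h' h1',
      hz.comp_congr V rfl e h1 (e ▸ h1), hz.comp_congr V' rfl e' h1' (e' ▸ h1'),
      hz.comp_chart hc V V'' c W₀ _ w'' h0, hz.comp_chart hc V' V'' c' W₀ _ w'' h0,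
      Functor.map_comp, Functor.map_comp, Category.assoc, Category.assoc, XV.map_fst, XV.map_fst]
  refine hf.hom_ext hR ?_ fun _ _ hk => hk
  rw [hz.comp_fst_comp hj, hz.comp_fst_comp hj]

/-- The lifts over the charts are compatible by independence of the chart, hence glue to a point of
X. -/
lemma FactorsThrough.exists_lift
    (hj : ∀ V, j V ≫ G.toBase V = XV.snd hf V)
    (hc : ∀ {V' V : Chart S} (c : V'.Hom V), j V' ≫ G.map c = XV.map hf c ≫ j V)
    (hz : FactorsThrough hf G j z) (hS : IsAlgebraicSpace S) :
    ∃ x : yon.obj T ⟶ X, x ≫ toGlue hf G j hj hc = z := by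
  let b := (pointEquiv z).base
  -- A chart is chosen for each member of the sieve; `hξ` then removes the choice.
  let ξ : ∀ (W : Scheme.{u}) (g : W ⟶ T), chartSieve b g → (yon.obj W ⟶ X) := fun W g hg =>
    yon.map (hz.comp hf hg.choose W g hg.choose_spec.choose hg.choose_spec.choose_spec) ≫
      XV.fst hf hg.choose
  have hξ : ∀ (W : Scheme.{u}) (g : W ⟶ T) (hg : chartSieve b g) (V : Chart S)
      (w : W ⟶ Spec V.ring) (h : yon.map g ≫ b = yon.map w ≫ V.pt),
      ξ W g hg = yon.map (hz.comp hf V W g w h) ≫ XV.fst hf V := fun W g hg V w h =>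
    hz.comp_fst_eq hj hc _ V W g _ w hg.choose_spec.choose_spec h
  obtain ⟨x, hx, hx'⟩ := hf.exists_glue (hS.chartSieve_mem b) b ξ
    (fun W g hg => hz.comp_fst_comp hj _ W g _ _)
    (fun W W' k g hg hg' => by
      obtain ⟨V, w, h⟩ := id hg
      have h' : yon.map (k ≫ g) ≫ b = yon.map (k ≫ w) ≫ V.pt := by
        rw [Functor.map_comp, Category.assoc, h, Functor.map_comp_assoc]
      rw [hξ W g hg V w h, hξ W' (k ≫ g) hg' V (k ≫ w) h', hz.comp_comp V W W' k g w h h',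
        Functor.map_comp, Category.assoc])
  refine ⟨x, pointEquiv.injective (Point.ext ?_ fun V W g w h h' => ?_)⟩
  · rw [pointEquiv_comp_toGlue_base, hx]
  · have h1 : (yon.map g ≫ x) ≫ f = yon.map w ≫ V.pt := by rw [Category.assoc, hx, h']
    rw [pointEquiv_comp_toGlue_map hf G j hj hc x V W g w h h1, ← hz.comp_fac V W g w h']
    congr 1
    refine XV.hom_ext hf ?_ ?_
    · have hg : chartSieve b g := ⟨V, w, h'⟩
      rw [XV.lift_fst, hx' W g hg, hξ W g hg V w h']
    · rw [XV.lift_snd, hz.comp_snd hj]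

end ToGlue

/-! ### The open locus where a point lifts, and representability by open immersions -/

section Locus

variable {X S : PSh.{u}} {f : X ⟶ S} {hf : AffineOver f} {G : ChartFamily S}
  {j : ∀ V, XV hf V ⟶ G.obj V} {T : Scheme.{u}}

/-- The hypothesis `hr` says that the image of j over V'' is the preimage of the image of j over V,
so the condition is insensitive to passing to a finer chart. -/
lemma mem_range_iff_of_chart
    (hr : ∀ {V' V : Chart S} (c : V'.Hom V) (p : G.obj V'),
      G.map c p ∈ Set.range (j V) ↔ p ∈ Set.range (j V'))
    (z : yon.obj T ⟶ G.glue) {V V'' : Chart S} (c : V''.Hom V) {W W₀ : Scheme.{u}} (g : W ⟶ T)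
    (w : W ⟶ Spec V.ring) (h) (k : W₀ ⟶ W) (w'' : W₀ ⟶ Spec V''.ring)
    (e : k ≫ w = w'' ≫ Spec.map c.φ) (h'') (p : W₀) :
    (pointEquiv z).map V W g w h (k p) ∈ Set.range (j V) ↔
      (pointEquiv z).map V'' W₀ (k ≫ g) w'' h'' p ∈ Set.range (j V'') := by
  have h1 : yon.map (k ≫ g) ≫ (pointEquiv z).base = yon.map (w'' ≫ Spec.map c.φ) ≫ V.pt := by
    rw [Functor.map_comp, Category.assoc, h, ← e, Functor.map_comp_assoc]
  have h2 : (pointEquiv z).map V W₀ (k ≫ g) (w'' ≫ Spec.map c.φ) h1 =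
      k ≫ (pointEquiv z).map V W g w h := by
    revert h1
    rw [← e]
    exact fun h1 => (pointEquiv z).map_comp V W W₀ k g w h h1
  rw [(pointEquiv z).map_chart V V'' c W₀ (k ≫ g) w'' h'' h1] at h2
  rw [← Scheme.Hom.comp_apply, ← h2, Scheme.Hom.comp_apply, hr]

/-- Whether a component lands in the image of j depends only on the underlying point of T: over W
×_T W' both components can be compared on a common refinement of the two charts. -/
lemma mem_range_iff_of_eq
    (hr : ∀ {V' V : Chart S} (c : V'.Hom V) (p : G.obj V'),
      G.map c p ∈ Set.range (j V) ↔ p ∈ Set.range (j V'))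
    (z : yon.obj T ⟶ G.glue) {V V' : Chart S} {W W' : Scheme.{u}} (g : W ⟶ T) (g' : W' ⟶ T)
    (w : W ⟶ Spec V.ring) (w' : W' ⟶ Spec V'.ring) (h h') (p : W) (p' : W') (e : g p = g' p') :
    (pointEquiv z).map V W g w h p ∈ Set.range (j V) ↔
      (pointEquiv z).map V' W' g' w' h' p' ∈ Set.range (j V') := by
  -- Points p and p' with the same image in T come from a point of W ×_T W'.
  obtain ⟨q, rfl, rfl⟩ := Scheme.Pullback.exists_preimage_pullback p p' e
  have hw : yon.map (pullback.fst g g' ≫ w) ≫ V.pt =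
      yon.map (pullback.snd g g' ≫ w') ≫ V'.pt := by
    rw [Functor.map_comp_assoc, ← h, Functor.map_comp_assoc, ← h', ← Functor.map_comp_assoc,
      ← Functor.map_comp_assoc, pullback.condition]
  obtain ⟨V'', c, c', W₀, k, w'', hk, e₁, e₂, ⟨q, rfl⟩⟩ := Chart.exists_refinement _ _ hw q
  have h1 : yon.map ((k ≫ pullback.fst g g') ≫ g) ≫ (pointEquiv z).base =
      yon.map w'' ≫ V''.pt := by
    rw [Functor.map_comp_assoc, h, ← Functor.map_comp_assoc, Category.assoc, e₁,
      Functor.map_comp_assoc, c.w]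
  have h2 : yon.map ((k ≫ pullback.snd g g') ≫ g') ≫ (pointEquiv z).base =
      yon.map w'' ≫ V''.pt := by
    rw [Functor.map_comp_assoc, h', ← Functor.map_comp_assoc, Category.assoc, e₂,
      Functor.map_comp_assoc, c'.w]
  have a := mem_range_iff_of_chart hr z c g w h (k ≫ pullback.fst g g') w''
    (by rw [Category.assoc, e₁]) h1 q
  have b := mem_range_iff_of_chart hr z c' g' w' h' (k ≫ pullback.snd g g') w''
    (by rw [Category.assoc, e₂]) h2 q
  rw [Scheme.Hom.comp_apply] at a b
  rw [a, b, (pointEquiv z).map_congr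
    (by rw [Category.assoc, pullback.condition, Category.assoc]) h1 h2]

variable (hf j) in
/-- The open subset of `T` over which the point `z` of `G.glue` factors through `j`. -/
def factorsLocus [∀ V, IsOpenImmersion (j V)] (z : yon.obj T ⟶ G.glue) : T.Opens where
  carrier := {t | ∃ (V : Chart S) (W : Scheme.{u}) (g : W ⟶ T) (w : W ⟶ Spec V.ring)
    (h : yon.map g ≫ (pointEquiv z).base = yon.map w ≫ V.pt) (p : W), Etale g ∧ g p = t ∧
    (pointEquiv z).map V W g w h p ∈ Set.range (j V)}
  is_open' := by
    rw [isOpen_iff_forall_mem_open]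
    rintro _ ⟨V, W, g, w, h, p, hg, rfl, hp⟩
    -- Étale morphisms are open, so the image in T of the preimage of the open set j(X ×_S V) is an
    -- open neighbourhood inside the locus.
    refine ⟨g '' ((pointEquiv z).map V W g w h ⁻¹ᵁ (j V).opensRange : W.Opens), ?_,
      g.isOpenMap _ (TopologicalSpace.Opens.isOpen _), ⟨p, hp, rfl⟩⟩
    rintro _ ⟨p', hp', rfl⟩
    exact ⟨V, W, g, w, h, p', hg, rfl, hp'⟩

variable [∀ V, IsOpenImmersion (j V)]

/-- The locus is defined by the existence of an étale test morphism, which makes it open; by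
independence of the test it can be read off on an arbitrary one. -/
lemma mem_factorsLocus_iff (hS : IsAlgebraicSpace S)
    (hr : ∀ {V' V : Chart S} (c : V'.Hom V) (p : G.obj V'),
      G.map c p ∈ Set.range (j V) ↔ p ∈ Set.range (j V'))
    (z : yon.obj T ⟶ G.glue) {V : Chart S} {W : Scheme.{u}} (g : W ⟶ T)
    (w : W ⟶ Spec V.ring) (h) (p : W) : g p ∈ factorsLocus hf j z ↔
      (pointEquiv z).map V W g w h p ∈ Set.range (j V) := by
  constructor
  · rintro ⟨V', W', g', w', h', p', -, e, hp'⟩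
    exact (mem_range_iff_of_eq hr z g' g w' w h' h p' p e).1 hp'
  · intro hp
    obtain ⟨V', W', g', w', hg', h', p', e⟩ := hS.exists_chart (pointEquiv z).base (g p)
    exact ⟨V', W', g', w', h', p', hg', e,
      (mem_range_iff_of_eq hr z g' g w' w h' h p' p e).2 hp⟩

/-- The universal property of the locus: it classifies the morphisms to T along which z lifts. -/
lemma factorsThrough_comp_iff (hS : IsAlgebraicSpace S)
    (hr : ∀ {V' V : Chart S} (c : V'.Hom V) (p : G.obj V'),
      G.map c p ∈ Set.range (j V) ↔ p ∈ Set.range (j V'))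
    (z : yon.obj T ⟶ G.glue) {T' : Scheme.{u}} (k : T' ⟶ T) :
    FactorsThrough hf G j (yon.map k ≫ z) ↔ Set.range k ⊆ factorsLocus hf j z := by
  constructor
  · rintro hz _ ⟨t, rfl⟩
    obtain ⟨V, W, g, w, hg, h, p, rfl⟩ := hS.exists_chart (yon.map k ≫ (pointEquiv z).base) t
    have h' : yon.map (g ≫ k) ≫ (pointEquiv z).base = yon.map w ≫ V.pt := by
      rw [Functor.map_comp_assoc, h]
    have h'' : yon.map g ≫ (pointEquiv (yon.map k ≫ z)).base = yon.map w ≫ V.pt := by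
      rw [pointEquiv_comp_base, h]
    have hp := hz V W g w h'' p
    rw [pointEquiv_comp_map k z g w h'' h'] at hp
    rw [← Scheme.Hom.comp_apply]
    exact (mem_factorsLocus_iff hS hr z (g ≫ k) w h' p).2 hp
  · intro hk V W g w h p
    have h' : yon.map (g ≫ k) ≫ (pointEquiv z).base = yon.map w ≫ V.pt := by
      rw [Functor.map_comp_assoc, ← pointEquiv_comp_base, h]
    rw [pointEquiv_comp_map k z g w h h']
    refine (mem_factorsLocus_iff hS hr z (g ≫ k) w h' p).1 ?_
    rw [Scheme.Hom.comp_apply]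
    exact hk ⟨g p, rfl⟩

/-- The pullback of j along z is the open subscheme U of T where z factors. Restricted to U, z lifts
to x, and a morphism to T along which z lifts lands in U. -/
lemma toGlue_relative_isOpenImmersion (hS : IsAlgebraicSpace S)
    (hj : ∀ V, j V ≫ G.toBase V = XV.snd hf V)
    (hc : ∀ {V' V : Chart S} (c : V'.Hom V), j V' ≫ G.map c = XV.map hf c ≫ j V)
    (hr : ∀ {V' V : Chart S} (c : V'.Hom V) (p : G.obj V'),
      G.map c p ∈ Set.range (j V) ↔ p ∈ Set.range (j V')) :
    MorphismProperty.relative yon @IsOpenImmersion (toGlue hf G j hj hc) := by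
  refine MorphismProperty.relative.of_exists fun T z => ?_
  let U := factorsLocus hf j z
  have hU : FactorsThrough hf G j (yon.map U.ι ≫ z) := by
    rw [factorsThrough_comp_iff hS hr]
    exact (Scheme.Opens.range_ι U).le
  obtain ⟨x, hx⟩ := hU.exists_lift hj hc hS
  refine ⟨U, x, U.ι, ?_, inferInstance⟩
  refine isPullback_of_forall_existsUnique hx fun T' y k hy => ?_
  obtain ⟨k, rfl⟩ := yon.map_surjective k
  have hk : Set.range k ⊆ Set.range U.ι := by
    rw [Scheme.Opens.range_ι]
    refine (factorsThrough_comp_iff hS hr z k).1 ?_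
    rw [← hy]
    exact factorsThrough_comp_toGlue hf G j hj hc y
  -- The factorisation through U recovers y because j is injective on points, and it is unique
  -- because U ⟶ T is a monomorphism.
  refine ⟨yon.map (IsOpenImmersion.lift U.ι k hk), ⟨?_, ?_⟩, ?_⟩
  · apply comp_toGlue_injective hf G j hj hc hS
    rw [Category.assoc, hx, ← Functor.map_comp_assoc, IsOpenImmersion.lift_fac, hy]
  · rw [← Functor.map_comp, IsOpenImmersion.lift_fac]
  · rintro l ⟨-, hl⟩
    obtain ⟨l, rfl⟩ := yon.map_surjective l
    congr 1
    rw [← cancel_mono U.ι, IsOpenImmersion.lift_fac]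
    apply yon.map_injective
    rw [← hl, Functor.map_comp]

end Locus

end GaRees

namespace GaRees

open Polynomial AlgebraicGeometry CategoryTheory Limits Opposite ChartFamily

/-! ### Application to Proj_S R(X, μ) -/

section Rees

variable {X S : PSh.{u}} {f : X ⟶ S} (hf : AffineOver f)
  {smul : ∀ T : Scheme.{u}, Γ(T, ⊤) → (yon.obj T ⟶ X) → (yon.obj T ⟶ X)}
  (hμ : IsGaAction f smul)

instance (V : Chart S) : IsOpenImmersion (chartEmb hf hμ V) := by
  unfold chartEmb
  infer_instance

instance (V : Chart S) : IsDominant (chartEmb hf hμ V) := by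
  unfold chartEmb
  infer_instance

lemma mem_range_chartEmb_iff (V : Chart S) (p : Proj (chartD hf hμ V).reesGrading) :
    p ∈ Set.range (chartEmb hf hμ V) ↔
      p ∉ ProjectiveSpectrum.zeroLocus (chartD hf hμ V).reesGrading {(chartD hf hμ V).υ} := by
  have h : (chartEmb hf hμ V).opensRange =
      Proj.basicOpen (chartD hf hμ V).reesGrading (chartD hf hμ V).υ :=
    (Scheme.Hom.opensRange_comp_of_isIso (XV hf V).isoSpec.hom (chartD hf hμ V).openEmb).trans
      (LFIHD.opensRange_openEmb _)
  change p ∈ (chartEmb hf hμ V).opensRange ↔ _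
  rw [h]
  exact not_congr Set.singleton_subset_iff.symm

/-- A change of chart maps υ to υ, so the preimage of D₊(υ) is D₊(υ). This is the compatibility of
images required by `toGlue_relative_isOpenImmersion`. -/
lemma mem_range_chartEmb_iff_of_hom {V' V : Chart S} (c : V'.Hom V)
    (p : Proj (chartD hf hμ V').reesGrading) :
    (chartHom hf c hμ).proj p ∈ Set.range (chartEmb hf hμ V) ↔
      p ∈ Set.range (chartEmb hf hμ V') := by
  have h : (chartHom hf c hμ).rees (chartD hf hμ V).υ = (chartD hf hμ V').υ :=
    Subtype.ext (by rw [LFIHD.Hom.coe_rees, LFIHD.coe_υ, LFIHD.coe_υ, Polynomial.map_X])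
  rw [mem_range_chartEmb_iff, mem_range_chartEmb_iff, ← h]
  have h' : p ∈ (chartHom hf c hμ).proj ⁻¹ᵁ Proj.basicOpen _ (chartD hf hμ V).υ ↔
      p ∈ Proj.basicOpen _ ((chartHom hf c hμ).rees (chartD hf hμ V).υ) := by
    rw [LFIHD.Hom.proj, Proj.map_preimage_basicOpen]
  exact (not_congr Set.singleton_subset_iff).trans
    (h'.trans (not_congr Set.singleton_subset_iff.symm))

lemma avoidsVPlus_iff {T : Scheme.{u}} (z : yon.obj T ⟶ projRees hf hμ) :
    AvoidsVPlus hf hμ z ↔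
      FactorsThrough hf (reesFamily hf hμ) (chartEmb hf hμ) z := by
  unfold AvoidsVPlus FactorsThrough
  refine forall_congr' fun V => forall_congr' fun W => forall_congr' fun g =>
    forall_congr' fun w => forall_congr' fun h => forall_congr' fun p =>
      (mem_range_chartEmb_iff hf hμ V _).symm

lemma chartEmb_toBase (V : Chart S) :
    chartEmb hf hμ V ≫ (reesFamily hf hμ).toBase V = XV.snd hf V := by
  refine (Category.assoc _ _ _).symm.trans ?_
  exact (congrArg (· ≫ invStr hf hμ V) (chartEmb_reesToInv hf hμ V)).trans
    (chartQuot_invStr hf hμ V)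

/-- The same fact with the target written as a member of `reesFamily`, the form in which the results
on glued functors use it. -/
instance (V : Chart S) : @IsOpenImmersion (XV hf V) ((reesFamily hf hμ).obj V)
    (chartEmb hf hμ V) :=
  inferInstanceAs (IsOpenImmersion (chartEmb hf hμ V))

lemma toProjRees_relative_isOpenImmersion (hS : IsAlgebraicSpace S) :
    MorphismProperty.relative yon @IsOpenImmersion (toProjRees hf hμ) :=
  toGlue_relative_isOpenImmersion (G := reesFamily hf hμ) (j := chartEmb hf hμ) hS
    (chartEmb_toBase hf hμ) (fun c => chartEmb_naturality hf hμ c)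
    (fun c p => mem_range_chartEmb_iff_of_hom hf hμ c p)

lemma toProjRees_projReesToBase : toProjRees hf hμ ≫ projReesToBase hf hμ = f :=
  toGlue_glueToBase hf (reesFamily hf hμ) (chartEmb hf hμ) (chartEmb_toBase hf hμ)
    (fun c => chartEmb_naturality hf hμ c)

/-- Avoiding V₊(υ) means landing in D₊(υ), the image of j over each chart, so lifting is the descent
statement for glued functors. -/
lemma exists_comp_toProjRees_iff (hS : IsAlgebraicSpace S) {T : Scheme.{u}}
    (z : yon.obj T ⟶ projRees hf hμ) :
    (∃ x : yon.obj T ⟶ X, x ≫ toProjRees hf hμ = z) ↔ AvoidsVPlus hf hμ z := by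
  rw [avoidsVPlus_iff]
  constructor
  · rintro ⟨x, rfl⟩
    exact factorsThrough_comp_toGlue hf (reesFamily hf hμ) (chartEmb hf hμ)
      (chartEmb_toBase hf hμ) (fun c => chartEmb_naturality hf hμ c) x
  · intro hz
    exact FactorsThrough.exists_lift (G := reesFamily hf hμ) (j := chartEmb hf hμ)
      (chartEmb_toBase hf hμ) (fun c => chartEmb_naturality hf hμ c) hz hS

section Action

variable {T : Scheme.{u}} (a : Γ(T, ⊤)) (z : yon.obj T ⟶ projRees hf hμ)

lemma pointEquiv_projReesSMul_base :
    (pointEquiv (G := reesFamily hf hμ) (projReesSMul hf hμ T a z)).base =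
      (pointEquiv (G := reesFamily hf hμ) z).base := by
  rw [projReesSMul, Equiv.apply_symm_apply]

lemma pointEquiv_projReesSMul_map (V : Chart S) (W : Scheme.{u}) (g : W ⟶ T)
    (w : W ⟶ Spec V.ring) (h h') :
    (pointEquiv (G := reesFamily hf hμ) (projReesSMul hf hμ T a z)).map V W g w h =
      (chartD hf hμ V).reesAct (g.appTop a)
        ((pointEquiv (G := reesFamily hf hμ) z).map V W g w h') :=
  Point.map_eq (pointEquiv.apply_symm_apply _) _ _

lemma projReesSMul_projReesToInv :
    projReesSMul hf hμ T a z ≫ projReesToInv hf hμ = z ≫ projReesToInv hf hμ := by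
  refine (pointEquiv (G := invFamily hf hμ)).injective (Point.ext ?_ fun V W g w h h' => ?_)
  · exact pointEquiv_projReesSMul_base hf hμ a z
  · refine (congrArg (· ≫ (chartD hf hμ V).reesToInv)
      (pointEquiv_projReesSMul_map hf hμ a z V W g w h h')).trans ?_
    exact LFIHD.reesAct_reesToInv _ _

end Action

/-- A point is determined by its base, which the action fixes, and by its components, on which the
axioms are those of the action on Proj R(V). The component along g is moved by the pullback of a
along g. -/
lemma isGaAction_projReesSMul : IsGaAction (projReesToBase hf hμ) (projReesSMul hf hμ) where
  zero_smul T z := by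
    refine (pointEquiv (G := reesFamily hf hμ)).injective (Point.ext ?_ fun V W g w h h' => ?_)
    · exact pointEquiv_projReesSMul_base hf hμ 0 z
    · rw [pointEquiv_projReesSMul_map hf hμ 0 z V W g w h h', map_zero]
      exact projAct_zero _ _ _
  add_smul T a b z := by
    refine (pointEquiv (G := reesFamily hf hμ)).injective (Point.ext ?_ fun V W g w h h' => ?_)
    · rw [pointEquiv_projReesSMul_base, pointEquiv_projReesSMul_base,
        pointEquiv_projReesSMul_base]
    · have h1 := h
      rw [pointEquiv_projReesSMul_base] at h1
      have h2 := h'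
      rw [pointEquiv_projReesSMul_base] at h2
      rw [pointEquiv_projReesSMul_map hf hμ (a + b) z V W g w h h1,
        pointEquiv_projReesSMul_map hf hμ a _ V W g w h' h2,
        pointEquiv_projReesSMul_map hf hμ b z V W g w h2 h1, map_add]
      exact projAct_add _ _ _ _ _
  smul_comp T a z := by
    refine (comp_glueToBase _).trans (Eq.trans ?_ (comp_glueToBase _).symm)
    exact pointEquiv_projReesSMul_base hf hμ a z
  naturality T T' k a z := by
    refine (pointEquiv (G := reesFamily hf hμ)).injective (Point.ext ?_ fun V W g w h h' => ?_)
    · rw [pointEquiv_projReesSMul_base]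
      refine (pointEquiv_comp_base k _).trans (Eq.trans ?_ (pointEquiv_comp_base k _).symm)
      rw [pointEquiv_projReesSMul_base]
    · have h1 := h'
      rw [pointEquiv_projReesSMul_base] at h1
      have h2 : yon.map (g ≫ k) ≫ (pointEquiv (G := reesFamily hf hμ) z).base =
          yon.map w ≫ V.pt := by
        rw [← h1, Functor.map_comp, Category.assoc]
        exact congrArg (yon.map g ≫ ·) (pointEquiv_comp_base k z).symm
      have h3 : yon.map (g ≫ k) ≫ (pointEquiv (G := reesFamily hf hμ)
          (projReesSMul hf hμ T a z)).base = yon.map w ≫ V.pt := by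
        rw [pointEquiv_projReesSMul_base, h2]
      refine (pointEquiv_comp_map k _ g w h h3).trans ?_
      rw [pointEquiv_projReesSMul_map hf hμ a z V W (g ≫ k) w h3 h2,
        pointEquiv_projReesSMul_map hf hμ (k.appTop a) _ V W g w h' h1,
        Scheme.Hom.comp_appTop]
      exact congrArg _ (pointEquiv_comp_map k z g w h1 h2).symm

/-- Inherited from `chartEmb` by composing with the natural morphism Proj R ⟶ Spec A₀. -/
lemma chartQuot_naturality {V' V : Chart S} (c : V'.Hom V) :
    chartQuot hf hμ V' ≫ Spec.map (CommRingCat.ofHom (chartHom hf c hμ).inv) =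
      XV.map hf c ≫ chartQuot hf hμ V := by
  rw [← chartEmb_reesToInv, ← chartEmb_reesToInv, Category.assoc,
    ← (chartHom hf c hμ).proj_reesToInv, ← Category.assoc, ← Category.assoc,
    chartEmb_naturality]

lemma toProjRees_projReesToInv : toProjRees hf hμ ≫ projReesToInv hf hμ = toSpecInv hf hμ := by
  have hc : ∀ {V' V : Chart S} (c : V'.Hom V), chartEmb hf hμ V' ≫ (reesFamily hf hμ).map c =
    XV.map hf c ≫ chartEmb hf hμ V := fun c => chartEmb_naturality hf hμ c
  have hc' : ∀ {V' V : Chart S} (c : V'.Hom V), chartQuot hf hμ V' ≫ (invFamily hf hμ).map c =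
      XV.map hf c ≫ chartQuot hf hμ V := fun c => chartQuot_naturality hf hμ c
  refine hom_ext_uliftYoneda.{u + 1} fun T x => ?_
  refine (pointEquiv (G := invFamily hf hμ)).injective (Point.ext ?_ fun V W g w h h' => ?_)
  · exact (pointEquiv_comp_toGlue_base hf (reesFamily hf hμ) (chartEmb hf hμ)
      (chartEmb_toBase hf hμ) hc x).trans (pointEquiv_comp_toGlue_base hf (invFamily hf hμ)
        (chartQuot hf hμ) (chartQuot_invStr hf hμ) hc' x).symm
  · have h1 : (yon.map g ≫ x) ≫ f = yon.map w ≫ V.pt := by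
      rw [← h', Category.assoc]
      exact congrArg (yon.map g ≫ ·) (pointEquiv_comp_toGlue_base hf (invFamily hf hμ)
        (chartQuot hf hμ) (chartQuot_invStr hf hμ) hc' x).symm
    refine Eq.trans ?_ (pointEquiv_comp_toGlue_map hf (invFamily hf hμ) (chartQuot hf hμ)
      (chartQuot_invStr hf hμ) hc' x V W g w h' h1).symm
    refine (congrArg (· ≫ (chartD hf hμ V).reesToInv) (pointEquiv_comp_toGlue_map hf
      (reesFamily hf hμ) (chartEmb hf hμ) (chartEmb_toBase hf hμ) hc x V W g w h h1)).trans ?_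
    refine (Category.assoc _ _ _).trans (congrArg _ (chartEmb_reesToInv hf hμ V))

lemma exp_chartD (V : Chart S) (s : coordRing hf V) :
    (chartD hf hμ V).exp s = coact hf hμ V s := by
  ext i
  rw [LFIHD.coeff_exp]
  rfl

/-- The pair (y, a) is a morphism k from W to Spec A(V)[t]. In terms of k the point is the
projection and the moved point is the co-action, so the universal case `reesAct_openEmb` applies. -/
lemma chartAct_chartEmb (V : Chart S) {W : Scheme.{u}} (a : Γ(W, ⊤)) (y : W ⟶ XV hf V) :
    chartAct hf hμ V a y ≫ chartEmb hf hμ V =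
      (chartD hf hμ V).reesAct a (y ≫ chartEmb hf hμ V) := by
  let φ : CommRingCat.of (coordRing hf V)[X] ⟶ Γ(W, ⊤) :=
    CommRingCat.ofHom (eval₂RingHom y.appTop.hom a)
  -- The morphism with y as its A(V)-part and t ↦ a; `h3` and `h4` recover y and a from it.
  let k : W ⟶ Spec (.of (coordRing hf V)[X]) := W.toSpecΓ ≫ Spec.map φ
  have h1 : k.appTop = (Scheme.ΓSpecIso _).hom ≫ φ := by
    rw [Scheme.Hom.comp_appTop, Scheme.toSpecΓ_appTop]
    exact Scheme.ΓSpecIso_naturality _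
  have h2 : ∀ (ψ : coordRing hf V ⟶ .of (coordRing hf V)[X]),
      (k ≫ Spec.map ψ ≫ (XV hf V).isoSpec.inv).appTop = ψ ≫ φ := by
    intro ψ
    rw [Scheme.Hom.comp_appTop, h1]
    refine (congrArg (· ≫ _) (specMap_isoSpec_inv_appTop (Y := XV hf V) _)).trans ?_
    rw [Category.assoc, Iso.inv_hom_id_assoc]
  have h3 : k ≫ Spec.map (CommRingCat.ofHom C) ≫ (XV hf V).isoSpec.inv = y := by
    apply ext_of_isAffine
    refine (h2 _).trans ?_
    ext s
    exact eval₂_C _ _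
  have h4 : k.appTop ((Scheme.ΓSpecIso (.of (coordRing hf V)[X])).inv Polynomial.X) = a := by
    rw [h1]
    refine (congrArg φ (CommRingCat.inv_hom_apply _ _)).trans ?_
    exact eval₂_X _ _
  -- The moved point is k followed by the co-action: a morphism to an affine scheme is determined by
  -- its effect on functions, given by `chartAct_appTop`.
  have h5 : k ≫ Spec.map (CommRingCat.ofHom (chartD hf hμ V).exp) ≫ (XV hf V).isoSpec.inv =
      chartAct hf hμ V a y := by
    apply ext_of_isAffine
    refine (h2 _).trans ?_
    ext s
    rw [chartAct_appTop, ← exp_chartD]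
    rfl
  have h6 := (chartD hf hμ V).reesAct_openEmb k
  rw [h4] at h6
  rw [← h5, chartEmb]
  simp only [Category.assoc, Iso.inv_hom_id_assoc]
  refine h6.symm.trans (congrArg _ ?_)
  conv_rhs => rw [← h3]
  simp only [Category.assoc, Iso.inv_hom_id_assoc]

/-- Equality of points is tested on components, where it becomes the equivariance of X ×_S V ⟶ Proj
R(V). -/
lemma smul_toProjRees {T : Scheme.{u}} (a : Γ(T, ⊤)) (x : yon.obj T ⟶ X) :
    smul T a x ≫ toProjRees hf hμ = projReesSMul hf hμ T a (x ≫ toProjRees hf hμ) := by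
  have hc : ∀ {V' V : Chart S} (c : V'.Hom V), chartEmb hf hμ V' ≫ (reesFamily hf hμ).map c =
    XV.map hf c ≫ chartEmb hf hμ V := fun c => chartEmb_naturality hf hμ c
  have hb : ∀ x : yon.obj T ⟶ X, (pointEquiv (G := reesFamily hf hμ)
      (x ≫ toProjRees hf hμ)).base = x ≫ f :=
    pointEquiv_comp_toGlue_base hf (reesFamily hf hμ) (chartEmb hf hμ) (chartEmb_toBase hf hμ) hc
  refine (pointEquiv (G := reesFamily hf hμ)).injective (Point.ext ?_ fun V W g w h h' => ?_)
  · rw [pointEquiv_projReesSMul_base]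
    exact (hb _).trans ((hμ.smul_comp T a x).trans (hb x).symm)
  · have h0 := h'
    rw [pointEquiv_projReesSMul_base] at h0
    have h1 : (yon.map g ≫ x) ≫ f = yon.map w ≫ V.pt := by
      rw [← h0, Category.assoc]
      exact congrArg (yon.map g ≫ ·) (hb x).symm
    have h2 : (yon.map g ≫ smul T a x) ≫ f = yon.map w ≫ V.pt := by
      rw [← h1, Category.assoc, hμ.smul_comp, Category.assoc]
    rw [pointEquiv_projReesSMul_map hf hμ a _ V W g w h' h0]
    refine (pointEquiv_comp_toGlue_map hf (reesFamily hf hμ) (chartEmb hf hμ)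
      (chartEmb_toBase hf hμ) hc (smul T a x) V W g w h h2).trans (Eq.trans ?_ (congrArg _
        (pointEquiv_comp_toGlue_map hf (reesFamily hf hμ) (chartEmb hf hμ)
        (chartEmb_toBase hf hμ) hc x V W g w h0 h1).symm))
    -- Lifting the moved point to X ×_S V is the same as moving the lift, by naturality of the
    -- action in the test scheme.
    refine Eq.trans (congrArg (· ≫ chartEmb hf hμ V) ?_) (chartAct_chartEmb hf hμ V _ _)
    refine XV.hom_ext hf ?_ ?_
    · rw [XV.lift_fst, chartAct, XV.lift_fst, XV.lift_fst, hμ.naturality]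
    · rw [XV.lift_snd, chartAct, XV.lift_snd, XV.lift_snd]

end Rees

end GaRees

theorem mainTheorem8 {S X : PSh.{u}} (hS : IsAlgebraicSpace S) (f : X ⟶ S) (hf : AffineOver f)
    (smul : ∀ T : Scheme.{u}, Γ(T, ⊤) → (yon.obj T ⟶ X) → (yon.obj T ⟶ X))
    (hμ : IsGaAction f smul) :
    -- `j` is an open immersion over `S`
    MorphismProperty.relative yon @IsOpenImmersion (toProjRees hf hμ) ∧
    toProjRees hf hμ ≫ projReesToBase hf hμ = f ∧
    -- the image of `j` is the complement of `V₊(υ)`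
    (∀ (T : Scheme.{u}) (z : yon.obj T ⟶ projRees hf hμ),
      (∃ x : yon.obj T ⟶ X, x ≫ toProjRees hf hμ = z) ↔ AvoidsVPlus hf hμ z) ∧
    -- `υR(D)` defines an action of the additive group on `Proj_S R(X, μ)` over `S`
    IsGaAction (projReesToBase hf hμ) (projReesSMul hf hμ) ∧
    -- `j` is equivariant
    (∀ (T : Scheme.{u}) (a : Γ(T, ⊤)) (x : yon.obj T ⟶ X),
      smul T a x ≫ toProjRees hf hμ = projReesSMul hf hμ T a (x ≫ toProjRees hf hμ)) ∧
    -- `j` is an equivariant completion relative to `X₀`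
    toProjRees hf hμ ≫ projReesToInv hf hμ = toSpecInv hf hμ ∧
    (∀ (T : Scheme.{u}) (a : Γ(T, ⊤)) (z : yon.obj T ⟶ projRees hf hμ),
      projReesSMul hf hμ T a z ≫ projReesToInv hf hμ = z ≫ projReesToInv hf hμ) ∧
    ∀ V : Chart S, IsDominant (chartEmb hf hμ V) ∧
      IsSeparated (chartD hf hμ V).reesToInv ∧
      ((chartD hf hμ V).invIncl.FiniteType → IsProper (chartD hf hμ V).reesToInv) := by
  exact ⟨toProjRees_relative_isOpenImmersion hf hμ hS, toProjRees_projReesToBase hf hμ,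
    fun T z => exists_comp_toProjRees_iff hf hμ hS z, isGaAction_projReesSMul hf hμ,
    fun T a x => smul_toProjRees hf hμ a x, toProjRees_projReesToInv hf hμ,
    fun T a z => projReesSMul_projReesToInv hf hμ a z,
    fun V => ⟨inferInstance, inferInstance, LFIHD.isProper_reesToInv _⟩⟩
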